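/- **Setting.** For $\sigma\in\mathbb R$ consider the Neumann problem $$-(2+\cos\xi)\,u''(\xi)+u(\xi)=-\sigma u(\xi)^2+g(\xi)\quad(0\le\xi\le\pi),\qquad u'(0)=u'(\pi)=0,\tag{1}$$ with $g(\xi)=\tfrac12+3\cos\xi+\tfrac12\cos2\xi$; a solution is a $C^2$ function on $[0,\pi]$ satisfying (1). For a real sequence $x=(x_k)_{k\ge0}$ and $s\in\mathbb N$ put $\omega_0^s=1$, $\omega_k^s=k^s$ $(k\ge1)$, $\|x\|_s=\sup_k|x_k|\omega_k^s$, $\Omega^s=\{x:\|x\|_s<\infty\}$, and $(x*y)_k=\sum_{j\in\mathbb Z}x_{|j|}y_{|k-j|}$. Write $u=\sum_{k\in\mathbb Z}x_{|k|}\cos(k\xi)$, so that (1) becomes $f(x)=0$ with $$f_k(x)=\lambda_kx_{k-1}+\mu_kx_k+\beta_kx_{k+1}+\sigma(x*x)_k-g_k ,$$ where $\lambda_k=\frac12(k-1)^2$ for $k\ge1$ (the $\lambda$-term is absent for $k=0$), $\mu_k=1+2k^2$, $\beta_0=1$, $\beta_k=\frac12(k+1)^2$ for $k\ge1$, and $g_0=\frac12$,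 $g_1=\frac32$, $g_2=\frac14$, $g_k=0$ for $k\ge3$. **Radii polynomials.** Let $m=M=20$, $L=100$, $s=2$, $C_1=2$, $\delta=\frac14\frac{(m+1)^2}{m^2+1/2}$, $\gamma=\frac12+\sqrt{\frac14-\delta^2}$, $\theta=\delta/\gamma$, $\eta=\frac1{\gamma(1-\theta^2)}$, $$\chi=\theta^{M/2}\tfrac M2\Big(\tfrac{m+M}m\Big)^4+\theta^{\sqrt M}\tfrac M2\,2^4+\tfrac1{1-\theta}\Big(\tfrac{m+M}{m+M-\sqrt M-1}\Big)^4 ,$$ $\delta_0=1$, $\delta_1=\mu_m$, $\delta_{n}=\mu_{m+n-1}\delta_{n-1}-\lambda_{m+n-1}\beta_{m+n-2}\delta_{n-2}$ for $n\ge2$, and $\tilde w=\sum_{l=0}^{L-1}\frac{1}{\delta_l\delta_{l+1}}\prod_{i=0}^{l-1}\beta_{m+i}\lambda_{m+i+1}$. Put $S=2\sum_{l=1}^{L}l^{-2}+2/L$ and $$\alpha_0=1+S,\qquad \alpha_k=2+S+\sum_{l=1}^{k-1}\tfrac{k^2}{l^2(k-l)^2}\ (1\le k<m),\qquad \alpha_m=2+S+2\big(\tfrac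 m{m-1}\big)^2+\tfrac{4\ln(m-2)}m+\tfrac{\pi^2-6}3 .$$ *Numerical data* are triples $(\sigma,\bar x,A)$ with $\sigma\in\mathbb R$, $\bar x\in\mathbb R^m$ (identified with $(\bar x_0,\dots,\bar x_{m-1},0,0,\dots)$) and $A=(A_{ij})_{0\le i,j<m}$ a real matrix. Let $\tilde K$ be the Jacobian matrix at $\bar x$ of $(f_0,\dots,f_{m-1})$ restricted to $\mathbb R^m$, with $\beta_{m-1}\lambda_m\tilde w$ subtracted from its last diagonal entry, and put $\rho_l=|f_{m+l}(\bar x)|/\mu_{m+l}$, $\rho=\eta\sum_{l=0}^{m-2}\theta^l\rho_l$, $a_i=\sum_{j<m}A_{ij}f_j(\bar x)$, $\kappa=\eta\lambda_m/\mu_m$. For $0\le i<m$ and $0\le k\le M$ define $$Y_i=|a_i|+\beta_{m-1}\rho|A_{i,m-1}|,\qquad Y_{m+k}=Y_{m-1}\,\kappa\theta^k+\begin{cases}\eta\sum_{l=0}^{m-2}\theta^{|k-l|}\rho_l,&k\le m-3,\\ \eta\sum_{l=0}^{m-2}\theta^{k-l}\rho_l,&k\ge m-2,\end{cases}$$ $$Z^1_i=\sum_{j<m}\frac{|(I-A\tilde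 K)_{ij}|}{\omega_j^2}+\frac{\beta_{m-1}\lambda_m\theta^{2L}}{\mu_m\omega_{m-1}^2(1-\theta^2)}|A_{i,m-1}|,\qquad Z^1_{m+k}=Z^1_{m-1}\kappa\theta^k .$$ For $c\in\mathbb R^m$ and $q\ge0$ define $$\mathcal B_i(c,q)=\sum_{j<m}|A_{ij}|c_j+\frac{\beta_{m-1}\eta q}{C_1(1-\theta)m^4}|A_{i,m-1}|,\qquad \mathcal B_{m+k}(c,q)=\mathcal B_{m-1}(c,q)\,\kappa\theta^k+\frac{\eta q}{C_1(m+k)^4}\Big(\chi_k+\frac\theta{1-\theta}\Big),$$ with $\chi_k=\sum_{l=0}^k\theta^{k-l}\big(\frac{m+k}{m+l}\big)^4$ for $k<M$ and $\chi_M=\chi$. Let $c^1_k=2|\sigma|\sum_{l=m-k}^{m-1}|\bar x_l|/\omega_{k+l}^2$ and $c^2_k=2|\sigma|\alpha_k/\omega_k^2$ for $0\le k<m$, and $q^1=2|\sigma|\alpha_m\|\bar x\|_2$, $q^2=2|\sigma|\alpha_m$. The radii polynomials are $$P_k(r)=Y_k+Z^1_k\,r+\mathcal B_k(c^1,q^1)\,r+\mathcal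 B_k(c^2,q^2)\,r^2-\frac r{\omega_k^2},\qquad 0\le k\le m+M .$$ **Theorem.** Let $r_0=10^{-10}$. For data $(\sigma,\bar x,A)$, say that $\hat x$ is *the unique true solution near $\bar x$* if $\hat x\in\Omega^2$, $\|\hat x-\bar x\|_2\le r_0$, $f(\hat x)=0$, the function $\sum_{k\in\mathbb Z}\hat x_{|k|}\cos(k\xi)$ solves (1), and no other $y\in\Omega^2$ with $\|y-\bar x\|_2\le r_0$ satisfies $f(y)=0$ or is the cosine coefficient sequence of a solution of (1). 1. For all numerical data $(\sigma,\bar x,A)$ such that $P_k(r_0)<0$ for all $0\le k\le m+M$, there is a unique true solution near $\bar x$. 2. There are numerical data $(\sigma_p,\bar x_p,A_p)$ indexed by $1350$ indices $p$, with $\sigma_p>0$ for $675$ of them and $\sigma_p<0$ for the other $675$, such that for every $p$ the radii polynomials $P_0,\dots,P_{m+M}$ are all negative on $[4\cdot10^{-11},10^{-4}]$ (in particular at $r_0$) and there is a unique true solution $\hat x_p$ near $\bar x_p$; the $1350$ solutions $\hat x_p$ are pairwise different, and for some value of $\sigma$ there are at least two of them, i.e. $\sigma_p=\sigma_q$ for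 some $p\ne q$. -/

import Mathlib

noncomputable section

namespace TridiagExample

open Real

/-! ### The sequence spaces -/

/-- The weight `ω_k^s`: `1` for `k = 0` and `k ^ s` for `k ≥ 1`. -/
def omega (s k : ℕ) : ℝ := if k = 0 then 1 else (k : ℝ) ^ s

/-- Membership in `Ω^s`: the weighted supremum of `x` is finite. -/
def MemOmega (s : ℕ) (x : ℕ → ℝ) : Prop :=
  BddAbove (Set.range fun k => |x k| * omega s k)

/-- The norm `‖x‖_s = sup_k |x_k| ω_k^s` (meaningful when `MemOmega s x`). -/
def normOmega (s : ℕ) (x : ℕ → ℝ) : ℝ := ⨆ k, |x k| * omega s k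

/-- The closed ball of radius `r` around `c` in `Ω^s`. -/
def ballOmega (s : ℕ) (c : ℕ → ℝ) (r : ℝ) : Set (ℕ → ℝ) :=
  {x | MemOmega s x ∧ MemOmega s (x - c) ∧ normOmega s (x - c) ≤ r}

/-- Discrete convolution of the symmetric extensions of `x` and `y` to `ℤ`. -/
def conv (x y : ℕ → ℝ) (k : ℕ) : ℝ := ∑' j : ℤ, x j.natAbs * y ((k : ℤ) - j).natAbs

/-! ### The boundary value problem and its formulation on cosine coefficients -/

/-- The forcing term `g`. -/
def g (ξ : ℝ) : ℝ := 1 / 2 + 3 * cos ξ + 1 / 2 * cos (2 * ξ)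

/-- Classical (`C²` on `[0, π]`) solutions of
`-(2 + cos ξ) u'' + u = -σ u² + g` on `[0, π]`, `u'(0) = u'(π) = 0`. -/
def IsNeumannSolution (σ : ℝ) (u : ℝ → ℝ) : Prop :=
  ContDiffOn ℝ 2 u (Set.Icc 0 π) ∧
  (∀ ξ ∈ Set.Icc (0 : ℝ) π,
    -(2 + cos ξ) * iteratedDerivWithin 2 u (Set.Icc 0 π) ξ + u ξ = -σ * u ξ ^ 2 + g ξ) ∧
  derivWithin u (Set.Icc 0 π) 0 = 0 ∧ derivWithin u (Set.Icc 0 π) π = 0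

/-- The function `u(ξ) = ∑_{k ∈ ℤ} x_{|k|} cos (k ξ)` with cosine coefficients `x`. -/
def cosSeries (x : ℕ → ℝ) (ξ : ℝ) : ℝ := ∑' k : ℤ, x k.natAbs * cos (k * ξ)

/-- Subdiagonal coefficients `λ_k` (used for `k ≥ 1` only). -/
def lam (k : ℕ) : ℝ := 1 / 2 * ((k : ℝ) - 1) ^ 2

/-- Diagonal coefficients `μ_k`. -/
def mu (k : ℕ) : ℝ := 1 + 2 * (k : ℝ) ^ 2

/-- Superdiagonal coefficients `β_k`. -/
def beta (k : ℕ) : ℝ := if k = 0 then 1 else 1 / 2 * ((k : ℝ) + 1) ^ 2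

/-- The tridiagonal linear part. -/
def linPart (x : ℕ → ℝ) (k : ℕ) : ℝ :=
  (if k = 0 then 0 else lam k * x (k - 1)) + mu k * x k + beta k * x (k + 1)

/-- The coefficients of `g = ∑_{k ∈ ℤ} g_{|k|} cos (k ξ)`. -/
def gCoeff : ℕ → ℝ
  | 0 => 1 / 2
  | 1 => 3 / 2
  | 2 => 1 / 4
  | _ => 0

/-- The nonlinear operator whose zeros are the coefficient sequences of solutions. -/
def f (σ : ℝ) (x : ℕ → ℝ) (k : ℕ) : ℝ := linPart x k + σ * conv x x k - gCoeff k

/-! ### Parameters: number of modes, tail parameter, computational parameter; `s = s_L = 2` -/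

/-- Number of Fourier modes kept in the numerical computation. -/
abbrev m : ℕ := 20

/-- Tail parameter of the estimates. -/
abbrev M : ℕ := 20

/-- Truncation parameter of the auxiliary series. -/
abbrev L : ℕ := 100

/-- The last index of the finite block. -/
abbrev last : Fin m := 19

/-- Numerical data: a parameter `σ`, an approximate zero `x̄ ∈ ℝ^m`, and an
(approximate inverse) matrix `A_m`. -/
structure NumData where
  σ : ℝ
  x : Fin m → ℝ
  A : Matrix (Fin m) (Fin m) ℝ

/-- The identification of `ℝ^m` with the sequences vanishing from index `m` on. -/
def extend (v : Fin m → ℝ) (k : ℕ) : ℝ := if h : k < m then v ⟨k, h⟩ else 0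

/-- The constant `C₁`, with `C₁ k² ≤ μ_k` for `k ≥ m`. -/
def C₁ : ℝ := 2

/-- The bound `δ` for `|λ_k / μ_k|` and `|β_k / μ_k|`, `k ≥ m`. -/
def delta : ℝ := 1 / 4 * (((m : ℝ) + 1) ^ 2 / ((m : ℝ) ^ 2 + 1 / 2))

def gamma : ℝ := 1 / 2 + √(1 / 4 - delta ^ 2)

def theta : ℝ := delta / gamma

def eta : ℝ := 1 / (gamma * (1 - theta ^ 2))

/-- The constant `χ(θ, m, M, s, s_L)` with `s + s_L = 4`. -/
def chi : ℝ :=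
  theta ^ ((M : ℝ) / 2) * ((M : ℝ) / 2) * (((m : ℝ) + M) / m) ^ 4
    + theta ^ √(M : ℝ) * ((M : ℝ) / 2) * 2 ^ 4
    + 1 / (1 - theta) * (((m : ℝ) + M) / ((m : ℝ) + M - √(M : ℝ) - 1)) ^ 4

/-- The leading principal minors `δ_n` of the tridiagonal tail `(λ, μ, β)_{k ≥ m}`. -/
def minor : ℕ → ℝ
  | 0 => 1
  | 1 => mu m
  | n + 2 => mu (m + n + 1) * minor (n + 1) - lam (m + n + 1) * beta (m + n) * minor n

/-- The truncation `w̃` (with `L` terms) of the series for the north-west entry of the inverse of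
the tridiagonal tail. -/
def wTilde : ℝ :=
  ∑ l ∈ Finset.range L,
    (∏ i ∈ Finset.range l, beta (m + i) * lam (m + i + 1)) / (minor l * minor (l + 1))

/-- The Jacobian matrix at `x̄` of the projection of `f` to the first `m` modes: its `j`-th column is
the projection of `Df(x̄) e_j`, where `Df(x̄) z = linPart z + 2 σ (x̄ * z)`. -/
def jac (d : NumData) : Matrix (Fin m) (Fin m) ℝ := fun i j =>
  linPart (Pi.single (j : ℕ) 1) i + 2 * d.σ * conv (extend d.x) (Pi.single (j : ℕ) 1) i

/-- The matrix `K̃`: the Jacobian corrected in its south-east entry. -/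
def KTilde (d : NumData) : Matrix (Fin m) (Fin m) ℝ :=
  jac d - Matrix.single last last (beta (m - 1) * lam m * wTilde)

/-- The constants of the convolution estimate in `Ω^s`, `s = 2`. -/
def alpha (k : ℕ) : ℝ :=
  if k = 0 then
    1 + 2 * ∑ l ∈ Finset.Icc 1 L, 1 / (l : ℝ) ^ 2 + 2 / (L : ℝ)
  else if k < m then
    2 + 2 * ∑ l ∈ Finset.Icc 1 L, 1 / (l : ℝ) ^ 2 + 2 / (L : ℝ)
      + ∑ l ∈ Finset.Icc 1 (k - 1), (k : ℝ) ^ 2 / ((l : ℝ) ^ 2 * ((k : ℝ) - l) ^ 2)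
  else
    2 + 2 * ∑ l ∈ Finset.Icc 1 L, 1 / (l : ℝ) ^ 2 + 2 / (L : ℝ)
      + 2 * ((m : ℝ) / ((m : ℝ) - 1)) ^ 2
      + (4 * log ((m : ℝ) - 2) / m + (π ^ 2 - 6) / 3)

/-! ### The bound `Y` on `T(x̄) - x̄`: finite block `YF`, and `YI k = Y_{m+k}` -/

/-- `|f(x̄)_{m+l}| / |μ_{m+l}|`. -/
def resid (d : NumData) (l : ℕ) : ℝ := |f d.σ (extend d.x) (m + l)| / |mu (m + l)|

/-- The vector `A_m f(x̄)_F`. -/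
def Af (d : NumData) (i : Fin m) : ℝ := ∑ j, d.A i j * f d.σ (extend d.x) j

def resid₀ (d : NumData) : ℝ := eta * ∑ l ∈ Finset.range (m - 1), theta ^ l * resid d l

def YF (d : NumData) (i : Fin m) : ℝ :=
  |Af d i| + |beta (m - 1)| * resid₀ d * |d.A i last|

def YI (d : NumData) (k : ℕ) : ℝ :=
  (|Af d last| + |beta (m - 1) * d.A last last| * resid₀ d) * (eta * theta ^ k * (|lam m| / |mu m|))
    + (if k ≤ m - 3 then
        eta * ∑ l ∈ Finset.range (k + 1), theta ^ (k - l) * resid d l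
          + eta * ∑ l ∈ Finset.Ico (k + 1) (m - 1), theta ^ (l - k) * resid d l
      else
        eta * theta ^ k * ∑ l ∈ Finset.range (m - 1), resid d l / theta ^ l)

/-! ### The bound `Z(r) = Z¹(r) + D¹ r + D² r²` on the derivative of `T` on the ball -/

/-- `Z¹_F = z1F · r`. -/
def z1F (d : NumData) (i : Fin m) : ℝ :=
  ∑ j, |(1 - d.A * KTilde d) i j| / omega 2 j
    + |beta (m - 1)| * |lam m| * theta ^ (2 * L) / (|mu m| * omega 2 (m - 1) * (1 - theta ^ 2))
      * |d.A i last|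

/-- `Z¹_{m+k} = z1I k · r`. -/
def z1I (d : NumData) (k : ℕ) : ℝ := z1F d last * (eta * theta ^ k * (|lam m| / |mu m|))

/-- A bound for the finite block of `|A| c`, if `c` has finite block `cF` and its tail satisfies
`|c_{m+k}| ≤ q / ω_{m+k}^2`. -/
def absAF (A : Matrix (Fin m) (Fin m) ℝ) (cF : Fin m → ℝ) (q : ℝ) (i : Fin m) : ℝ :=
  ∑ j, |A i j| * cF j + |beta (m - 1)| * eta * q / (C₁ * (1 - theta) * omega 4 m) * |A i last|

/-- A bound for the entry `m + k`, `k ≤ M`, of `|A| c` in the same situation. -/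
def absAI (A : Matrix (Fin m) (Fin m) ℝ) (cF : Fin m → ℝ) (q : ℝ) (k : ℕ) : ℝ :=
  absAF A cF q last * (eta * (|lam m| / |mu m|) * theta ^ k)
    + eta * q / (C₁ * omega 4 (m + k)) *
      ((if k < M then
          ∑ l ∈ Finset.range (k + 1), theta ^ (k - l) * (((m : ℝ) + k) / ((m : ℝ) + l)) ^ 4
        else chi) + theta / (1 - theta))

/-- Finite block of the first order bound `C¹(x̄)`. -/
def c1F (d : NumData) (k : Fin m) : ℝ :=
  2 * |d.σ| * ∑ l ∈ Finset.Ico (m - (k : ℕ)) m, |extend d.x l| / omega 2 ((k : ℕ) + l)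

/-- Finite block of the second order bound `C²`. -/
def c2F (d : NumData) (k : Fin m) : ℝ := 2 * |d.σ| * alpha k / omega 2 k

/-- Tail constant of `C¹(x̄)`. -/
def q1 (d : NumData) : ℝ := 2 * |d.σ| * alpha m * normOmega 2 (extend d.x)

/-- Tail constant of `C²`. -/
def q2 (d : NumData) : ℝ := 2 * |d.σ| * alpha m

def ZF (d : NumData) (r : ℝ) (i : Fin m) : ℝ :=
  z1F d i * r + absAF d.A (c1F d) (q1 d) i * r + absAF d.A (c2F d) (q2 d) i * r ^ 2

def ZI (d : NumData) (r : ℝ) (k : ℕ) : ℝ :=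
  z1I d k * r + absAI d.A (c1F d) (q1 d) k * r + absAI d.A (c2F d) (q2 d) k * r ^ 2

/-! ### Radii polynomials -/

/-- The radii polynomials `P_k`, `0 ≤ k < m`. -/
def radiiF (d : NumData) (i : Fin m) (r : ℝ) : ℝ := YF d i + ZF d r i - r / omega 2 i

/-- The radii polynomials `P_{m+k}`, `0 ≤ k ≤ M`. -/
def radiiI (d : NumData) (k : ℕ) (r : ℝ) : ℝ := YI d k + ZI d r k - r / omega 2 (m + k)

/-- All radii polynomials `P_0, …, P_{m+M}` are negative at `r`. -/
def RadiiNeg (d : NumData) (r : ℝ) : Prop :=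
  (∀ i, radiiF d i r < 0) ∧ ∀ k ≤ M, radiiI d k r < 0

/-- `x` lies in the closed ball of radius `r` around `x̄` in `Ω²`, is a zero of `f`, is the cosine
coefficient sequence of a solution of the Neumann problem, and no other element of the ball is a zero
of `f` or the coefficient sequence of a solution of the Neumann problem. -/
def IsUniqueTrueSolution (d : NumData) (r : ℝ) (x : ℕ → ℝ) : Prop :=
  x ∈ ballOmega 2 (extend d.x) r ∧ f d.σ x = 0 ∧ IsNeumannSolution d.σ (cosSeries x) ∧
  ∀ y ∈ ballOmega 2 (extend d.x) r,
    (f d.σ y = 0 ∨ IsNeumannSolution d.σ (cosSeries y)) → y = x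

end TridiagExample

end

noncomputable section
namespace TridiagExample
open Real

/-! ### Weights and weighted bounds -/

/-! The zero of `f` is the fixed point of the Newton-like map `newton d x = x - opA d.A (f d.σ x)`,
which contracts a closed ball around the approximate zero in the weighted supremum norm. The
off-diagonal entries of the linear part grow as fast as the diagonal, so the diagonal alone does not
serve as an approximate inverse of the tail. Instead the tridiagonal tail is inverted exactly
(`exists_tailOp_eq`, `tailInv`), and only upper bounds for this inverse are used. From index `m` on,
both off-diagonal entries are at most `δ < 1/2` times the diagonal. A comparison principle
(`abs_le_of_isSuper`) then bounds solutions of the tail equation by supersolutions of the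
constant-coefficient operator `tridiag (-δ, 1, -δ)`, and the Green function `η θ^{|k-l|}` supplies
these (`isSuper_greenSum`, `isSuper_geometric`). Eliminating the tail changes the finite Jacobian
only in its last diagonal entry, by `β_{m-1} λ_m` times the north-west entry of the tail inverse;
`wTilde` approximates that entry up to `abs_tailCol_sub_wTilde`.

As `f` is quadratic, `f x - f y` is exactly the derivative at the midpoint applied to `x - y`
(`f_sub`). Bounds for the identity minus `opA` composed with this derivative on the ball are
therefore Lipschitz bounds for `newton` (`newton_sub`). Negativity of a radii polynomial expresses
in one coordinate both that the ball is mapped into itself and that the Lipschitz constant is below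
one. Finitely many coordinates suffice, because beyond `m + M` the weighted bounds do not exceed
their value at `m + M` (`TailMono`). The same inequalities make the matrix `A` invertible, so fixed
points are zeros (`exists_unique_zero`). Zeros and classical solutions correspond by
`isNeumannSolution_of_zero`, a regularity argument, and `f_eq_zero_of_isNeumannSolution`,
integration by parts against cosines.

For the second assertion, `radiiNeg_of_smallDefect` treats all data at once: when `|σ|` is tiny the
nonlinear terms are negligible, and an almost diagonal `A` is a sufficient approximate inverse, so
only the smallness of `f` at the centre remains to be checked. All but one of the data come from a
quadratic Taylor polynomial in `σ` of the branch through `cos ξ` at `σ = 0`; integer arithmetic on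
its coefficients handles every `σ` simultaneously. The remaining one lies at `σ = -1/20000` near the
constant `-1/σ`, where the linearization is the linear part minus twice the identity; a branch point
with the same `σ` gives the second solution. Solutions differ because a zero determines `σ`
(`sigma_unique`), while the mean value separates the large solution from the branch (`mean_lt_iff`).
-/

lemma omega_pos (s k : ℕ) : 0 < omega s k := by
  unfold omega; split_ifs with h
  · exact one_pos
  · have : (0 : ℝ) < k := by exact_mod_cast Nat.pos_of_ne_zero h
    positivity

lemma omega_of_pos (s : ℕ) {k : ℕ} (h : 0 < k) : omega s k = (k : ℝ) ^ s := by
  simp [omega, h.ne']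

lemma omega_zero (s : ℕ) : omega s 0 = 1 := by simp [omega]

lemma one_le_omega (s k : ℕ) : 1 ≤ omega s k := by
  unfold omega; split_ifs with h
  · exact le_rfl
  · have : (1 : ℝ) ≤ k := by exact_mod_cast Nat.one_le_iff_ne_zero.mpr h
    exact one_le_pow₀ this

lemma omega_mono (s : ℕ) {k l : ℕ} (h : k ≤ l) : omega s k ≤ omega s l := by
  rcases Nat.eq_zero_or_pos k with rfl | hk
  · rw [omega_zero]; exact one_le_omega s l
  · rw [omega_of_pos s hk, omega_of_pos s (hk.trans_le h)]
    have : (k : ℝ) ≤ l := by exact_mod_cast h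
    gcongr

/-- `x` is dominated by `a / ω²`, i.e. `‖x‖_2 ≤ a`. -/
def Dominated (x : ℕ → ℝ) (a : ℝ) : Prop := ∀ k, |x k| ≤ a / omega 2 k

lemma Dominated.nonneg {x : ℕ → ℝ} {a : ℝ} (h : Dominated x a) : 0 ≤ a := by
  have := (abs_nonneg _).trans (h 0)
  simpa [omega_zero] using this

lemma Dominated.add {x y : ℕ → ℝ} {a b : ℝ} (hx : Dominated x a) (hy : Dominated y b) :
    Dominated (x + y) (a + b) := fun k => by
  rw [add_div]; exact (abs_add_le _ _).trans (add_le_add (hx k) (hy k))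

lemma Dominated.smul {x : ℕ → ℝ} {a : ℝ} (hx : Dominated x a) (c : ℝ) :
    Dominated (c • x) (|c| * a) := fun k => by
  simp only [Pi.smul_apply, smul_eq_mul, abs_mul, mul_div_assoc]
  exact mul_le_mul_of_nonneg_left (hx k) (abs_nonneg c)

lemma Dominated.neg {x : ℕ → ℝ} {a : ℝ} (hx : Dominated x a) : Dominated (-x) a := fun k => by
  simpa using hx k

lemma Dominated.sub {x y : ℕ → ℝ} {a b : ℝ} (hx : Dominated x a) (hy : Dominated y b) :
    Dominated (x - y) (a + b) := by
  rw [sub_eq_add_neg]; exact hx.add hy.neg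

lemma Dominated.abs_le {x : ℕ → ℝ} {a : ℝ} (hx : Dominated x a) (k : ℕ) : |x k| ≤ a :=
  (hx k).trans (div_le_self hx.nonneg (one_le_omega 2 k))

lemma dominated_iff {x : ℕ → ℝ} {a : ℝ} : Dominated x a ↔ ∀ k, |x k| * omega 2 k ≤ a :=
  forall_congr' fun k => le_div_iff₀ (omega_pos 2 k)

lemma MemOmega.dominated {x : ℕ → ℝ} (h : MemOmega 2 x) : Dominated x (normOmega 2 x) :=
  dominated_iff.2 fun k => le_ciSup h k

lemma Dominated.memOmega {x : ℕ → ℝ} {a : ℝ} (h : Dominated x a) : MemOmega 2 x :=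
  ⟨a, by rintro _ ⟨k, rfl⟩; exact dominated_iff.1 h k⟩

lemma Dominated.normOmega_le {x : ℕ → ℝ} {a : ℝ} (h : Dominated x a) : normOmega 2 x ≤ a :=
  ciSup_le (dominated_iff.1 h)

lemma dominated_of_support {x : ℕ → ℝ} (N : ℕ) (h : ∀ k, N ≤ k → x k = 0) :
    ∃ a, Dominated x a := by
  refine ⟨∑ k ∈ Finset.range N, |x k| * omega 2 k, dominated_iff.2 fun k => ?_⟩
  have h0 : ∀ k, 0 ≤ |x k| * omega 2 k := fun k => mul_nonneg (abs_nonneg _) (omega_pos 2 k).le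
  by_cases hk : k < N
  · exact Finset.single_le_sum (f := fun k => |x k| * omega 2 k) (fun i _ => h0 i)
      (Finset.mem_range.2 hk)
  · rw [h k (not_lt.1 hk)]; simpa using Finset.sum_nonneg fun i _ => h0 i

lemma extend_of_le (v : Fin m → ℝ) {k : ℕ} (h : m ≤ k) : extend v k = 0 := by
  simp [extend, not_lt.2 h]

lemma extend_val (v : Fin m → ℝ) (i : Fin m) : extend v i = v i := by
  unfold extend; rw [dif_pos i.2]

lemma memOmega_extend (v : Fin m → ℝ) : MemOmega 2 (extend v) :=
  (dominated_of_support m fun _ hk => extend_of_le v hk).choose_spec.memOmega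

/-- Replaces suprema by coordinatewise bounds. Membership of `x` itself in `Ω²` is automatic, since
the centre has finite support. -/
lemma mem_ballOmega_iff {v : Fin m → ℝ} {x : ℕ → ℝ} {r : ℝ} :
    x ∈ ballOmega 2 (extend v) r ↔ Dominated (x - extend v) r := by
  constructor
  · rintro ⟨_, h1, h2⟩ k
    exact (h1.dominated k).trans (div_le_div_of_nonneg_right h2 (omega_pos 2 k).le)
  · intro h
    refine ⟨?_, h.memOmega, h.normOmega_le⟩
    have := h.add (memOmega_extend v).dominated
    rw [sub_add_cancel] at this
    exact this.memOmega

/-! ### Convolution -/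

lemma summable_inv_omega : Summable fun j : ℤ => 1 / omega 2 j.natAbs := by
  have h : Summable fun k : ℕ => 1 / omega 2 k := by
    rw [← summable_nat_add_iff 1]
    have := (summable_nat_add_iff 1).2 (Real.summable_one_div_nat_pow.2 (one_lt_two))
    refine this.congr fun k => ?_
    rw [omega_of_pos 2 (Nat.succ_pos k)]
  exact Summable.of_nat_of_neg (by simpa using h) (by simpa using h)

lemma Dominated.summable {x : ℕ → ℝ} {a : ℝ} (h : Dominated x a) :
    Summable fun j : ℤ => x j.natAbs := by
  refine Summable.of_norm_bounded (summable_inv_omega.mul_left a) fun j => ?_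
  simpa [div_eq_mul_inv] using h j.natAbs

lemma summable_conv {x y : ℕ → ℝ} {b : ℝ} (hx : Summable fun j : ℤ => x j.natAbs)
    (hy : ∀ k, |y k| ≤ b) (k : ℤ) :
    Summable fun j : ℤ => x j.natAbs * y (k - j).natAbs := by
  refine Summable.of_norm_bounded (hx.norm.mul_left b) fun j => ?_
  rw [norm_mul, mul_comm]
  exact mul_le_mul_of_nonneg_right (hy _) (norm_nonneg _)

lemma conv_comm (x y : ℕ → ℝ) : conv x y = conv y x := by
  funext k
  unfold conv
  rw [← (Equiv.subLeft (k : ℤ)).tsum_eq]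
  refine tsum_congr fun j => ?_
  simp [mul_comm]

lemma conv_add_right {x y z : ℕ → ℝ} {a b c : ℝ} (hx : Dominated x a) (hy : Dominated y b)
    (hz : Dominated z c) : conv x (y + z) = conv x y + conv x z := by
  funext k
  simp only [conv, Pi.add_apply, mul_add]
  exact Summable.tsum_add (summable_conv hx.summable hy.abs_le k)
    (summable_conv hx.summable hz.abs_le k)

lemma conv_smul_right (x y : ℕ → ℝ) (c : ℝ) : conv x (c • y) = c • conv x y := by
  funext k
  simp only [conv, Pi.smul_apply, smul_eq_mul, ← tsum_mul_left]
  exact tsum_congr fun j => by ring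

lemma conv_add_left {x y z : ℕ → ℝ} {a b c : ℝ} (hx : Dominated x a) (hy : Dominated y b)
    (hz : Dominated z c) : conv (x + y) z = conv x z + conv y z := by
  rw [conv_comm, conv_add_right hz hx hy, conv_comm z, conv_comm z]

lemma conv_smul_left (x y : ℕ → ℝ) (c : ℝ) : conv (c • x) y = c • conv x y := by
  rw [conv_comm, conv_smul_right, conv_comm]

/-- Bilinearity and commutativity. Domination provides the summability without which the series
could not be added termwise. -/
lemma conv_sq_sub {x y : ℕ → ℝ} {a b : ℝ} (hx : Dominated x a) (hy : Dominated y b) :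
    conv x x - conv y y = conv (x + y) (x - y) := by
  have h1 := conv_add_left hx hy (hx.sub hy)
  have h2 := conv_add_right hx hx ((hy.smul (-1)))
  have h3 := conv_add_right hy hx ((hy.smul (-1)))
  rw [conv_smul_right] at h2 h3
  have e : x - y = x + (-1 : ℝ) • y := by simp [sub_eq_add_neg]
  rw [h1, e, h2, h3, conv_comm y x]
  simp [sub_eq_add_neg]

/-- The reciprocal weights `1 / ω²`. -/
def weight (k : ℕ) : ℝ := 1 / omega 2 k

/-- The convolution of the weights `1 / ω²` with themselves. -/
def weightConv (k : ℕ) : ℝ := conv weight weight k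

lemma dominated_weight : Dominated weight 1 := fun k => by
  unfold weight
  rw [abs_of_nonneg (by have := omega_pos 2 k; positivity)]

lemma summable_weight_mul (k : ℕ) : Summable fun j : ℤ =>
    1 / omega 2 j.natAbs * (1 / omega 2 ((k : ℤ) - j).natAbs) :=
  summable_conv (x := weight) (y := weight) dominated_weight.summable dominated_weight.abs_le k

lemma abs_conv_le_weightConv {x y : ℕ → ℝ} {a b : ℝ} (hx : Dominated x a) (hy : Dominated y b)
    (k : ℕ) : |conv x y k| ≤ a * b * weightConv k := by
  have hs := (summable_weight_mul k).mul_left (a * b)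
  have hb : ∀ j : ℤ, ‖x j.natAbs * y ((k : ℤ) - j).natAbs‖ ≤
      a * b * (1 / omega 2 j.natAbs * (1 / omega 2 ((k : ℤ) - j).natAbs)) := fun j => by
    rw [norm_mul]
    calc _ ≤ (a / omega 2 j.natAbs) * (b / omega 2 ((k : ℤ) - j).natAbs) :=
          mul_le_mul (hx _) (hy _) (abs_nonneg _) ((abs_nonneg _).trans (hx _))
      _ = _ := by ring
  have := tsum_of_norm_bounded hs.hasSum hb
  rw [tsum_mul_left] at this
  exact this

/-- Telescoping with `1/(t+1)² ≤ 1/t - 1/(t+1)`; this is the origin of the term `2 / L` in `alpha`.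
-/
lemma sum_inv_sq_le (a : ℕ) (ha : 0 < a) (N : ℕ) :
    ∑ n ∈ Finset.range N, 1 / ((a : ℝ) + n + 1) ^ 2 ≤ 1 / a - 1 / ((a : ℝ) + N) := by
  have ha' : (0 : ℝ) < a := by exact_mod_cast ha
  induction N with
  | zero => simp
  | succ n ih =>
    rw [Finset.sum_range_succ]
    have h : 1 / ((a : ℝ) + n + 1) ^ 2 ≤ 1 / ((a : ℝ) + n) - 1 / ((a : ℝ) + (n + 1 : ℕ)) := by
      push_cast
      rw [div_sub_div _ _ (by positivity) (by positivity), div_le_div_iff₀ (by positivity)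
        (by positivity)]
      nlinarith [show (0 : ℝ) ≤ a + n by positivity]
    linarith

lemma summable_inv_succ_sq : Summable fun n : ℕ => 1 / ((n : ℝ) + 1) ^ 2 := by
  have := (summable_nat_add_iff 1).2 (Real.summable_one_div_nat_pow.2 (one_lt_two))
  exact this.congr fun k => by push_cast; rfl

lemma tsum_inv_succ_sq_le : ∑' n : ℕ, 1 / ((n : ℝ) + 1) ^ 2 ≤
    ∑ l ∈ Finset.Icc 1 L, 1 / (l : ℝ) ^ 2 + 1 / (L : ℝ) := by
  rw [← summable_inv_succ_sq.sum_add_tsum_nat_add L]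
  have e : ∑ i ∈ Finset.range L, 1 / ((i : ℝ) + 1) ^ 2 = ∑ l ∈ Finset.Icc 1 L, 1 / (l : ℝ) ^ 2 := by
    rw [Finset.range_eq_Ico]
    refine Eq.trans (Finset.sum_congr rfl fun i _ => ?_)
      (Finset.sum_Ico_add' (fun i : ℕ => 1 / (i : ℝ) ^ 2) 0 L 1)
    push_cast; rfl
  rw [e]
  gcongr
  refine Real.tsum_le_of_sum_range_le (fun n => by positivity) fun N => ?_
  refine le_trans (le_of_eq ?_) ((sum_inv_sq_le L (by norm_num) N).trans
    (sub_le_self _ (by positivity)))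
  exact Finset.sum_congr rfl fun i _ => by push_cast; ring

/-- The interior part of the convolution sum. -/
def innerSum (k : ℕ) : ℝ :=
  ∑ l ∈ Finset.Icc 1 (k - 1), (k : ℝ) ^ 2 / ((l : ℝ) ^ 2 * ((k : ℝ) - l) ^ 2)

lemma tsum_int_split {F : ℤ → ℝ} (hF : Summable F) :
    (Summable fun n : ℕ => F n) ∧ (Summable fun n : ℕ => F (-((n : ℤ) + 1))) ∧
      ∑' j, F j = ∑' n : ℕ, F n + ∑' n : ℕ, F (-((n : ℤ) + 1)) := by
  have h1 : Summable fun n : ℕ => F n := hF.comp_injective Nat.cast_injective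
  have h2 : Summable fun n : ℕ => F (-((n : ℤ) + 1)) :=
    hF.comp_injective (i := fun n : ℕ => -((n : ℤ) + 1)) fun a b h => by simpa using h
  exact ⟨h1, h2, tsum_of_nat_of_neg_add_one h1 h2⟩

/-- The summands are fourth inverse powers; they are weakened to inverse squares so that the same
sum appears as for `k ≥ 1`. -/
lemma weightConv_zero_le : weightConv 0 ≤ 1 + 2 * ∑' n : ℕ, 1 / ((n : ℝ) + 1) ^ 2 := by
  unfold weightConv conv weight
  have hs' := summable_weight_mul 0
  have key : ∀ n : ℕ, 1 / omega 2 (n + 1) * (1 / omega 2 (n + 1)) ≤ 1 / ((n : ℝ) + 1) ^ 2 := by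
    intro n
    rw [omega_of_pos 2 n.succ_pos]
    push_cast
    refine mul_le_of_le_one_right (by positivity) ?_
    rw [div_le_one (by positivity)]
    exact one_le_pow₀ (by linarith [show (0 : ℝ) ≤ n by positivity])
  rw [(tsum_int_split hs').2.2]
  have e1 : ∀ n : ℕ, (1 / omega 2 (n : ℤ).natAbs * (1 / omega 2 ((0 : ℕ) - (n : ℤ)).natAbs)) =
    1 / omega 2 n * (1 / omega 2 n) := fun n => by simp
  have e2 : ∀ n : ℕ, (1 / omega 2 (-((n : ℤ) + 1)).natAbs *
      (1 / omega 2 ((0 : ℕ) - (-((n : ℤ) + 1))).natAbs)) =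
    1 / omega 2 (n + 1) * (1 / omega 2 (n + 1)) := fun n => by
      have : (-((n : ℤ) + 1)).natAbs = n + 1 := by omega
      have h' : (((0 : ℕ) : ℤ) - (-((n : ℤ) + 1))).natAbs = n + 1 := by omega
      rw [this, h']
  simp_rw [e1, e2]
  have s1 : Summable fun n : ℕ => 1 / omega 2 (n + 1) * (1 / omega 2 (n + 1)) :=
    Summable.of_nonneg_of_le (fun n => by have := omega_pos 2 (n + 1); positivity) key
      summable_inv_succ_sq
  have s0 : Summable fun n : ℕ => 1 / omega 2 n * (1 / omega 2 n) := (summable_nat_add_iff 1).1 s1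
  rw [s0.tsum_eq_zero_add, omega_zero]
  have := s1.tsum_le_tsum key summable_inv_succ_sq
  linarith

/-- Split `ℤ` into `j < 0`, `0 ≤ j ≤ k` and `j > k`. On each outer range one of the two factors is
at most `1/k²`, leaving a sum of inverse squares. The endpoints `0` and `k` give `2/k²`, and the
interior is `innerSum`. -/
lemma weightConv_le {k : ℕ} (hk : 0 < k) : weightConv k ≤
    (2 + 2 * ∑' n : ℕ, 1 / ((n : ℝ) + 1) ^ 2 + innerSum k) / (k : ℝ) ^ 2 := by
  have hk' : (0 : ℝ) < k := by exact_mod_cast hk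
  unfold weightConv conv weight
  have hs := summable_weight_mul k
  obtain ⟨hs1, hs2, e⟩ := tsum_int_split hs
  rw [e]
  rw [← hs1.sum_add_tsum_nat_add (k + 1)]
  have hs3 := (summable_nat_add_iff (k + 1)).2 hs1
  have key : ∀ n : ℕ, 1 / ((n : ℝ) + 1) ^ 2 * (1 / ((n : ℝ) + 1 + k) ^ 2) ≤
      (1 / (k : ℝ) ^ 2) * (1 / ((n : ℝ) + 1) ^ 2) := fun n => by
    rw [mul_comm]; gcongr; linarith [show (0 : ℝ) ≤ n by positivity]
  have t1 : ∑' n : ℕ, 1 / omega 2 ((n + (k + 1) : ℕ) : ℤ).natAbs *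
      (1 / omega 2 ((k : ℤ) - (n + (k + 1) : ℕ)).natAbs) ≤
      (1 / (k : ℝ) ^ 2) * ∑' n : ℕ, 1 / ((n : ℝ) + 1) ^ 2 := by
    rw [← tsum_mul_left]
    refine hs3.tsum_le_tsum (fun n => ?_) (summable_inv_succ_sq.mul_left _)
    have a1 : ((n + (k + 1) : ℕ) : ℤ).natAbs = n + 1 + k := by omega
    have a2 : ((k : ℤ) - (n + (k + 1) : ℕ)).natAbs = n + 1 := by omega
    rw [a1, a2, omega_of_pos 2 (by omega), omega_of_pos 2 (by omega), mul_comm]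
    push_cast
    exact key n
  have t2 : ∑' n : ℕ, 1 / omega 2 (-((n : ℤ) + 1)).natAbs *
      (1 / omega 2 ((k : ℤ) - (-((n : ℤ) + 1))).natAbs) ≤
      (1 / (k : ℝ) ^ 2) * ∑' n : ℕ, 1 / ((n : ℝ) + 1) ^ 2 := by
    rw [← tsum_mul_left]
    refine hs2.tsum_le_tsum (fun n => ?_) (summable_inv_succ_sq.mul_left _)
    have a1 : (-((n : ℤ) + 1)).natAbs = n + 1 := by omega
    have a2 : ((k : ℤ) - (-((n : ℤ) + 1))).natAbs = n + 1 + k := by omega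
    rw [a1, a2, omega_of_pos 2 (by omega), omega_of_pos 2 (by omega)]
    push_cast
    exact key n
  have t3 : ∑ n ∈ Finset.range (k + 1), 1 / omega 2 (n : ℤ).natAbs *
      (1 / omega 2 ((k : ℤ) - n).natAbs) = 2 / (k : ℝ) ^ 2 + innerSum k / (k : ℝ) ^ 2 := by
    rw [Finset.sum_range_succ, Finset.range_eq_Ico, Finset.sum_eq_sum_Ico_succ_bot hk]
    have b0 : 1 / omega 2 ((0 : ℕ) : ℤ).natAbs * (1 / omega 2 ((k : ℤ) - (0 : ℕ)).natAbs) =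
        1 / (k : ℝ) ^ 2 := by
      simp [omega_zero, omega_of_pos 2 hk]
    have bk : 1 / omega 2 (k : ℤ).natAbs * (1 / omega 2 ((k : ℤ) - k).natAbs) =
        1 / (k : ℝ) ^ 2 := by
      simp [omega_zero, omega_of_pos 2 hk]
    rw [b0, bk, innerSum, Finset.sum_div]
    have e : Finset.Ico (0 + 1) k = Finset.Icc 1 (k - 1) := by
      ext x; simp only [Finset.mem_Ico, Finset.mem_Icc]; omega
    rw [e]
    have : ∑ n ∈ Finset.Icc 1 (k - 1), 1 / omega 2 (n : ℤ).natAbs *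
        (1 / omega 2 ((k : ℤ) - n).natAbs) =
        ∑ l ∈ Finset.Icc 1 (k - 1), (k : ℝ) ^ 2 / ((l : ℝ) ^ 2 * ((k : ℝ) - l) ^ 2) / (k : ℝ) ^ 2 := by
      refine Finset.sum_congr rfl fun n hn => ?_
      rw [Finset.mem_Icc] at hn
      have a2 : ((k : ℤ) - n).natAbs = k - n := by omega
      rw [Int.natAbs_natCast, a2, omega_of_pos 2 (by omega), omega_of_pos 2 (by omega),
        Nat.cast_sub (by omega)]
      field_simp
    rw [this]; ring
  rw [t3]
  calc _ ≤ 2 / (k : ℝ) ^ 2 + innerSum k / (k : ℝ) ^ 2 +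
      (1 / (k : ℝ) ^ 2) * ∑' n : ℕ, 1 / ((n : ℝ) + 1) ^ 2 +
      (1 / (k : ℝ) ^ 2) * ∑' n : ℕ, 1 / ((n : ℝ) + 1) ^ 2 := by gcongr
    _ = _ := by ring

lemma log_eighteen : (2 : ℝ) ≤ log 18 := by
  rw [le_log_iff_exp_le (by norm_num)]
  have := exp_one_lt_d9
  have h : exp 2 = exp 1 * exp 1 := by rw [← exp_add]; norm_num
  rw [h]; nlinarith [exp_pos 1]

/-- After the endpoints `l = 1` and `l = k - 1` are removed, partial fractions give `k²/(l²(k-l)²) =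
(1/l + 1/(k-l))²`. The reflection `l ↦ k - l` reduces the sum to inverse squares, bounded by `ζ(2)`,
and to a harmonic sum, bounded by a logarithm. -/
lemma innerSum_le {k : ℕ} (hk : m ≤ k) : innerSum k ≤
    2 * ((m : ℝ) / ((m : ℝ) - 1)) ^ 2 + (4 * log ((m : ℝ) - 2) / m + (π ^ 2 - 6) / 3) := by
  have hk' : (20 : ℝ) ≤ k := by exact_mod_cast hk
  have hk20 : 20 ≤ k := hk
  unfold innerSum
  have e : Finset.Icc 1 (k - 1) = Finset.Ico 1 (k - 1 + 1) := by
    ext x; simp only [Finset.mem_Ico, Finset.mem_Icc]; omega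
  rw [e, Finset.sum_Ico_succ_top (by omega), Finset.sum_eq_sum_Ico_succ_bot (by omega)]
  have hc : ((k - 1 : ℕ) : ℝ) = (k : ℝ) - 1 := by
    rw [Nat.cast_sub (by omega)]; simp
  have b1 : (k : ℝ) ^ 2 / (((1 : ℕ) : ℝ) ^ 2 * ((k : ℝ) - (1 : ℕ)) ^ 2) ≤
      ((m : ℝ) / ((m : ℝ) - 1)) ^ 2 := by
    rw [Nat.cast_one, one_pow, one_mul, ← div_pow]
    refine pow_le_pow_left₀ (div_nonneg (by linarith) (by linarith)) ?_ 2
    rw [div_le_div_iff₀ (by linarith) (by norm_num)]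
    norm_num; linarith
  have b2 : (k : ℝ) ^ 2 / (((k - 1 : ℕ) : ℝ) ^ 2 * ((k : ℝ) - (k - 1 : ℕ)) ^ 2) ≤
      ((m : ℝ) / ((m : ℝ) - 1)) ^ 2 := by
    refine le_trans (le_of_eq ?_) b1
    rw [hc]; push_cast; ring_nf
  have hsplit : ∑ l ∈ Finset.Ico (1 + 1) (k - 1), (k : ℝ) ^ 2 / ((l : ℝ) ^ 2 * ((k : ℝ) - l) ^ 2) =
      2 * ∑ l ∈ Finset.Ico 2 (k - 1), 1 / (l : ℝ) ^ 2 +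
        4 / k * ∑ l ∈ Finset.Ico 2 (k - 1), 1 / (l : ℝ) := by
    have hr : ∀ F : ℝ → ℝ, ∑ l ∈ Finset.Ico 2 (k - 1), F ((k : ℝ) - l) =
        ∑ l ∈ Finset.Ico 2 (k - 1), F l := fun F => by
      have := Finset.sum_Ico_reflect (fun l : ℕ => F l) 2 (m := k - 1) (n := k) (by omega)
      rw [show k + 1 - (k - 1) = 2 by omega, show k + 1 - 2 = k - 1 by omega] at this
      rw [← this]
      refine Finset.sum_congr rfl fun l hl => ?_
      rw [Finset.mem_Ico] at hl
      rw [Nat.cast_sub (by omega)]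
    have : ∀ l ∈ Finset.Ico 2 (k - 1), (k : ℝ) ^ 2 / ((l : ℝ) ^ 2 * ((k : ℝ) - l) ^ 2) =
        (1 / (l : ℝ) ^ 2 + 1 / ((k : ℝ) - l) ^ 2) + 2 / k * (1 / (l : ℝ) + 1 / ((k : ℝ) - l)) := by
      intro l hl
      rw [Finset.mem_Ico] at hl
      have h1 : (2 : ℝ) ≤ l := by exact_mod_cast hl.1
      have h2 : (l : ℝ) < k := by exact_mod_cast (by omega : l < k)
      have h3 : (k : ℝ) - l ≠ 0 := by linarith
      have h4 : (l : ℝ) ≠ 0 := by linarith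
      have h5 : (k : ℝ) ≠ 0 := by linarith
      field_simp
      ring
    rw [show (1 + 1 : ℕ) = 2 from rfl, Finset.sum_congr rfl this, Finset.sum_add_distrib,
      ← Finset.mul_sum, Finset.sum_add_distrib, Finset.sum_add_distrib,
      hr (fun t => 1 / t ^ 2), hr (fun t => 1 / t)]
    ring
  have c1 : ∑ l ∈ Finset.Ico 2 (k - 1), 1 / (l : ℝ) ^ 2 ≤ π ^ 2 / 6 - 1 := by
    have := sum_le_hasSum (insert 1 (Finset.Ico 2 (k - 1))) (fun i _ => by positivity)
      hasSum_zeta_two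
    rw [Finset.sum_insert (by simp)] at this
    norm_num at this ⊢
    linarith
  have c2 : ∑ l ∈ Finset.Ico 2 (k - 1), 1 / (l : ℝ) ≤ log ((k : ℝ) - 2) := by
    have h := harmonic_le_one_add_log (k - 2)
    rw [harmonic_eq_sum_Icc] at h
    push_cast at h
    have e : Finset.Icc 1 (k - 2) = insert 1 (Finset.Ico 2 (k - 1)) := by
      ext x; simp only [Finset.mem_insert, Finset.mem_Ico, Finset.mem_Icc]; omega
    rw [e, Finset.sum_insert (by simp), Nat.cast_sub (by omega)] at h
    simp only [one_div]
    push_cast at h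
    linarith
  -- Monotonicity of this quotient without derivatives: the tangent to `log` at `18` bounds the
  -- numerator, and `log 18 ≥ 2` exceeds the required `10/9`.
  have c3 : log ((k : ℝ) - 2) / k ≤ log 18 / 20 := by
    have h1 : log ((k : ℝ) - 2) ≤ log 18 + ((k : ℝ) - 20) / 18 := by
      have := log_le_sub_one_of_pos (x := ((k : ℝ) - 2) / 18) (by apply div_pos <;> linarith)
      rw [log_div (by linarith) (by norm_num)] at this
      linarith
    rw [div_le_div_iff₀ (by linarith) (by norm_num)]
    nlinarith [log_eighteen]
  rw [hsplit]
  have c4 : 4 / (k : ℝ) * ∑ l ∈ Finset.Ico 2 (k - 1), 1 / (l : ℝ) ≤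
      4 * log ((m : ℝ) - 2) / m := by
    calc _ ≤ 4 / (k : ℝ) * log ((k : ℝ) - 2) := by gcongr
      _ = 4 * (log ((k : ℝ) - 2) / k) := by ring
      _ ≤ 4 * (log 18 / 20) := by gcongr
      _ = _ := by norm_num; ring
  linarith

lemma weightConv_le_alpha (k : ℕ) : weightConv k ≤ alpha k / omega 2 k := by
  have h := tsum_inv_succ_sq_le
  have hL : (2 : ℝ) / (L : ℝ) = 2 * (1 / (L : ℝ)) := by ring
  unfold alpha
  split_ifs with h0 h1
  · subst h0
    rw [omega_zero, div_one]
    refine weightConv_zero_le.trans ?_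
    linarith
  · refine (weightConv_le (Nat.pos_of_ne_zero h0)).trans ?_
    rw [omega_of_pos 2 (Nat.pos_of_ne_zero h0)]
    refine div_le_div_of_nonneg_right ?_ (by positivity)
    unfold innerSum
    linarith
  · refine (weightConv_le (Nat.pos_of_ne_zero h0)).trans ?_
    rw [omega_of_pos 2 (Nat.pos_of_ne_zero h0)]
    refine div_le_div_of_nonneg_right ?_ (by positivity)
    have := innerSum_le (not_lt.1 h1)
    linarith

lemma alpha_nonneg (k : ℕ) : 0 ≤ alpha k := by
  have h : 0 ≤ weightConv k := tsum_nonneg fun j => by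
    have h1 := omega_pos 2 j.natAbs
    have h2 := omega_pos 2 ((k : ℤ) - j).natAbs
    unfold weight
    positivity
  have := h.trans (weightConv_le_alpha k)
  have h2 := mul_nonneg this (omega_pos 2 k).le
  rwa [div_mul_cancel₀ _ (omega_pos 2 k).ne'] at h2

lemma alpha_of_le {k : ℕ} (hk : m ≤ k) : alpha k = alpha m := by
  have hk20 : 20 ≤ k := hk
  unfold alpha
  rw [if_neg (by omega), if_neg (not_lt.2 hk), if_neg (by norm_num), if_neg (by norm_num)]

lemma abs_conv_le {x y : ℕ → ℝ} {a b : ℝ} (hx : Dominated x a) (hy : Dominated y b) (k : ℕ) :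
    |conv x y k| ≤ a * b * alpha k / omega 2 k := by
  rw [mul_div_assoc]
  exact (abs_conv_le_weightConv hx hy k).trans
    (mul_le_mul_of_nonneg_left (weightConv_le_alpha k) (mul_nonneg hx.nonneg hy.nonneg))

/-! ### The constants of the tail -/

lemma delta_eq : delta = 441 / 1602 := by unfold delta; norm_num

lemma sqrt_delta_sq : √(1 / 4 - delta ^ 2) ^ 2 = 1 / 4 - delta ^ 2 :=
  sq_sqrt (by rw [delta_eq]; norm_num)

lemma delta_pos : 0 < delta := by rw [delta_eq]; norm_num

lemma gamma_mem : 0.917 < gamma ∧ gamma < 0.9175 := by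
  have h := sqrt_delta_sq
  have h0 := sqrt_nonneg (1 / 4 - delta ^ 2)
  unfold gamma
  rw [delta_eq] at *
  constructor
  · have : (0.417 : ℝ) < √(1 / 4 - (441 / 1602) ^ 2) := by
      apply lt_sqrt_of_sq_lt; norm_num
    linarith
  · have : √(1 / 4 - (441 / 1602) ^ 2) < (0.4175 : ℝ) := by
      rw [sqrt_lt' (by norm_num)]; norm_num
    linarith

lemma gamma_pos : 0 < gamma := by linarith [gamma_mem.1]

/-- `γ` is the larger root of this quadratic. Hence `θ = δ/γ` satisfies `δ(1 + θ²) = θ`, so that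
`θ^k` is the decaying homogeneous solution of `tridiag (-δ, 1, -δ)`. -/
lemma gamma_sq : gamma ^ 2 - gamma + delta ^ 2 = 0 := by
  have h := sqrt_delta_sq
  unfold gamma
  ring_nf at h ⊢
  linarith

lemma theta_mul_gamma : theta * gamma = delta := by
  unfold theta; rw [div_mul_cancel₀ _ gamma_pos.ne']

lemma theta_mem : 0.3 < theta ∧ theta < 0.3003 := by
  have h := gamma_mem
  unfold theta
  rw [delta_eq]
  constructor
  · rw [lt_div_iff₀ gamma_pos]; linarith
  · rw [div_lt_iff₀ gamma_pos]; linarith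

lemma theta_pos : 0 < theta := by linarith [theta_mem.1]

lemma theta_lt_one : theta < 1 := by linarith [theta_mem.2]

lemma one_sub_delta_mul_theta : 1 - delta * theta = gamma := by
  have h1 := gamma_sq
  have h2 := theta_mul_gamma
  have h3 := gamma_pos
  have : (1 - delta * theta - gamma) * gamma = 0 := by
    rw [sub_mul, sub_mul, mul_assoc, h2]; linarith
  rcases mul_eq_zero.1 this with h | h
  · linarith
  · linarith

lemma one_sub_theta_sq_pos : 0 < 1 - theta ^ 2 := by nlinarith [theta_mem.1, theta_mem.2]

lemma eta_mul : eta * (gamma * (1 - theta ^ 2)) = 1 := by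
  unfold eta
  rw [one_div, inv_mul_cancel₀ (mul_pos gamma_pos one_sub_theta_sq_pos).ne']

lemma eta_pos : 0 < eta := by
  unfold eta; have := gamma_pos; have := one_sub_theta_sq_pos; positivity

lemma mu_pos (k : ℕ) : 0 < mu k := by unfold mu; positivity

lemma one_le_mu (k : ℕ) : 1 ≤ mu k := by
  unfold mu; linarith [show (0 : ℝ) ≤ 2 * (k : ℝ) ^ 2 by positivity]

lemma lam_nonneg (k : ℕ) : 0 ≤ lam k := by unfold lam; positivity

lemma beta_pos (k : ℕ) : 0 < beta k := by unfold beta; split_ifs <;> positivity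

lemma lam_le {k : ℕ} (hk : m ≤ k) : lam k ≤ delta * mu k := by
  have hk' : (20 : ℝ) ≤ k := by exact_mod_cast hk
  rw [delta_eq]; unfold lam mu
  nlinarith

/-- The ratio `β_k/μ_k` decreases for `k ≥ m` and equals `δ` at `k = m`, which explains the value of
`δ`. -/
lemma beta_le {k : ℕ} (hk : m ≤ k) : beta k ≤ delta * mu k := by
  have hk' : (20 : ℝ) ≤ k := by exact_mod_cast hk
  have hk0 : k ≠ 0 := by rintro rfl; norm_num at hk
  rw [delta_eq]; unfold beta mu
  rw [if_neg hk0]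
  nlinarith

/-! ### The tridiagonal tail -/

/-- The tridiagonal operator `(λ, μ, β)_{k ≥ m}`, indexed from `0`. -/
def tailOp (x : ℕ → ℝ) (n : ℕ) : ℝ :=
  (if n = 0 then 0 else lam (m + n) * x (n - 1)) + mu (m + n) * x n + beta (m + n) * x (n + 1)

/-- Nonnegative supersolutions of the comparison operator `tridiag (-δ, 1, -δ)`. -/
structure IsSuper (r X : ℕ → ℝ) : Prop where
  nonneg : ∀ n, 0 ≤ X n
  zero : r 0 + delta * X 1 ≤ X 0
  succ : ∀ n, r (n + 1) + delta * X n + delta * X (n + 2) ≤ X (n + 1)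

/-- Comparison principle. If `|x| - X` is at most `B ≥ 0` everywhere, then solving each row for its
diagonal term improves the bound to `2δB`. Iterating from `B = C` and using `2δ < 1` leaves zero in
the limit. The a priori boundedness of `x` only starts the iteration, so the value of `C` is
immaterial. -/
lemma abs_le_of_isSuper {x r X : ℕ → ℝ} {C : ℝ} (hx : ∀ n, |x n| ≤ C)
    (hr : ∀ n, |tailOp x n| ≤ mu (m + n) * r n) (hX : IsSuper r X) (n : ℕ) : |x n| ≤ X n := by
  have hd := delta_pos
  have key : ∀ n, mu (m + n) * |x n| ≤ mu (m + n) * r n +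
      (if n = 0 then 0 else lam (m + n) * |x (n - 1)|) + beta (m + n) * |x (n + 1)| := fun n => by
    have e : mu (m + n) * x n = tailOp x n - (if n = 0 then 0 else lam (m + n) * x (n - 1)) -
        beta (m + n) * x (n + 1) := by unfold tailOp; ring
    rw [← abs_of_pos (mu_pos (m + n)), ← abs_mul, e, abs_of_pos (mu_pos (m + n))]
    refine (abs_sub _ _).trans (add_le_add ((abs_sub _ _).trans (add_le_add (hr n) ?_)) ?_)
    · split_ifs
      · simp
      · rw [abs_mul, abs_of_nonneg (lam_nonneg _)]
    · rw [abs_mul, abs_of_pos (beta_pos _)]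
  have step : ∀ B : ℝ, 0 ≤ B → (∀ n, |x n| - X n ≤ B) → ∀ n, |x n| - X n ≤ 2 * delta * B := by
    intro B hB h n
    have hμ := mu_pos (m + n)
    have h1 : |x (n + 1)| ≤ X (n + 1) + B := by linarith [h (n + 1)]
    have hb : beta (m + n) * |x (n + 1)| ≤ mu (m + n) * (delta * (X (n + 1) + B)) := by
      calc _ ≤ (delta * mu (m + n)) * (X (n + 1) + B) :=
            mul_le_mul (beta_le (by omega)) h1 (abs_nonneg _) (mul_nonneg hd.le hμ.le)
        _ = _ := by ring
    rcases n with _ | n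
    · have := key 0
      simp only [if_true, add_zero] at this
      have h3 : mu m * |x 0| ≤ mu m * (r 0 + delta * (X 1 + B)) := by
        simp only [add_zero, zero_add] at hb
        rw [mul_add]; simpa using this.trans (by simpa using hb)
      have h4 := le_of_mul_le_mul_left h3 (mu_pos m)
      nlinarith [hX.zero]
    · have := key (n + 1)
      simp only [Nat.add_eq_zero_iff, one_ne_zero, and_false, if_false, Nat.add_sub_cancel] at this
      have h2 : |x n| ≤ X n + B := by linarith [h n]
      have hl : lam (m + (n + 1)) * |x n| ≤ mu (m + (n + 1)) * (delta * (X n + B)) := by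
        calc _ ≤ (delta * mu (m + (n + 1))) * (X n + B) :=
              mul_le_mul (lam_le (by omega)) h2 (abs_nonneg _) (mul_nonneg hd.le hμ.le)
          _ = _ := by ring
      have h3 : mu (m + (n + 1)) * |x (n + 1)| ≤
          mu (m + (n + 1)) * (r (n + 1) + delta * (X n + B) + delta * (X (n + 2) + B)) := by
        rw [mul_add, mul_add]; linarith
      have h4 := le_of_mul_le_mul_left h3 hμ
      nlinarith [hX.succ n]
  have hC : 0 ≤ C := (abs_nonneg _).trans (hx 0)
  have hpow : ∀ N : ℕ, ∀ n, |x n| - X n ≤ (2 * delta) ^ N * C := by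
    intro N
    induction N with
    | zero => intro n; rw [pow_zero, one_mul]; linarith [hx n, hX.nonneg n]
    | succ N ih =>
      intro n
      rw [pow_succ', mul_assoc]
      exact step _ (by positivity) ih n
  have hlim : Filter.Tendsto (fun N : ℕ => (2 * delta) ^ N * C) Filter.atTop (nhds (0 * C)) :=
    (tendsto_pow_atTop_nhds_zero_of_lt_one (by positivity)
      (by rw [delta_eq]; norm_num)).mul_const C
  rw [zero_mul] at hlim
  have := ge_of_tendsto' hlim fun N => hpow N n
  linarith

lemma tailOp_add (x y : ℕ → ℝ) : tailOp (x + y) = tailOp x + tailOp y := by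
  funext n; simp only [tailOp, Pi.add_apply]; split_ifs <;> ring

lemma tailOp_smul (c : ℝ) (x : ℕ → ℝ) : tailOp (c • x) = c • tailOp x := by
  funext n; simp only [tailOp, Pi.smul_apply, smul_eq_mul]; split_ifs <;> ring

lemma tailOp_sub (x y : ℕ → ℝ) : tailOp (x - y) = tailOp x - tailOp y := by
  funext n; simp only [tailOp, Pi.sub_apply]; split_ifs <;> ring

lemma isSuper_zero : IsSuper 0 0 := ⟨by simp, by simp, by simp⟩

lemma tailOp_inj {x y : ℕ → ℝ} {C D : ℝ} (hx : ∀ n, |x n| ≤ C) (hy : ∀ n, |y n| ≤ D)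
    (h : tailOp x = tailOp y) : x = y := by
  funext n
  have := abs_le_of_isSuper (x := x - y) (r := 0) (X := 0) (C := C + D)
    (fun n => (abs_sub _ _).trans (add_le_add (hx n) (hy n)))
    (fun n => by rw [tailOp_sub, h]; simp) isSuper_zero n
  simp only [Pi.sub_apply, Pi.zero_apply, abs_nonpos_iff] at this
  linarith

/-- Jacobi iteration on bounded sequences: after division by `μ`, each of the two neighbours enters
with weight at most `δ`, so the iteration contracts with factor `2δ = 441/801`. -/
lemma exists_tailOp_eq {h : ℕ → ℝ} {C : ℝ} (hh : ∀ n, |h n| ≤ C * mu (m + n)) :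
    ∃ x : ℕ → ℝ, (∃ D, ∀ n, |x n| ≤ D) ∧ tailOp x = h := by
  have hd := delta_pos
  let B := BoundedContinuousFunction ℕ ℝ
  let F : (ℕ → ℝ) → ℕ → ℝ := fun x n => h n / mu (m + n) -
    ((if n = 0 then 0 else lam (m + n) / mu (m + n) * x (n - 1)) +
      beta (m + n) / mu (m + n) * x (n + 1))
  have hl : ∀ n, |lam (m + n) / mu (m + n)| ≤ delta := fun n => by
    rw [abs_of_nonneg (div_nonneg (lam_nonneg _) (mu_pos _).le), div_le_iff₀ (mu_pos _)]
    exact lam_le (by omega)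
  have hb : ∀ n, |beta (m + n) / mu (m + n)| ≤ delta := fun n => by
    rw [abs_of_nonneg (div_nonneg (beta_pos _).le (mu_pos _).le), div_le_iff₀ (mu_pos _)]
    exact beta_le (by omega)
  have hlin : ∀ (x : ℕ → ℝ) (E : ℝ), (∀ n, |x n| ≤ E) → ∀ n,
      |(if n = 0 then 0 else lam (m + n) / mu (m + n) * x (n - 1)) +
        beta (m + n) / mu (m + n) * x (n + 1)| ≤ 2 * delta * E := fun x E hx n => by
    have hE : 0 ≤ E := (abs_nonneg _).trans (hx 0)
    have h1 : |beta (m + n) / mu (m + n) * x (n + 1)| ≤ delta * E := by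
      rw [abs_mul]; exact mul_le_mul (hb n) (hx _) (abs_nonneg _) hd.le
    have h2 : |(if n = 0 then 0 else lam (m + n) / mu (m + n) * x (n - 1))| ≤ delta * E := by
      split_ifs
      · rw [abs_zero]; positivity
      · rw [abs_mul]; exact mul_le_mul (hl n) (hx _) (abs_nonneg _) hd.le
    linarith [abs_add_le (if n = 0 then 0 else lam (m + n) / mu (m + n) * x (n - 1))
      (beta (m + n) / mu (m + n) * x (n + 1))]
  have hF : ∀ (x : B) n, ‖F x n‖ ≤ C + 2 * delta * ‖x‖ := fun x n => by
    refine (abs_sub _ _).trans (add_le_add ?_ (hlin x ‖x‖ (fun n => x.norm_coe_le_norm n) n))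
    rw [abs_div, abs_of_pos (mu_pos _), div_le_iff₀ (mu_pos _)]
    exact hh n
  let Φ : B → B := fun x => BoundedContinuousFunction.ofNormedAddCommGroupDiscrete (F x) _ (hF x)
  have hK : ((2 * delta).toNNReal : ℝ) = 2 * delta := coe_toNNReal _ (by positivity)
  have hc : ContractingWith (2 * delta).toNNReal Φ := by
    refine ⟨?_, LipschitzWith.of_dist_le_mul fun x y => ?_⟩
    · rw [← NNReal.coe_lt_coe, hK, delta_eq]; norm_num
    · rw [hK, BoundedContinuousFunction.dist_le (by positivity)]
      intro n
      have := hlin (fun n => y n - x n) (dist x y)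
        (fun n => by
          rw [abs_sub_comm, ← Real.dist_eq]
          exact BoundedContinuousFunction.dist_coe_le_dist n) n
      refine le_trans (le_of_eq ?_) this
      rw [Real.dist_eq]
      congr 1
      change F x n - F y n = _
      simp only [F]
      split_ifs <;> ring
  refine ⟨(hc.fixedPoint : B), ⟨‖hc.fixedPoint‖, fun n => hc.fixedPoint.norm_coe_le_norm n⟩, ?_⟩
  funext n
  have hfix : F (hc.fixedPoint : B) n = (hc.fixedPoint : B) n :=
    DFunLike.congr_fun (show Φ hc.fixedPoint = hc.fixedPoint from hc.fixedPoint_isFixedPt) n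
  generalize hc.fixedPoint = x at hfix
  have hμ := (mu_pos (m + n)).ne'
  unfold tailOp
  rw [← hfix]
  simp only [F]
  split_ifs
  · field_simp; ring
  · field_simp; ring

open Classical in
/-- The inverse of the tridiagonal tail on sequences `h` with `h / μ` bounded. -/
def tailInv (h : ℕ → ℝ) : ℕ → ℝ :=
  if hh : ∃ C : ℝ, ∀ n, |h n| ≤ C * mu (m + n) then (exists_tailOp_eq hh.choose_spec).choose else 0

lemma tailInv_bounded (h : ℕ → ℝ) : ∃ D, ∀ n, |tailInv h n| ≤ D := by
  unfold tailInv
  split_ifs with hh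
  · exact (exists_tailOp_eq hh.choose_spec).choose_spec.1
  · exact ⟨0, by simp⟩

lemma tailOp_tailInv {h : ℕ → ℝ} {C : ℝ} (hh : ∀ n, |h n| ≤ C * mu (m + n)) :
    tailOp (tailInv h) = h := by
  have : ∃ C : ℝ, ∀ n, |h n| ≤ C * mu (m + n) := ⟨C, hh⟩
  unfold tailInv
  rw [dif_pos this]
  exact (exists_tailOp_eq this.choose_spec).choose_spec.2

lemma tailInv_eq {x : ℕ → ℝ} {h : ℕ → ℝ} {C D : ℝ} (hx : ∀ n, |x n| ≤ C)
    (hh : ∀ n, |h n| ≤ D * mu (m + n)) (e : tailOp x = h) : tailInv h = x := by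
  obtain ⟨E, hE⟩ := tailInv_bounded h
  exact tailOp_inj hE hx ((tailOp_tailInv hh).trans e.symm)

lemma tailInv_sub {h k : ℕ → ℝ} {C D : ℝ} (hh : ∀ n, |h n| ≤ C * mu (m + n))
    (hk : ∀ n, |k n| ≤ D * mu (m + n)) : tailInv (h - k) = tailInv h - tailInv k := by
  obtain ⟨E, hE⟩ := tailInv_bounded h
  obtain ⟨G, hG⟩ := tailInv_bounded k
  refine tailInv_eq (C := E + G) (D := C + D)
    (fun n => (abs_sub _ _).trans (add_le_add (hE n) (hG n)))
    (fun n => (abs_sub _ _).trans ?_) ?_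
  · rw [add_mul]; exact add_le_add (hh n) (hk n)
  · rw [tailOp_sub, tailOp_tailInv hh, tailOp_tailInv hk]

lemma abs_tailInv_le {h r X : ℕ → ℝ} {C : ℝ} (hC : ∀ n, |h n| ≤ C * mu (m + n))
    (hr : ∀ n, |h n| ≤ mu (m + n) * r n) (hX : IsSuper r X) (n : ℕ) : |tailInv h n| ≤ X n := by
  obtain ⟨E, hE⟩ := tailInv_bounded h
  exact abs_le_of_isSuper hE (fun n => by rw [tailOp_tailInv hC]; exact hr n) hX n

/-! ### Supersolutions from the Green function -/

/-- `η ∑_l θ^{|k - l|} r_l`. -/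
def greenSum (r : ℕ → ℝ) (k : ℕ) : ℝ :=
  eta * (∑ l ∈ Finset.range (k + 1), theta ^ (k - l) * r l +
    ∑' j : ℕ, theta ^ (j + 1) * r (k + 1 + j))

lemma summable_theta_mul {r : ℕ → ℝ} {C : ℝ} (hC : ∀ n, |r n| ≤ C) (k : ℕ) :
    Summable fun j : ℕ => theta ^ j * r (k + j) := by
  have h := (summable_geometric_of_lt_one theta_pos.le theta_lt_one).mul_right C
  refine Summable.of_norm_bounded h fun j => ?_
  rw [norm_mul, norm_pow, Real.norm_of_nonneg theta_pos.le]
  exact mul_le_mul_of_nonneg_left (hC _) (pow_nonneg theta_pos.le _)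

/-- The kernel is the Green function of `tridiag (-δ, 1, -δ)` on all of `ℤ`. On the half-line every
row but the first therefore holds with equality; in the first row the nonnegative contribution of
the absent left neighbour is dropped. -/
lemma isSuper_greenSum {r : ℕ → ℝ} {C : ℝ} (h0 : ∀ n, 0 ≤ r n) (hC : ∀ n, r n ≤ C) :
    IsSuper r (greenSum r) := by
  have hC' : ∀ n, |r n| ≤ C := fun n => by rw [abs_of_nonneg (h0 n)]; exact hC n
  -- `N` collects the sources up to `k` and `U` those from `k` on. Their one-step recursions turn
  -- the three-term inequality into polynomial algebra in `θ`, `δ` and `η`.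
  set N : ℕ → ℝ := fun k => ∑ l ∈ Finset.range (k + 1), theta ^ (k - l) * r l with hN
  set U : ℕ → ℝ := fun k => ∑' j : ℕ, theta ^ j * r (k + j) with hU
  have hN0 : N 0 = r 0 := by simp [hN]
  have hNs : ∀ k, N (k + 1) = r (k + 1) + theta * N k := fun k => by
    simp only [hN]
    rw [Finset.sum_range_succ, Finset.mul_sum, add_comm]
    congr 1
    · simp
    · refine Finset.sum_congr rfl fun l hl => ?_
      rw [Finset.mem_range] at hl
      rw [← mul_assoc, ← pow_succ', show k + 1 - l = k - l + 1 by omega]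
  have hUs : ∀ k, U k = r k + theta * U (k + 1) := fun k => by
    simp only [hU]
    rw [(summable_theta_mul hC' k).tsum_eq_zero_add, ← tsum_mul_left]
    simp only [pow_zero, one_mul, add_zero]
    congr 1
    refine tsum_congr fun j => ?_
    rw [pow_succ', mul_assoc, show k + (j + 1) = k + 1 + j by omega]
  have hX : ∀ k, greenSum r k = eta * (N k + theta * U (k + 1)) := fun k => by
    simp only [greenSum, hN, hU, ← tsum_mul_left]
    congr 3
    funext j; rw [pow_succ', mul_assoc]
  have hN' : ∀ k, 0 ≤ N k := fun k => Finset.sum_nonneg fun l _ =>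
    mul_nonneg (pow_nonneg theta_pos.le _) (h0 l)
  have hU' : ∀ k, 0 ≤ U k := fun k => tsum_nonneg fun l =>
    mul_nonneg (pow_nonneg theta_pos.le _) (h0 _)
  have he := eta_mul
  have hg := one_sub_delta_mul_theta
  have ht := theta_mul_gamma
  have hη := eta_pos
  have hθ := theta_pos
  refine ⟨fun n => ?_, ?_, fun n => ?_⟩
  · rw [hX]; have := hN' n; have := hU' (n + 1); positivity
  · rw [hX, hX, hNs 0, hN0, hUs 1]
    simp only [zero_add, Nat.reduceAdd]
    set a := r 0
    set b := r 1
    set c := U 2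
    -- The three terms are handled separately: `ηγ ≥ 1` for the source at the origin, and `θ - δ =
    -- δθ² ≥ 0` for the sources to its right.
    have e1 : eta * (a + theta * (b + theta * c)) - delta * (eta * (b + theta * a + theta * c)) =
        eta * a * (1 - delta * theta) + eta * (theta - delta) * b +
          eta * theta * c * (theta - delta) := by ring
    have e2 : theta - delta = theta * (delta * theta) := by rw [← ht]; nlinarith
    have h1 : a ≤ eta * a * (1 - delta * theta) := by
      rw [hg]
      have : 1 ≤ eta * gamma := by nlinarith [mul_pos hη gamma_pos, sq_nonneg theta]
      nlinarith [h0 0]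
    have hd := delta_pos
    have hb : 0 ≤ b := h0 1
    have hc : 0 ≤ c := hU' 2
    have h2 : 0 ≤ eta * (theta - delta) * b := by rw [e2]; positivity
    have h3 : 0 ≤ eta * theta * c * (theta - delta) := by rw [e2]; positivity
    linarith
  · rw [hX, hX, hX, hNs (n + 1), hNs n, hUs (n + 1), hUs (n + 2)]
    set a := r (n + 1)
    set b := r (n + 1 + 1)
    set b' := r (n + 2)
    have hbb : b = b' := rfl
    rw [hbb]
    set c := U (n + 2 + 1)
    set c' := U (n + 1 + 1 + 1)
    set v := N n
    have hcc : c' = c := rfl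
    have e1 : eta * (a + theta * v + theta * (b' + theta * c)) =
        a + delta * (eta * (v + theta * (a + theta * (b' + theta * c)))) +
          delta * (eta * (b' + theta * (a + theta * v) + theta * c)) := by
      have hδ : delta = theta * (1 - delta * theta) := by rw [hg, ht]
      have hδ2 : delta * (1 + theta ^ 2) = theta := by linarith
      have hη2 : eta * (1 - 2 * delta * theta) = 1 := by
        have : gamma * (1 - theta ^ 2) = 1 - 2 * delta * theta := by
          rw [← hg]; nlinarith
        rw [← this]; exact he
      linear_combination (-(eta * v + eta * theta ^ 1 * c + eta * b')) * hδ2 + a * hη2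
    have hUe : U (n + 1 + 1) = b' + theta * c := hUs (n + 2)
    linarith

lemma isSuper_geometric (a : ℝ) (ha : 0 ≤ a) :
    IsSuper (Pi.single 0 a) (fun n => eta * theta ^ n * a) := by
  have he := eta_mul
  have hg := one_sub_delta_mul_theta
  have ht := theta_mul_gamma
  have hη := eta_pos
  have hθ := theta_pos
  refine ⟨fun n => by positivity, ?_, fun n => ?_⟩
  · have : 1 ≤ eta * gamma := by nlinarith [mul_pos hη gamma_pos, sq_nonneg theta]
    have h2 : eta * (1 - delta * theta) = eta * gamma := by rw [hg]
    simp only [Pi.single_eq_same, pow_one, pow_zero]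
    nlinarith
  · rw [Pi.single_eq_of_ne (by omega)]
    have hδ2 : delta * (1 + theta ^ 2) = theta := by
      have hδ : delta = theta * (1 - delta * theta) := by rw [hg, ht]
      linarith
    apply le_of_eq
    linear_combination (eta * theta ^ n * a) * hδ2

/-! ### The first column of the inverse -/

/-- The first column of the inverse of the tail. -/
def tailCol : ℕ → ℝ := tailInv (Pi.single 0 1)

lemma single_le_mu (n : ℕ) : |(Pi.single 0 1 : ℕ → ℝ) n| ≤ 1 * mu (m + n) := by
  rcases n with _ | n
  · simpa using (one_le_mu m)
  · simpa using (mu_pos _).le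

lemma tailOp_tailCol : tailOp tailCol = Pi.single 0 1 := tailOp_tailInv single_le_mu

lemma abs_tailCol_le (n : ℕ) : |tailCol n| ≤ eta * theta ^ n * (1 / mu m) := by
  have hμ := mu_pos m
  refine abs_tailInv_le single_le_mu (fun n => ?_)
    (isSuper_geometric (1 / mu m) (by positivity)) n
  rcases n with _ | n
  · simp [hμ.ne']
  · simp

/-- For the ratio of consecutive minors the recursion reads `ρ_{n+1} = μ - λβ/ρ_n`. With `ρ_n ≥ γμ`
and `λ, β ≤ δμ` this gives `ρ_{n+1} ≥ μ(1 - δ²/γ)`, which is `γμ` because `γ(1-γ) = δ²`. -/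
lemma minor_step (n : ℕ) : 0 < minor n ∧ gamma * mu (m + n) * minor n ≤ minor (n + 1) := by
  have hg := gamma_pos
  have hg1 : gamma ≤ 1 := by linarith [gamma_mem.2]
  induction n with
  | zero =>
    simp only [minor, add_zero, mul_one]
    exact ⟨one_pos, by nlinarith [mu_pos m]⟩
  | succ n ih =>
    obtain ⟨h0, h1⟩ := ih
    have hμ := mu_pos (m + n)
    have hμ' := mu_pos (m + n + 1)
    have hpos : 0 < minor (n + 1) := lt_of_lt_of_le (by positivity) h1
    refine ⟨hpos, ?_⟩
    have hl := lam_le (show m ≤ m + n + 1 by omega)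
    have hb := beta_le (show m ≤ m + n by omega)
    have hlb : lam (m + n + 1) * beta (m + n) ≤ (delta * mu (m + n + 1)) * (delta * mu (m + n)) :=
      mul_le_mul hl hb (beta_pos _).le (mul_nonneg delta_pos.le hμ'.le)
    have h2 : lam (m + n + 1) * beta (m + n) * minor n ≤
        (1 - gamma) * mu (m + n + 1) * minor (n + 1) := by
      have hq : delta ^ 2 = gamma * (1 - gamma) := by linarith [gamma_sq]
      calc _ ≤ (delta * mu (m + n + 1)) * (delta * mu (m + n)) * minor n := by gcongr
        _ = (1 - gamma) * mu (m + n + 1) * (gamma * mu (m + n) * minor n) := by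
          linear_combination (mu (m + n + 1) * mu (m + n) * minor n) * hq
        _ ≤ _ := by
          apply mul_le_mul_of_nonneg_left h1
          exact mul_nonneg (by linarith) hμ'.le
    have e : minor (n + 1 + 1) = mu (m + n + 1) * minor (n + 1) -
      lam (m + n + 1) * beta (m + n) * minor n := by rw [minor]
    rw [e, ← add_assoc]
    linarith

/-- Gaussian elimination of the first `n` unknowns from the tail system with right-hand side `e_0`;
the source travels down the subdiagonal and acquires a sign at each step. -/
lemma minor_elim (n : ℕ) : minor (n + 1) * tailCol n + beta (m + n) * minor n * tailCol (n + 1) =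
    (-1) ^ n * ∏ i ∈ Finset.range n, lam (m + i + 1) := by
  induction n with
  | zero =>
    have := congrFun tailOp_tailCol 0
    simp only [tailOp, if_true, Pi.single_eq_same, add_zero, zero_add] at this
    simp only [minor, Finset.range_zero, Finset.prod_empty, pow_zero, mul_one, zero_add, add_zero]
    exact this
  | succ n ih =>
    have h := congrFun tailOp_tailCol (n + 1)
    simp only [tailOp, Nat.add_eq_zero_iff, one_ne_zero, and_false, if_false, Nat.add_sub_cancel,
      Pi.single_eq_of_ne (Nat.succ_ne_zero n)] at h
    rw [Finset.prod_range_succ, minor]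
    rw [← add_assoc] at h ⊢
    linear_combination minor (n + 1) * h - lam (m + n + 1) * ih

/-- An exact expansion with remainder: solving `minor_elim` for `tailCol N` and inserting this into
the remainder splits off the next term of the series. -/
lemma tailCol_zero_eq (N : ℕ) : tailCol 0 = ∑ l ∈ Finset.range N,
    (∏ i ∈ Finset.range l, beta (m + i) * lam (m + i + 1)) / (minor l * minor (l + 1)) +
    (-1) ^ N * (∏ i ∈ Finset.range N, beta (m + i)) / minor N * tailCol N := by
  induction N with
  | zero => simp [minor]
  | succ N ih =>
    rw [Finset.sum_range_succ, ih, Finset.prod_range_succ, Finset.prod_mul_distrib, add_assoc]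
    congr 1
    have h0 := (minor_step N).1.ne'
    have h1 := (minor_step (N + 1)).1.ne'
    have h := minor_elim N
    have e : tailCol N = ((-1) ^ N * ∏ i ∈ Finset.range N, lam (m + i + 1) -
        beta (m + N) * minor N * tailCol (N + 1)) / minor (N + 1) := by
      rw [eq_div_iff h1]; linarith
    rw [e, pow_succ]
    have hs : ((-1 : ℝ) ^ N) * (-1) ^ N = 1 := by rw [← mul_pow]; norm_num
    field_simp
    linear_combination (∏ i ∈ Finset.range N, beta (m + i)) *
      (∏ i ∈ Finset.range N, lam (m + i + 1)) * hs

/-- Each new factor satisfies `β ≤ δμ = θγμ`, while the minors grow at least by `γμ`. The first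
minor is `μ_m` and not merely `γμ_m`, which saves the extra factor `γ`. -/
lemma prod_beta_le (N : ℕ) : ∏ i ∈ Finset.range (N + 1), beta (m + i) ≤
    gamma * theta ^ (N + 1) * minor (N + 1) := by
  have ht := theta_mul_gamma
  induction N with
  | zero =>
    have hb := beta_le (le_refl m)
    simp only [zero_add, Finset.prod_range_one, add_zero, pow_one, minor]
    rw [mul_comm gamma, ht]; exact hb
  | succ N ih =>
    rw [Finset.prod_range_succ]
    have hb := beta_le (show m ≤ m + (N + 1) by omega)
    have hm := (minor_step (N + 1))
    have hθ := theta_pos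
    calc _ ≤ gamma * theta ^ (N + 1) * minor (N + 1) * (delta * mu (m + (N + 1))) :=
          mul_le_mul ih hb (beta_pos _).le
            (mul_nonneg (mul_nonneg gamma_pos.le (by positivity)) hm.1.le)
      _ = gamma * theta ^ (N + 1 + 1) * (gamma * mu (m + (N + 1)) * minor (N + 1)) := by
          rw [← ht]; ring
      _ ≤ _ := mul_le_mul_of_nonneg_left hm.2 (mul_nonneg gamma_pos.le (by positivity))

/-- The remainder is small twice over: the quotient of the `β`-product by the minor is at most
`γθ^L`, and `tailCol L` decays like `ηθ^L`. Moreover `γη = 1/(1-θ²)`. -/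
lemma abs_tailCol_sub_wTilde : |tailCol 0 - wTilde| ≤ theta ^ (2 * L) / (mu m * (1 - theta ^ 2)) := by
  have h := tailCol_zero_eq L
  have hw : tailCol 0 - wTilde =
      (-1) ^ L * (∏ i ∈ Finset.range L, beta (m + i)) / minor L * tailCol L := by
    rw [h, wTilde]; ring
  rw [hw, abs_mul, abs_div, abs_mul, abs_pow, abs_neg, abs_one, one_pow, one_mul,
    abs_of_pos (minor_step L).1, abs_of_pos (Finset.prod_pos fun i _ => beta_pos _)]
  have h1 : (∏ i ∈ Finset.range L, beta (m + i)) / minor L ≤ gamma * theta ^ L := by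
    rw [div_le_iff₀ (minor_step L).1]; exact prod_beta_le 99
  have hθ := theta_pos
  have hg := gamma_pos
  have hμ := mu_pos m
  have h1t := one_sub_theta_sq_pos
  calc _ ≤ (gamma * theta ^ L) * (eta * theta ^ L * (1 / mu m)) :=
        mul_le_mul h1 (abs_tailCol_le L) (abs_nonneg _) (by positivity)
    _ = _ := by
      rw [eta, two_mul, pow_add]; field_simp

/-! ### Contractions in weighted supremum norms -/

/-- The substitution `a_k = (x_k - c_k) w_k` identifies the weighted ball with a closed ball of
bounded functions on `ℕ`, which is complete; Banach's theorem applies there. -/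
lemma exists_fixedPoint_of_weighted_contraction {w : ℕ → ℝ} (hw : ∀ k, 0 < w k) {c : ℕ → ℝ}
    {r K : ℝ} (hr : 0 ≤ r) (hK0 : 0 ≤ K) (hK : K < 1) (T : (ℕ → ℝ) → ℕ → ℝ)
    (hmaps : ∀ x, (∀ k, |x k - c k| ≤ r / w k) → ∀ k, |T x k - c k| ≤ r / w k)
    (hcontr : ∀ x y, (∀ k, |x k - c k| ≤ r / w k) → (∀ k, |y k - c k| ≤ r / w k) → ∀ ζ,
      (∀ k, |x k - y k| ≤ ζ / w k) → ∀ k, |T x k - T y k| ≤ K * ζ / w k) :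
    ∃ x, (∀ k, |x k - c k| ≤ r / w k) ∧ T x = x ∧
      ∀ y, (∀ k, |y k - c k| ≤ r / w k) → T y = y → y = x := by
  let B := BoundedContinuousFunction ℕ ℝ
  let X := Metric.closedBall (0 : B) r
  let E : B → ℕ → ℝ := fun a k => c k + a k / w k
  have hE : ∀ a : X, ∀ k, |E a k - c k| ≤ r / w k := fun a k => by
    simp only [E, add_sub_cancel_left, abs_div, abs_of_pos (hw k)]
    have h1 : ‖(a : B)‖ ≤ r := mem_closedBall_zero_iff.1 a.2
    have h2 : |(a : B) k| ≤ r := ((a : B).norm_coe_le_norm k).trans h1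
    exact div_le_div_of_nonneg_right h2 (hw k).le
  have hb : ∀ a : X, ∀ k, ‖(T (E a) k - c k) * w k‖ ≤ r := fun a k => by
    rw [norm_mul, Real.norm_of_nonneg (hw k).le, ← le_div_iff₀ (hw k)]
    exact hmaps _ (hE a) k
  let Φ : X → X := fun a =>
    ⟨BoundedContinuousFunction.ofNormedAddCommGroupDiscrete _ r (hb a), by
      rw [mem_closedBall_zero_iff, BoundedContinuousFunction.norm_le hr]
      exact hb a⟩
  have hKc : (K.toNNReal : ℝ) = K := coe_toNNReal _ hK0
  have hdist : ∀ a b : X, ∀ k, |E a k - E b k| ≤ dist a b / w k := fun a b k => by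
    simp only [E, add_sub_add_left_eq_sub, ← sub_div, abs_div, abs_of_pos (hw k)]
    refine div_le_div_of_nonneg_right ?_ (hw k).le
    rw [← Real.dist_eq]
    exact BoundedContinuousFunction.dist_coe_le_dist (f := (a : B)) (g := (b : B)) k
  have hc : ContractingWith K.toNNReal Φ := by
    refine ⟨by rw [← NNReal.coe_lt_coe, hKc]; exact_mod_cast hK,
      LipschitzWith.of_dist_le_mul fun a b => ?_⟩
    rw [hKc, Subtype.dist_eq, BoundedContinuousFunction.dist_le (by positivity)]
    intro k
    have := hcontr _ _ (hE a) (hE b) (dist a b) (hdist a b) k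
    rw [Real.dist_eq]
    change |(T (E a) k - c k) * w k - (T (E b) k - c k) * w k| ≤ _
    rw [← sub_mul, sub_sub_sub_cancel_right, abs_mul, abs_of_pos (hw k), ← le_div_iff₀ (hw k)]
    exact this
  have : Nonempty X := ⟨⟨0, by simpa [X] using hr⟩⟩
  have : CompleteSpace X := (Metric.isClosed_closedBall).completeSpace_coe
  refine ⟨E (hc.fixedPoint : X), hE _, ?_, fun y hy hTy => ?_⟩
  · funext k
    have h : Φ hc.fixedPoint = hc.fixedPoint := hc.fixedPoint_isFixedPt
    have h2 : (T (E (hc.fixedPoint : X)) k - c k) * w k = (hc.fixedPoint : B) k :=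
      DFunLike.congr_fun (congrArg Subtype.val h) k
    have hwk := (hw k).ne'
    change T (E (hc.fixedPoint : X)) k = c k + (hc.fixedPoint : B) k / w k
    rw [← h2, mul_div_cancel_right₀ _ hwk]; ring
  · have hyb : ∀ k, ‖(y k - c k) * w k‖ ≤ r := fun k => by
      rw [norm_mul, Real.norm_of_nonneg (hw k).le, ← le_div_iff₀ (hw k)]
      exact hy k
    let a : X := ⟨BoundedContinuousFunction.ofNormedAddCommGroupDiscrete _ r hyb, by
      rw [mem_closedBall_zero_iff, BoundedContinuousFunction.norm_le hr]
      exact hyb⟩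
    have ha : E a = y := by
      funext k
      change c k + (y k - c k) * w k / w k = y k
      rw [mul_div_cancel_right₀ _ (hw k).ne']; ring
    have hfix : Function.IsFixedPt Φ a := by
      apply Subtype.ext
      ext k
      change (T (E a) k - c k) * w k = (y k - c k) * w k
      rw [ha, hTy]
    rw [← hc.fixedPoint_unique hfix, ha]

/-! ### The approximate inverse -/

variable (A : Matrix (Fin m) (Fin m) ℝ)

/-- Finite block of the approximate inverse applied to `h`. -/
def opF (h : ℕ → ℝ) (i : Fin m) : ℝ :=
  ∑ j : Fin m, A i j * h j - beta (m - 1) * tailInv (fun n => h (m + n)) 0 * A i last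

/-- Tail of the approximate inverse applied to `h`. -/
def opI (h : ℕ → ℝ) (n : ℕ) : ℝ :=
  tailInv (fun n => h (m + n)) n - lam m * opF A h last * tailCol n

/-- The approximate inverse of the derivative of `f` at `x̄`. -/
def opA (h : ℕ → ℝ) (k : ℕ) : ℝ := if hk : k < m then opF A h ⟨k, hk⟩ else opI A h (k - m)

lemma opA_val (h : ℕ → ℝ) (i : Fin m) : opA A h i = opF A h i := by
  unfold opA; rw [dif_pos i.2]

lemma opA_tail (h : ℕ → ℝ) (n : ℕ) : opA A h (m + n) = opI A h n := by
  unfold opA; rw [dif_neg (by omega), Nat.add_sub_cancel_left]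

lemma tail_le_mu {h : ℕ → ℝ} {C : ℝ} (hC : ∀ k, |h k| ≤ C) (n : ℕ) :
    |h (m + n)| ≤ C * mu (m + n) :=
  (hC _).trans (le_mul_of_one_le_right ((abs_nonneg _).trans (hC 0)) (one_le_mu _))

lemma tailInv_shift_sub {h k : ℕ → ℝ} {C D : ℝ} (hC : ∀ n, |h n| ≤ C) (hD : ∀ n, |k n| ≤ D) :
    tailInv (fun n => (h - k) (m + n)) =
      tailInv (fun n => h (m + n)) - tailInv (fun n => k (m + n)) :=
  tailInv_sub (tail_le_mu hC) (tail_le_mu hD)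

lemma opF_sub {h k : ℕ → ℝ} {C D : ℝ} (hC : ∀ n, |h n| ≤ C) (hD : ∀ n, |k n| ≤ D) (i : Fin m) :
    opF A (h - k) i = opF A h i - opF A k i := by
  unfold opF
  rw [tailInv_shift_sub hC hD]
  simp only [Pi.sub_apply, mul_sub, Finset.sum_sub_distrib]
  ring

lemma opI_sub {h k : ℕ → ℝ} {C D : ℝ} (hC : ∀ n, |h n| ≤ C) (hD : ∀ n, |k n| ≤ D) (n : ℕ) :
    opI A (h - k) n = opI A h n - opI A k n := by
  unfold opI
  rw [opF_sub A hC hD, tailInv_shift_sub hC hD]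
  simp only [Pi.sub_apply]
  ring

lemma opA_sub {h k : ℕ → ℝ} {C D : ℝ} (hC : ∀ n, |h n| ≤ C) (hD : ∀ n, |k n| ≤ D) :
    opA A (h - k) = opA A h - opA A k := by
  funext n
  simp only [opA, Pi.sub_apply]
  split_ifs
  · exact opF_sub A hC hD _
  · exact opI_sub A hC hD _

lemma abs_opF_le {h : ℕ → ℝ} {t : ℝ} (ht : |tailInv (fun n => h (m + n)) 0| ≤ t) (i : Fin m) :
    |opF A h i| ≤ |∑ j : Fin m, A i j * h j| + |beta (m - 1)| * t * |A i last| := by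
  unfold opF
  refine (abs_sub _ _).trans (add_le_add le_rfl ?_)
  rw [abs_mul, abs_mul]
  gcongr

lemma abs_lam_mul_tailCol_le (v : ℝ) (n : ℕ) :
    |lam m * v * tailCol n| ≤ |v| * (eta * theta ^ n * (|lam m| / |mu m|)) := by
  rw [abs_mul, abs_mul]
  calc _ ≤ |lam m| * |v| * (eta * theta ^ n * (1 / mu m)) := by gcongr; exact abs_tailCol_le n
    _ = _ := by rw [abs_of_pos (mu_pos m)]; ring

lemma abs_opI_le (h : ℕ → ℝ) (n : ℕ) :
    |opI A h n| ≤ |tailInv (fun n => h (m + n)) n| +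
      |opF A h last| * (eta * theta ^ n * (|lam m| / |mu m|)) :=
  (abs_sub _ _).trans (add_le_add le_rfl (abs_lam_mul_tailCol_le _ n))

/-! ### The bound `Y` -/

lemma greenSum_of_support {r : ℕ → ℝ} {N : ℕ} (hr : ∀ n, N ≤ n → r n = 0) (k : ℕ) :
    greenSum r k = eta * (∑ l ∈ Finset.range (k + 1), theta ^ (k - l) * r l +
      ∑ l ∈ Finset.Ico (k + 1) N, theta ^ (l - k) * r l) := by
  unfold greenSum
  congr 2
  rw [Finset.sum_Ico_eq_sum_range, tsum_eq_sum (s := Finset.range (N - (k + 1)))]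
  · refine Finset.sum_congr rfl fun j _ => ?_
    rw [show k + 1 + j - k = j + 1 by omega]
  · intro j hj
    rw [Finset.mem_range] at hj
    rw [hr _ (by omega), mul_zero]

lemma conv_extend_eq_zero (v w : Fin m → ℝ) {k : ℕ} (hk : 2 * m - 1 ≤ k) :
    conv (extend v) (extend w) k = 0 := by
  unfold conv
  have hk' : 39 ≤ k := hk
  have : ∀ j : ℤ, extend v j.natAbs * extend w ((k : ℤ) - j).natAbs = 0 := fun j => by
    by_cases hj : 20 ≤ j.natAbs
    · rw [extend_of_le v hj, zero_mul]
    · rw [extend_of_le w (show 20 ≤ ((k : ℤ) - j).natAbs by omega), mul_zero]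
  simp [this]

lemma gCoeff_of_le {k : ℕ} (hk : 3 ≤ k) : gCoeff k = 0 := by
  obtain ⟨n, rfl⟩ := Nat.exists_eq_add_of_le' hk
  rfl

/-- The self-convolution of the centre ends at index `2m - 2` and its linear part at `m`, so the
sums in `Y` may stop at `l = m - 2`. -/
lemma resid_eq_zero (d : NumData) {l : ℕ} (hl : m - 1 ≤ l) : resid d l = 0 := by
  have hl' : 19 ≤ l := hl
  unfold resid f linPart
  rw [conv_extend_eq_zero _ _ (show 39 ≤ 20 + l by omega), gCoeff_of_le (show 3 ≤ 20 + l by omega),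
    if_neg (show ¬ 20 + l = 0 by omega), extend_of_le _ (show 20 ≤ 20 + l - 1 by omega),
    extend_of_le _ (show 20 ≤ 20 + l by omega), extend_of_le _ (show 20 ≤ 20 + l + 1 by omega)]
  simp

lemma resid_nonneg (d : NumData) (l : ℕ) : 0 ≤ resid d l := by unfold resid; positivity

lemma resid_le (d : NumData) (l : ℕ) : resid d l ≤ ∑ n ∈ Finset.range (m - 1), resid d n := by
  by_cases hl : l < m - 1
  · exact Finset.single_le_sum (f := resid d) (fun i _ => resid_nonneg d i) (Finset.mem_range.2 hl)
  · rw [resid_eq_zero d (not_lt.1 hl)]; exact Finset.sum_nonneg fun i _ => resid_nonneg d i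

lemma f_tail_le (d : NumData) (l : ℕ) :
    |f d.σ (extend d.x) (m + l)| ≤ mu (m + l) * resid d l := by
  have hμ := mu_pos (m + l)
  unfold resid
  rw [abs_of_pos hμ, mul_div_cancel₀ _ hμ.ne']

lemma abs_tailInv_f_le (d : NumData) (n : ℕ) :
    |tailInv (fun n => f d.σ (extend d.x) (m + n)) n| ≤ greenSum (resid d) n :=
  abs_tailInv_le (fun l => (f_tail_le d l).trans (by
      rw [mul_comm]; exact mul_le_mul_of_nonneg_right (resid_le d l) (mu_pos _).le))
    (f_tail_le d) (isSuper_greenSum (resid_nonneg d) (resid_le d)) n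

lemma greenSum_resid_zero (d : NumData) : greenSum (resid d) 0 = resid₀ d := by
  rw [greenSum_of_support (fun n hn => resid_eq_zero d hn), resid₀]
  have h := Finset.sum_eq_sum_Ico_succ_bot (show 0 < m - 1 by norm_num)
    fun l => theta ^ l * resid d l
  rw [← Finset.range_eq_Ico] at h
  rw [h]
  simp only [zero_add, Finset.sum_range_one, Nat.sub_zero, Nat.sub_self]

/-- For `k ≥ m - 2` no source lies to the right of `k`, and the factor `θ^k` can be pulled out. This
form later yields the decay in `tailMono_YI`. -/
lemma greenSum_resid (d : NumData) (k : ℕ) : greenSum (resid d) k =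
    (if k ≤ m - 3 then
        eta * ∑ l ∈ Finset.range (k + 1), theta ^ (k - l) * resid d l
          + eta * ∑ l ∈ Finset.Ico (k + 1) (m - 1), theta ^ (l - k) * resid d l
      else
        eta * theta ^ k * ∑ l ∈ Finset.range (m - 1), resid d l / theta ^ l) := by
  rw [greenSum_of_support (fun n hn => resid_eq_zero d hn)]
  split_ifs with h
  · ring
  · have h' : 18 ≤ k := by
      have : ¬ k ≤ 17 := h
      omega
    rw [Finset.Ico_eq_empty_of_le (show m - 1 ≤ k + 1 from by change 19 ≤ k + 1; omega),
      Finset.sum_empty, add_zero, mul_assoc]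
    congr 1
    rw [Finset.mul_sum]
    have hsub : Finset.range (m - 1) ⊆ Finset.range (k + 1) :=
      Finset.range_subset_range.2 (by change 19 ≤ k + 1; omega)
    rw [← Finset.sum_subset hsub]
    · refine Finset.sum_congr rfl fun l hl => ?_
      have hl' : l < 19 := Finset.mem_range.1 hl
      rw [pow_sub₀ _ theta_pos.ne' (by omega), ← div_eq_mul_inv]
      ring
    · intro l _ hl
      rw [resid_eq_zero d (not_lt.1 fun h => hl (Finset.mem_range.2 h)), mul_zero]

lemma abs_opF_f_le (d : NumData) (i : Fin m) : |opF d.A (f d.σ (extend d.x)) i| ≤ YF d i :=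
  abs_opF_le d.A ((abs_tailInv_f_le d 0).trans (greenSum_resid_zero d).le) i

lemma abs_opI_f_le (d : NumData) (k : ℕ) : |opI d.A (f d.σ (extend d.x)) k| ≤ YI d k := by
  refine (abs_opI_le d.A _ k).trans ?_
  have h1 := abs_tailInv_f_le d k
  rw [greenSum_resid] at h1
  have h2 := abs_opF_f_le d last
  have he := eta_pos
  have ht := theta_pos
  unfold YI
  rw [add_comm]
  refine add_le_add (mul_le_mul_of_nonneg_right (h2.trans (le_of_eq ?_)) (by positivity)) h1
  unfold YF
  rw [abs_mul]; ring

/-! ### Bounds for the approximate inverse on dominated sequences -/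

/-- `∑_{l ≤ k} θ^{k-l} ((m+k)/(m+l))^4`. -/
def powSum (k : ℕ) : ℝ :=
  ∑ l ∈ Finset.range (k + 1), theta ^ (k - l) * (((m : ℝ) + k) / ((m : ℝ) + l)) ^ 4

lemma powSum_succ (k : ℕ) : powSum (k + 1) =
    1 + theta * (((m : ℝ) + k + 1) / ((m : ℝ) + k)) ^ 4 * powSum k := by
  unfold powSum
  rw [Finset.sum_range_succ, Finset.mul_sum, add_comm]
  have hm : (0 : ℝ) < m := by norm_num
  congr 1
  · have : (m : ℝ) + ((k + 1 : ℕ) : ℝ) ≠ 0 := by positivity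
    rw [Nat.sub_self, pow_zero, one_mul, div_self this, one_pow]
  · refine Finset.sum_congr rfl fun l hl => ?_
    have hl' := Finset.mem_range.1 hl
    have h1 : (m : ℝ) + k ≠ 0 := by positivity
    have h2 : (m : ℝ) + l ≠ 0 := by positivity
    rw [show k + 1 - l = k - l + 1 by omega, pow_succ']
    push_cast
    field_simp
    ring

/-- The bound `1.6` is invariant under `powSum_succ`: the ratio of neighbouring indices is at most
`1.05`, and `1 + 0.3003 · 1.05⁴ · 1.6 < 1.6`. -/
lemma powSum_le (k : ℕ) : powSum k ≤ 1.6 := by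
  induction k with
  | zero => norm_num [powSum]
  | succ k ih =>
    rw [powSum_succ]
    have hk : (0 : ℝ) ≤ k := by positivity
    have h1 : (((m : ℝ) + k + 1) / ((m : ℝ) + k)) ≤ 1.05 := by
      rw [div_le_iff₀ (by norm_num; linarith)]; norm_num; linarith
    have h0 : 0 ≤ (((m : ℝ) + k + 1) / ((m : ℝ) + k)) := by positivity
    have h2 : (((m : ℝ) + k + 1) / ((m : ℝ) + k)) ^ 4 ≤ 1.05 ^ 4 := pow_le_pow_left₀ h0 h1 4
    have ht := theta_mem.2
    have htp := theta_pos
    have hp : 0 ≤ powSum k := Finset.sum_nonneg fun l _ => by positivity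
    calc 1 + theta * (((m : ℝ) + k + 1) / ((m : ℝ) + k)) ^ 4 * powSum k
        ≤ 1 + 0.3003 * 1.05 ^ 4 * 1.6 := by gcongr
      _ ≤ _ := by norm_num

/-- The last summand alone is at least `2`. Together with `powSum_le`, this is how `chi` is seen to
dominate the finite sums for all `k ≥ M`. -/
lemma two_le_chi : 2 ≤ chi := by
  have ht := theta_mem
  have htp := theta_pos
  have hs : (4.4 : ℝ) < √(M : ℝ) := by
    apply lt_sqrt_of_sq_lt; norm_num
  have hs2 : √(M : ℝ) < 5 := by
    rw [sqrt_lt' (by norm_num)]; norm_num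
  have h1 : (1.4 : ℝ) ≤ 1 / (1 - theta) := by
    rw [le_div_iff₀ (by linarith)]; linarith
  have h2 : (1.15 : ℝ) ≤ ((m : ℝ) + M) / ((m : ℝ) + M - √(M : ℝ) - 1) := by
    push_cast at hs hs2 ⊢
    rw [le_div_iff₀ (by linarith)]; linarith
  have h3 : (1.15 : ℝ) ^ 4 ≤ (((m : ℝ) + M) / ((m : ℝ) + M - √(M : ℝ) - 1)) ^ 4 :=
    pow_le_pow_left₀ (by norm_num) h2 4
  have h4 : (2 : ℝ) ≤ 1 / (1 - theta) * (((m : ℝ) + M) / ((m : ℝ) + M - √(M : ℝ) - 1)) ^ 4 := by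
    calc (2 : ℝ) ≤ 1.4 * 1.15 ^ 4 := by norm_num
      _ ≤ _ := by gcongr
  unfold chi
  have h5 : 0 ≤ theta ^ ((M : ℝ) / 2) * ((M : ℝ) / 2) * (((m : ℝ) + M) / m) ^ 4 := by positivity
  have h6 : 0 ≤ theta ^ √(M : ℝ) * ((M : ℝ) / 2) * 2 ^ 4 := by positivity
  linarith

lemma m_add_pos (n : ℕ) : 0 < m + n := Nat.add_pos_left (by norm_num) n

lemma omega_four_pos (k : ℕ) : 0 < omega 4 k := omega_pos 4 k

/-- Sources up to `k` are summed exactly. To the right of `k` the weight is replaced by its value at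
`k`, leaving a geometric series. -/
lemma greenSum_quartic_le {q : ℝ} (hq : 0 ≤ q) (k : ℕ) :
    greenSum (fun n => q / (C₁ * omega 4 (m + n))) k ≤
      eta * q / (C₁ * omega 4 (m + k)) * (powSum k + theta / (1 - theta)) := by
  have hθ := theta_pos
  have hθ1 := theta_lt_one
  have hη := eta_pos
  have hC : 0 < C₁ := by norm_num [C₁]
  have hω := omega_four_pos (m + k)
  unfold greenSum
  rw [mul_add, mul_add]
  refine add_le_add (le_of_eq ?_) ?_
  · unfold powSum
    rw [Finset.mul_sum, Finset.mul_sum]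
    refine Finset.sum_congr rfl fun l _ => ?_
    beta_reduce
    rw [omega_of_pos 4 (m_add_pos k), omega_of_pos 4 (m_add_pos l)]
    have h1 : ((m : ℝ) + k) ≠ 0 := by positivity
    have h2 : ((m : ℝ) + l) ≠ 0 := by positivity
    push_cast
    field_simp
  · have hg : HasSum (fun j : ℕ => theta ^ (j + 1) * (q / (C₁ * omega 4 (m + k))))
        (theta / (1 - theta) * (q / (C₁ * omega 4 (m + k)))) := by
      have := ((hasSum_geometric_of_lt_one hθ.le hθ1).mul_left theta).mul_right
        (q / (C₁ * omega 4 (m + k)))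
      simpa only [pow_succ', div_eq_mul_inv] using this
    have hle : ∑' j : ℕ, theta ^ (j + 1) * (q / (C₁ * omega 4 (m + (k + 1 + j)))) ≤
        theta / (1 - theta) * (q / (C₁ * omega 4 (m + k))) := by
      rw [← hg.tsum_eq]
      have hb : ∀ j : ℕ, theta ^ (j + 1) * (q / (C₁ * omega 4 (m + (k + 1 + j)))) ≤
          theta ^ (j + 1) * (q / (C₁ * omega 4 (m + k))) := fun j => by
        gcongr
        exact omega_mono 4 (by omega)
      refine Summable.tsum_le_tsum hb (Summable.of_nonneg_of_le (fun j => ?_) hb hg.summable)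
        hg.summable
      have := omega_four_pos (m + (k + 1 + j))
      positivity
    calc _ ≤ eta * (theta / (1 - theta) * (q / (C₁ * omega 4 (m + k)))) := by gcongr
      _ = _ := by ring

/-- Division by `μ_k ≥ C₁ k²` turns decay of order two into decay of order four, and the Green
function preserves it. This gain makes the tail estimates small. -/
lemma abs_tailInv_quartic_le {h : ℕ → ℝ} {q : ℝ}
    (hq : ∀ n, |h (m + n)| ≤ q / omega 2 (m + n)) (k : ℕ) :
    |tailInv (fun n => h (m + n)) k| ≤
      eta * q / (C₁ * omega 4 (m + k)) * (powSum k + theta / (1 - theta)) := by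
  have hC : 0 < C₁ := by norm_num [C₁]
  have hq0 : 0 ≤ q := by
    have h1 := (abs_nonneg _).trans (hq 0)
    have h2 := mul_nonneg h1 (omega_pos 2 (m + 0)).le
    rwa [div_mul_cancel₀ _ (omega_pos 2 _).ne'] at h2
  refine (abs_tailInv_le (C := q) (fun n => ?_) (fun n => ?_)
    (isSuper_greenSum (r := fun n => q / (C₁ * omega 4 (m + n))) (C := q) (fun n => ?_)
      fun n => ?_) k).trans (greenSum_quartic_le hq0 k)
  · refine (hq n).trans ((div_le_self hq0 (one_le_omega _ _)).trans ?_)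
    exact le_mul_of_one_le_right hq0 (one_le_mu _)
  · refine (hq n).trans ?_
    have hp := m_add_pos n
    rw [omega_of_pos 2 hp, omega_of_pos 4 hp, C₁, mu]
    have hx : (0 : ℝ) < ((m + n : ℕ) : ℝ) := by exact_mod_cast hp
    generalize ((m + n : ℕ) : ℝ) = x at hx
    rw [mul_div_assoc', div_le_div_iff₀ (by positivity) (by positivity)]
    nlinarith [mul_nonneg hq0 (sq_nonneg x)]
  · have := omega_four_pos (m + n); positivity
  · refine div_le_self hq0 ?_
    have := one_le_omega 4 (m + n)
    norm_num [C₁]; linarith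

variable {A}

lemma abs_opF_le_absAF {h : ℕ → ℝ} {cF : Fin m → ℝ} {q : ℝ} (hF : ∀ j : Fin m, |h j| ≤ cF j)
    (hq : ∀ n, |h (m + n)| ≤ q / omega 2 (m + n)) (i : Fin m) : |opF A h i| ≤ absAF A cF q i := by
  refine (abs_opF_le A (abs_tailInv_quartic_le hq 0) i).trans ?_
  unfold absAF
  refine add_le_add ?_ (le_of_eq ?_)
  · refine (Finset.abs_sum_le_sum_abs _ _).trans (Finset.sum_le_sum fun j _ => ?_)
    rw [abs_mul]
    exact mul_le_mul_of_nonneg_left (hF j) (abs_nonneg _)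
  · have h1 : 1 - theta ≠ 0 := by linarith [theta_lt_one]
    have h2 := (omega_four_pos m).ne'
    have h3 : C₁ ≠ 0 := by norm_num [C₁]
    have hp : powSum 0 = 1 := by norm_num [powSum]
    rw [hp, add_zero]
    field_simp
    ring

lemma abs_opI_le_absAI {h : ℕ → ℝ} {cF : Fin m → ℝ} {q : ℝ} (hF : ∀ j : Fin m, |h j| ≤ cF j)
    (hq : ∀ n, |h (m + n)| ≤ q / omega 2 (m + n)) (k : ℕ) : |opI A h k| ≤ absAI A cF q k := by
  have hη := eta_pos
  have hθ := theta_pos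
  have hC : 0 < C₁ := by norm_num [C₁]
  have hq0 : 0 ≤ q := by
    have h1 := (abs_nonneg _).trans (hq 0)
    have h2 := mul_nonneg h1 (omega_pos 2 (m + 0)).le
    rwa [div_mul_cancel₀ _ (omega_pos 2 _).ne'] at h2
  refine (abs_opI_le A h k).trans ?_
  unfold absAI
  rw [add_comm]
  refine add_le_add ?_ ((abs_tailInv_quartic_le hq k).trans ?_)
  · rw [show eta * theta ^ k * (|lam m| / |mu m|) = eta * (|lam m| / |mu m|) * theta ^ k by ring]
    exact mul_le_mul_of_nonneg_right (abs_opF_le_absAF hF hq last) (by positivity)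
  · have := omega_four_pos (m + k)
    gcongr
    split_ifs
    · exact le_rfl
    · linarith [powSum_le k, two_le_chi]

lemma absAF_add_smul (c c' : Fin m → ℝ) (q q' a : ℝ) (i : Fin m) :
    absAF A (fun j => a * (c j + c' j)) (a * (q + q')) i =
      a * (absAF A c q i + absAF A c' q' i) := by
  unfold absAF
  have : ∑ j, |A i j| * (a * (c j + c' j)) = a * (∑ j, |A i j| * c j + ∑ j, |A i j| * c' j) := by
    rw [← Finset.sum_add_distrib, Finset.mul_sum]
    exact Finset.sum_congr rfl fun j _ => by ring
  rw [this]; ring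

lemma absAI_add_smul (c c' : Fin m → ℝ) (q q' a : ℝ) (k : ℕ) :
    absAI A (fun j => a * (c j + c' j)) (a * (q + q')) k =
      a * (absAI A c q k + absAI A c' q' k) := by
  unfold absAI
  rw [absAF_add_smul]; ring

/-! ### The linearization -/

lemma conv_extend (v : Fin m → ℝ) (y : ℕ → ℝ) (k : ℕ) :
    conv (extend v) y k =
      ∑ j ∈ Finset.Icc (-19 : ℤ) 19, extend v j.natAbs * y ((k : ℤ) - j).natAbs := by
  unfold conv
  refine tsum_eq_sum fun j hj => ?_
  rw [extend_of_le v, zero_mul]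
  rw [Finset.mem_Icc] at hj
  change 20 ≤ j.natAbs
  omega

lemma extend_eq_sum (v : Fin m → ℝ) (k : ℕ) :
    extend v k = ∑ j : Fin m, v j * (Pi.single (j : ℕ) 1 : ℕ → ℝ) k := by
  by_cases hk : k < m
  · rw [Finset.sum_eq_single ⟨k, hk⟩]
    · simp [extend, hk]
    · intro j _ hj
      rw [Pi.single_eq_of_ne, mul_zero]
      rintro rfl; exact hj rfl
    · simp
  · rw [extend_of_le v (not_lt.1 hk)]
    refine (Finset.sum_eq_zero fun j _ => ?_).symm
    rw [Pi.single_eq_of_ne, mul_zero]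
    rintro rfl; exact hk j.2

lemma sum_jac_mul (d : NumData) (v : Fin m → ℝ) (i : Fin m) :
    ∑ j, jac d i j * v j = linPart (extend v) i + 2 * d.σ * conv (extend d.x) (extend v) i := by
  have h1 : linPart (extend v) i = ∑ j : Fin m, linPart (Pi.single (j : ℕ) 1) i * v j := by
    simp only [linPart]
    rw [extend_eq_sum v i, extend_eq_sum v (i + 1), extend_eq_sum v (i - 1)]
    simp only [add_mul, Finset.sum_add_distrib, Finset.mul_sum]
    congr 1
    · congr 1
      · split_ifs
        · simp
        · exact Finset.sum_congr rfl fun j _ => by ring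
      · exact Finset.sum_congr rfl fun j _ => by ring
    · exact Finset.sum_congr rfl fun j _ => by ring
  have h2 : conv (extend d.x) (extend v) i =
      ∑ j : Fin m, conv (extend d.x) (Pi.single (j : ℕ) 1) i * v j := by
    simp only [conv_extend]
    simp only [extend_eq_sum v, Finset.mul_sum, Finset.sum_mul]
    rw [Finset.sum_comm]
    exact Finset.sum_congr rfl fun j _ => Finset.sum_congr rfl fun l _ => by ring
  rw [h1, h2, Finset.mul_sum, ← Finset.sum_add_distrib]
  exact Finset.sum_congr rfl fun j _ => by unfold jac; ring

/-- The first `m` entries of a sequence. -/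
def head (z : ℕ → ℝ) (j : Fin m) : ℝ := z j

/-- The approximate derivative: Jacobian block, tridiagonal coupling, tridiagonal tail. -/
def approxDeriv (d : NumData) (z : ℕ → ℝ) (k : ℕ) : ℝ :=
  linPart z k + if k < m then 2 * d.σ * conv (extend d.x) (extend (head z)) k else 0

/-- The coefficients grow quadratically and are compensated by the weight. Boundedness guarantees
that `tailInv` is applied only where it is a true inverse and not its default value `0`. -/
lemma abs_linPart_le {z : ℕ → ℝ} {ζ : ℝ} (hz : Dominated z ζ) (k : ℕ) : |linPart z k| ≤ 5 * ζ := by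
  have hζ := hz.nonneg
  have h1 : |mu k * z k| ≤ 3 * ζ := by
    rw [abs_mul, abs_of_pos (mu_pos k)]
    calc _ ≤ mu k * (ζ / omega 2 k) := mul_le_mul_of_nonneg_left (hz k) (mu_pos k).le
      _ = mu k / omega 2 k * ζ := by ring
      _ ≤ 3 * ζ := by
        gcongr
        rw [div_le_iff₀ (omega_pos 2 k)]
        rcases Nat.eq_zero_or_pos k with rfl | hk
        · rw [omega_zero, mu]; norm_num
        · rw [omega_of_pos 2 hk, mu]
          have : (1 : ℝ) ≤ k := by exact_mod_cast hk
          nlinarith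
  have h2 : |beta k * z (k + 1)| ≤ ζ := by
    rw [abs_mul, abs_of_pos (beta_pos k)]
    calc _ ≤ beta k * (ζ / omega 2 (k + 1)) := mul_le_mul_of_nonneg_left (hz _) (beta_pos k).le
      _ = beta k / omega 2 (k + 1) * ζ := by ring
      _ ≤ 1 * ζ := by
        gcongr
        rw [div_le_one (omega_pos 2 _), omega_of_pos 2 (Nat.succ_pos k), beta]
        push_cast
        split_ifs with h
        · simp [h]
        · nlinarith [sq_nonneg ((k : ℝ) + 1)]
      _ = ζ := one_mul ζ
  have h3 : |if k = 0 then 0 else lam k * z (k - 1)| ≤ ζ := by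
    split_ifs with h
    · simpa using hζ
    · rw [abs_mul, abs_of_nonneg (lam_nonneg k)]
      calc _ ≤ lam k * (ζ / omega 2 (k - 1)) := mul_le_mul_of_nonneg_left (hz _) (lam_nonneg k)
        _ = lam k / omega 2 (k - 1) * ζ := by ring
        _ ≤ 1 * ζ := by
          gcongr
          rw [div_le_one (omega_pos 2 _), lam]
          obtain ⟨n, rfl⟩ := Nat.exists_eq_succ_of_ne_zero h
          simp only [Nat.succ_eq_add_one, Nat.add_sub_cancel]
          push_cast
          rcases Nat.eq_zero_or_pos n with rfl | hn
          · rw [omega_zero]; norm_num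
          · rw [omega_of_pos 2 hn]; nlinarith [sq_nonneg (n : ℝ)]
        _ = ζ := one_mul ζ
  unfold linPart
  linarith [abs_add_le ((if k = 0 then 0 else lam k * z (k - 1)) + mu k * z k) (beta k * z (k + 1)),
    abs_add_le (if k = 0 then 0 else lam k * z (k - 1)) (mu k * z k)]

lemma alpha_le_sum (k : ℕ) : alpha k ≤ ∑ j ∈ Finset.range (m + 1), alpha j := by
  by_cases hk : k < m + 1
  · exact Finset.single_le_sum (f := alpha) (fun i _ => alpha_nonneg i) (Finset.mem_range.2 hk)
  · rw [alpha_of_le (show m ≤ k by omega)]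
    exact Finset.single_le_sum (f := alpha) (fun i _ => alpha_nonneg i)
      (Finset.mem_range.2 (Nat.lt_succ_self m))

lemma Dominated.conv_dominated {x y : ℕ → ℝ} {a b : ℝ} (hx : Dominated x a) (hy : Dominated y b) :
    Dominated (conv x y) (a * b * ∑ j ∈ Finset.range (m + 1), alpha j) := fun k =>
  (abs_conv_le hx hy k).trans (div_le_div_of_nonneg_right
    (mul_le_mul_of_nonneg_left (alpha_le_sum k) (mul_nonneg hx.nonneg hy.nonneg))
    (omega_pos 2 k).le)

lemma dominated_head {z : ℕ → ℝ} {ζ : ℝ} (hz : Dominated z ζ) : Dominated (extend (head z)) ζ :=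
  fun k => by
    by_cases hk : k < m
    · simpa [extend, hk, head] using hz k
    · rw [extend_of_le _ (not_lt.1 hk), abs_zero]
      exact div_nonneg hz.nonneg (omega_pos 2 k).le

/-- The derivative of `f` at `c`, applied to `z`. -/
def linDeriv (σ : ℝ) (c z : ℕ → ℝ) : ℕ → ℝ := linPart z + (2 * σ) • conv c z

lemma deriv_bounded (σ : ℝ) {c z : ℕ → ℝ} {a ζ : ℝ} (hc : Dominated c a) (hz : Dominated z ζ) :
    ∃ C, ∀ k, |linDeriv σ c z k| ≤ C :=
  ⟨_, fun k => (abs_add_le _ _).trans (add_le_add (abs_linPart_le hz k)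
    (((hc.conv_dominated hz).smul (2 * σ)).abs_le k))⟩

lemma approxDeriv_bounded (d : NumData) {z : ℕ → ℝ} {ζ : ℝ} (hz : Dominated z ζ) :
    ∃ C, ∀ k, |approxDeriv d z k| ≤ C := by
  have hc := (memOmega_extend d.x).dominated.conv_dominated (dominated_head hz)
  have h := (hc.smul (2 * d.σ))
  refine ⟨5 * ζ + |2 * d.σ| * (normOmega 2 (extend d.x) * ζ * ∑ j ∈ Finset.range (m + 1), alpha j),
    fun k => (abs_add_le _ _).trans (add_le_add (abs_linPart_le hz k) ?_)⟩
  split_ifs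
  · exact h.abs_le k
  · rw [abs_zero]; exact h.nonneg

lemma approxDeriv_tail (d : NumData) (z : ℕ → ℝ) :
    (fun n => approxDeriv d z (m + n)) =
      tailOp (fun n => z (m + n)) + (lam m * z (m - 1)) • Pi.single 0 1 := by
  funext n
  simp only [approxDeriv, Pi.add_apply, Pi.smul_apply, smul_eq_mul, linPart, tailOp]
  rw [if_neg (show ¬ m + n < m by omega), if_neg (m_add_pos n).ne']
  rcases n with _ | n
  · simp; ring
  · simp only [Nat.add_eq_zero_iff, one_ne_zero, and_false, if_false, Nat.add_sub_cancel]
    rw [Pi.single_eq_of_ne (Nat.succ_ne_zero n)]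
    rw [show m + (n + 1) - 1 = m + n by omega, show m + (n + 1) + 1 = m + (n + 1 + 1) by omega]
    ring

/-- The finite modes reach the tail only through `λ_m z_{m-1}` in its first row, so inverting adds a
multiple of the first column `tailCol`. -/
lemma tailInv_approxDeriv (d : NumData) {z : ℕ → ℝ} {ζ : ℝ} (hz : Dominated z ζ) :
    tailInv (fun n => approxDeriv d z (m + n)) =
      fun n => z (m + n) + lam m * z (m - 1) * tailCol n := by
  obtain ⟨C, hC⟩ := approxDeriv_bounded d hz
  obtain ⟨D, hD⟩ := tailInv_bounded (Pi.single 0 1)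
  refine tailInv_eq (C := ζ + |lam m * z (m - 1)| * D) (fun n => ?_) (tail_le_mu hC) ?_
  · refine (abs_add_le _ _).trans (add_le_add (hz.abs_le _) ?_)
    rw [abs_mul]
    exact mul_le_mul_of_nonneg_left (hD n) (abs_nonneg _)
  · have e : (fun n => z (m + n) + lam m * z (m - 1) * tailCol n) =
        (fun n => z (m + n)) + (lam m * z (m - 1)) • tailCol := rfl
    rw [approxDeriv_tail, e, tailOp_add, tailOp_smul, tailOp_tailCol]

lemma approxDeriv_val (d : NumData) (z : ℕ → ℝ) (i : Fin m) :
    approxDeriv d z i = ∑ j, jac d i j * head z j +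
      if i = last then beta (m - 1) * z m else 0 := by
  rw [sum_jac_mul]
  unfold approxDeriv
  rw [if_pos i.2]
  have hi : extend (head z) i = z i := extend_val (head z) i
  have hi' : extend (head z) (i - 1) = z (i - 1) := by
    have : (i : ℕ) - 1 < m := by omega
    simp [extend, this, head]
  have key : linPart z i = linPart (extend (head z)) i +
      if i = last then beta (m - 1) * z m else 0 := by
    unfold linPart
    rw [hi, hi']
    split_ifs with h0 h1 h1
    · subst h1; simp at h0
    · have : extend (head z) (i + 1) = z (i + 1) := by
        simp [extend, h0, head]
      rw [this]; ring
    · subst h1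
      rw [extend_of_le _ (show m ≤ ((last : Fin m) : ℕ) + 1 by decide)]
      change _ + beta 19 * z 20 = _ + beta 19 * 0 + beta 19 * z 20
      ring
    · have hlt : (i : ℕ) + 1 < m := by
        have h2 : (i : ℕ) ≠ 19 := fun h => h1 (Fin.ext h)
        have h3 : (i : ℕ) < 20 := i.2
        change (i : ℕ) + 1 < 20
        omega
      have : extend (head z) (i + 1) = z (i + 1) := by
        unfold extend; rw [dif_pos hlt]; rfl
      rw [this]; ring
  rw [key]; ring

lemma last_val : ((last : Fin m) : ℕ) = m - 1 := rfl

/-- Block elimination: the term `β_{m-1} z_m` in the last finite row cancels against the tail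
correction in `opF`, leaving the Schur complement with `tailCol 0`. Replacing that entry by `wTilde`
produces the second summand. -/
lemma sub_opF_approxDeriv (d : NumData) {z : ℕ → ℝ} {ζ : ℝ} (hz : Dominated z ζ) (i : Fin m) :
    z i - opF d.A (approxDeriv d z) i = ∑ j, (1 - d.A * KTilde d) i j * head z j +
      beta (m - 1) * lam m * (tailCol 0 - wTilde) * z (m - 1) * d.A i last := by
  have h1 : ∑ j, (1 - d.A * KTilde d) i j * head z j = z i -
      (∑ j, d.A i j * ∑ l, jac d j l * head z l -
        d.A i last * (beta (m - 1) * lam m * wTilde) * z (m - 1)) := by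
    have : ∑ j, (1 - d.A * KTilde d) i j * head z j =
        ((1 - d.A * KTilde d).mulVec (head z)) i := rfl
    rw [this, Matrix.sub_mulVec, Matrix.one_mulVec, KTilde, Matrix.mul_sub, Matrix.sub_mulVec,
      ← Matrix.mulVec_mulVec, ← Matrix.mulVec_mulVec]
    simp only [Pi.sub_apply]
    congr 2
    simp only [Matrix.mulVec, dotProduct, Matrix.single_apply]
    rw [Finset.sum_eq_single last]
    · rw [Finset.sum_eq_single last]
      · simp only [and_self, if_true, head, last_val]; ring
      · intro j _ hj
        rw [if_neg (fun h => hj h.2.symm), zero_mul]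
      · simp
    · intro j _ hj
      rw [Finset.sum_eq_zero, mul_zero]
      intro l _
      rw [if_neg (fun h => hj h.1.symm), zero_mul]
    · simp
  rw [h1]
  unfold opF
  rw [tailInv_approxDeriv d hz]
  simp only [approxDeriv_val, mul_add, Finset.sum_add_distrib, mul_ite, mul_zero,
    Finset.sum_ite_eq', Finset.mem_univ, if_true, add_zero]
  ring

lemma abs_sub_opF_approxDeriv (d : NumData) {z : ℕ → ℝ} {ζ : ℝ} (hz : Dominated z ζ) (i : Fin m) :
    |z i - opF d.A (approxDeriv d z) i| ≤ z1F d i * ζ := by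
  rw [sub_opF_approxDeriv d hz, z1F, add_mul]
  refine (abs_add_le _ _).trans (add_le_add ?_ ?_)
  · rw [Finset.sum_mul]
    refine (Finset.abs_sum_le_sum_abs _ _).trans (Finset.sum_le_sum fun j _ => ?_)
    rw [abs_mul]
    calc _ ≤ |(1 - d.A * KTilde d) i j| * (ζ / omega 2 j) :=
          mul_le_mul_of_nonneg_left (hz j) (abs_nonneg _)
      _ = _ := by ring
  · simp only [abs_mul]
    have hw := abs_tailCol_sub_wTilde
    have hζ := hz.nonneg
    have ho := omega_pos 2 (m - 1)
    have h0 := (abs_nonneg _).trans hw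
    rw [abs_of_pos (mu_pos m)]
    have ht := one_sub_theta_sq_pos
    have hμ := mu_pos m
    generalize theta ^ (2 * L) = p at hw h0 ⊢
    calc _ ≤ |beta (m - 1)| * |lam m| * (p / (mu m * (1 - theta ^ 2))) *
          (ζ / omega 2 (m - 1)) * |d.A i last| := by
          gcongr
          exact hz _
      _ = _ := by
        field_simp

/-- As the tail is inverted exactly, its defect is only the defect of the last finite coordinate,
transported by `-λ_m tailCol`. -/
lemma abs_sub_opI_approxDeriv (d : NumData) {z : ℕ → ℝ} {ζ : ℝ} (hz : Dominated z ζ) (n : ℕ) :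
    |z (m + n) - opI d.A (approxDeriv d z) n| ≤ z1I d n * ζ := by
  have e : z (m + n) - opI d.A (approxDeriv d z) n =
      -(lam m * (z ((last : Fin m) : ℕ) - opF d.A (approxDeriv d z) last) * tailCol n) := by
    unfold opI
    rw [tailInv_approxDeriv d hz, last_val]
    ring
  have hη := eta_pos
  have hθ := theta_pos
  rw [e, abs_neg]
  refine (abs_lam_mul_tailCol_le _ n).trans ?_
  calc _ ≤ (z1F d last * ζ) * (eta * theta ^ n * (|lam m| / |mu m|)) := by
        gcongr; exact abs_sub_opF_approxDeriv d hz last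
    _ = _ := by unfold z1I; ring

/-- A pair contributes only if `|j| < m ≤ |i - j|`. For `i < m` this forces `j = -l` with `m - i ≤ l
< m`. -/
lemma abs_conv_sub_head_le (v : Fin m → ℝ) {z : ℕ → ℝ} {ζ : ℝ} (hz : Dominated z ζ) (i : Fin m) :
    |conv (extend v) (z - extend (head z)) i| ≤
      ζ * ∑ l ∈ Finset.Ico (m - (i : ℕ)) m, |extend v l| / omega 2 ((i : ℕ) + l) := by
  have hi : (i : ℕ) < 20 := i.2
  have hsmall : ∀ k, k < 20 → (z - extend (head z)) k = 0 := fun k hk => by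
    have : extend (head z) k = z k := extend_val (head z) ⟨k, hk⟩
    rw [Pi.sub_apply, this, sub_self]
  have hbig : ∀ k, 20 ≤ k → (z - extend (head z)) k = z k := fun k hk => by
    rw [Pi.sub_apply, extend_of_le _ hk, sub_zero]
  have hsum : conv (extend v) (z - extend (head z)) i =
      ∑ l ∈ Finset.Ico (m - (i : ℕ)) m, extend v l * z ((i : ℕ) + l) := by
    rw [conv_extend]
    have hinj : Set.InjOn (fun l : ℕ => -(l : ℤ)) (Finset.Ico (m - (i : ℕ)) m) :=
      fun a _ b _ h => by simpa using h
    rw [← Finset.sum_subset (s₁ := (Finset.Ico (m - (i : ℕ)) m).image fun l : ℕ => -(l : ℤ)),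
      Finset.sum_image hinj]
    · refine Finset.sum_congr rfl fun l hl => ?_
      rw [Finset.mem_Ico] at hl
      have h1 : 20 - (i : ℕ) ≤ l := hl.1
      have e1 : (-(l : ℤ)).natAbs = l := by omega
      have e2 : (((i : ℕ) : ℤ) - -(l : ℤ)).natAbs = (i : ℕ) + l := by omega
      rw [e1, e2, hbig _ (by omega)]
    · intro j hj
      rw [Finset.mem_image] at hj
      obtain ⟨l, hl, rfl⟩ := hj
      rw [Finset.mem_Ico] at hl
      have h2 : l < 20 := hl.2
      rw [Finset.mem_Icc]; omega
    · intro j hj hj'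
      rw [Finset.mem_Icc] at hj
      rw [hsmall, mul_zero]
      by_contra hcon
      apply hj'
      rw [Finset.mem_image]
      refine ⟨j.natAbs, ?_, ?_⟩
      · rw [Finset.mem_Ico]
        constructor
        · change 20 - (i : ℕ) ≤ _; omega
        · change _ < 20; omega
      · omega
  rw [hsum, Finset.mul_sum]
  refine (Finset.abs_sum_le_sum_abs _ _).trans (Finset.sum_le_sum fun l _ => ?_)
  rw [abs_mul]
  calc _ ≤ |extend v l| * (ζ / omega 2 ((i : ℕ) + l)) :=
        mul_le_mul_of_nonneg_left (hz _) (abs_nonneg _)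
    _ = _ := by ring

/-- The Lipschitz bound `Z(r) / r` on the finite block. -/
def lipF (d : NumData) (r : ℝ) (i : Fin m) : ℝ :=
  z1F d i + (absAF d.A (c1F d) (q1 d) i + absAF d.A (fun j => r * c2F d j) (r * q2 d) i)

/-- The Lipschitz bound `Z(r) / r` on the tail. -/
def lipI (d : NumData) (r : ℝ) (k : ℕ) : ℝ :=
  z1I d k + (absAI d.A (c1F d) (q1 d) k + absAI d.A (fun j => r * c2F d j) (r * q2 d) k)

/-- In the finite rows the approximate derivative omits two things: the centre convolved with the
tail of `z`, giving `c1F`, and the displacement `b` convolved with `z`, giving `r * c2F`. -/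
lemma deriv_sub_approxDeriv_val (d : NumData) {z b : ℕ → ℝ} {r ζ : ℝ} (hb : Dominated b r)
    (hz : Dominated z ζ) (i : Fin m) :
    |(linDeriv d.σ (extend d.x + b) z - approxDeriv d z) i| ≤ ζ * (c1F d i + r * c2F d i) := by
  have hx := (memOmega_extend d.x).dominated
  have hh := dominated_head hz
  have e : (linDeriv d.σ (extend d.x + b) z - approxDeriv d z) i =
      2 * d.σ * (conv (extend d.x) (z - extend (head z)) i + conv b z i) := by
    have h1 := congrFun (conv_add_left hx hb hz) i
    have h2 := congrFun (conv_add_right hx (hz.sub hh) hh) i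
    rw [sub_add_cancel] at h2
    simp only [Pi.add_apply] at h1 h2
    simp only [linDeriv, approxDeriv, Pi.sub_apply, Pi.add_apply, Pi.smul_apply, smul_eq_mul,
      if_pos i.2, h1, h2]
    ring
  rw [e, abs_mul, abs_mul, abs_two]
  have h1 := abs_conv_sub_head_le d.x hz i
  have h2 := abs_conv_le hb hz i
  calc _ ≤ 2 * |d.σ| * (ζ * ∑ l ∈ Finset.Ico (m - (i : ℕ)) m,
        |extend d.x l| / omega 2 ((i : ℕ) + l) + r * ζ * alpha i / omega 2 i) := by
        gcongr
        exact (abs_add_le _ _).trans (add_le_add h1 h2)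
    _ = _ := by unfold c1F c2F; ring

lemma deriv_sub_approxDeriv_tail (d : NumData) {z b : ℕ → ℝ} {r ζ : ℝ} (hb : Dominated b r)
    (hz : Dominated z ζ) (n : ℕ) :
    |(linDeriv d.σ (extend d.x + b) z - approxDeriv d z) (m + n)| ≤
      ζ * (q1 d + r * q2 d) / omega 2 (m + n) := by
  have hx := (memOmega_extend d.x).dominated
  have e : (linDeriv d.σ (extend d.x + b) z - approxDeriv d z) (m + n) =
      2 * d.σ * conv (extend d.x + b) z (m + n) := by
    simp only [linDeriv, approxDeriv, Pi.sub_apply, Pi.add_apply, Pi.smul_apply, smul_eq_mul,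
      if_neg (show ¬ m + n < m by omega)]
    ring
  rw [e, abs_mul, abs_mul, abs_two]
  have h := abs_conv_le (hx.add hb) hz (m + n)
  rw [alpha_of_le (Nat.le_add_right m n)] at h
  calc _ ≤ 2 * |d.σ| * ((normOmega 2 (extend d.x) + r) * ζ * alpha m / omega 2 (m + n)) := by
        gcongr
    _ = _ := by unfold q1 q2; ring

lemma abs_sub_opF_deriv (d : NumData) {z b : ℕ → ℝ} {r ζ : ℝ} (hb : Dominated b r)
    (hz : Dominated z ζ) (i : Fin m) :
    |z i - opF d.A (linDeriv d.σ (extend d.x + b) z) i| ≤ lipF d r i * ζ := by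
  have hx := (memOmega_extend d.x).dominated
  obtain ⟨C, hC⟩ := deriv_bounded d.σ (hx.add hb) hz
  obtain ⟨D, hD⟩ := approxDeriv_bounded d hz
  have h1 := abs_sub_opF_approxDeriv d hz i
  have h2 := abs_opF_le_absAF (A := d.A) (deriv_sub_approxDeriv_val d hb hz)
    (deriv_sub_approxDeriv_tail d hb hz) i
  rw [opF_sub d.A hC hD, absAF_add_smul] at h2
  have e : z i - opF d.A (linDeriv d.σ (extend d.x + b) z) i =
      (z i - opF d.A (approxDeriv d z) i) -
      (opF d.A (linDeriv d.σ (extend d.x + b) z) i - opF d.A (approxDeriv d z) i) := by ring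
  rw [e]
  refine (abs_sub _ _).trans ((add_le_add h1 h2).trans (le_of_eq ?_))
  unfold lipF; ring

lemma abs_sub_opI_deriv (d : NumData) {z b : ℕ → ℝ} {r ζ : ℝ} (hb : Dominated b r)
    (hz : Dominated z ζ) (n : ℕ) :
    |z (m + n) - opI d.A (linDeriv d.σ (extend d.x + b) z) n| ≤ lipI d r n * ζ := by
  have hx := (memOmega_extend d.x).dominated
  obtain ⟨C, hC⟩ := deriv_bounded d.σ (hx.add hb) hz
  obtain ⟨D, hD⟩ := approxDeriv_bounded d hz
  have h1 := abs_sub_opI_approxDeriv d hz n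
  have h2 := abs_opI_le_absAI (A := d.A) (deriv_sub_approxDeriv_val d hb hz)
    (deriv_sub_approxDeriv_tail d hb hz) n
  rw [opI_sub d.A hC hD, absAI_add_smul] at h2
  have e : z (m + n) - opI d.A (linDeriv d.σ (extend d.x + b) z) n =
      (z (m + n) - opI d.A (approxDeriv d z) n) -
      (opI d.A (linDeriv d.σ (extend d.x + b) z) n - opI d.A (approxDeriv d z) n) := by ring
  rw [e]
  refine (abs_sub _ _).trans ((add_le_add h1 h2).trans (le_of_eq ?_))
  unfold lipI; ring

/-! ### Behaviour of the tail bounds beyond the index `m + M` -/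

/-- The weighted values `ω_{m+k}² F_k` for `k ≥ M` are bounded by the one at `k = M`. -/
def TailMono (F : ℕ → ℝ) : Prop := ∀ k, M ≤ k → omega 2 (m + k) * F k ≤ omega 2 (m + M) * F M

lemma TailMono.add {F G : ℕ → ℝ} (hF : TailMono F) (hG : TailMono G) :
    TailMono fun k => F k + G k := fun k hk => by
  rw [mul_add, mul_add]; exact add_le_add (hF k hk) (hG k hk)

lemma TailMono.const_mul {F : ℕ → ℝ} (hF : TailMono F) {c : ℝ} (hc : 0 ≤ c) :
    TailMono fun k => c * F k := fun k hk => by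
  rw [mul_left_comm, mul_left_comm (omega 2 (m + M))]
  exact mul_le_mul_of_nonneg_left (hF k hk) hc

lemma TailMono.congr {F G : ℕ → ℝ} (hF : TailMono F) (h : ∀ k, M ≤ k → G k = F k) :
    TailMono G := fun k hk => by
  rw [h k hk, h M le_rfl]; exact hF k hk

lemma tailMono_theta : TailMono fun k => theta ^ k := by
  intro k hk
  induction k, hk using Nat.le_induction with
  | base => exact le_rfl
  | succ k hk ih =>
    refine le_trans ?_ ih
    rw [omega_of_pos 2 (m_add_pos _), omega_of_pos 2 (m_add_pos _), pow_succ]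
    have ht := theta_mem.2
    have ht0 := theta_pos
    have hk0 : (0 : ℝ) ≤ k := by positivity
    push_cast
    have h : (20 + ((k : ℝ) + 1)) ^ 2 * theta ≤ (20 + (k : ℝ)) ^ 2 := by nlinarith
    calc _ = theta ^ k * ((20 + ((k : ℝ) + 1)) ^ 2 * theta) := by ring
      _ ≤ theta ^ k * (20 + (k : ℝ)) ^ 2 := mul_le_mul_of_nonneg_left h (by positivity)
      _ = _ := by ring

lemma tailMono_quartic : TailMono fun k => 1 / omega 4 (m + k) := by
  intro k hk
  beta_reduce
  rw [omega_of_pos 2 (m_add_pos _), omega_of_pos 2 (m_add_pos _),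
    omega_of_pos 4 (m_add_pos _), omega_of_pos 4 (m_add_pos _)]
  have h1 : (0 : ℝ) < ((m + M : ℕ) : ℝ) := by norm_num
  have h2 : ((m + M : ℕ) : ℝ) ≤ ((m + k : ℕ) : ℝ) := by exact_mod_cast Nat.add_le_add_left hk m
  generalize ((m + M : ℕ) : ℝ) = a at *
  generalize ((m + k : ℕ) : ℝ) = b at *
  have hb : 0 < b := h1.trans_le h2
  have e : ∀ t : ℝ, 0 < t → t ^ 2 * (1 / t ^ 4) = 1 / t ^ 2 := fun t ht => by field_simp
  rw [e a h1, e b hb]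
  gcongr

lemma YF_nonneg (d : NumData) (i : Fin m) : 0 ≤ YF d i := (abs_nonneg _).trans (abs_opF_f_le d i)

lemma YI_nonneg (d : NumData) (k : ℕ) : 0 ≤ YI d k := (abs_nonneg _).trans (abs_opI_f_le d k)

lemma tailMono_YI (d : NumData) : TailMono (YI d) := by
  have hη := eta_pos
  have hθ := theta_pos
  have h0 : 0 ≤ YF d last * (eta * (|lam m| / |mu m|)) +
      eta * ∑ l ∈ Finset.range (m - 1), resid d l / theta ^ l := by
    have h1 : 0 ≤ ∑ l ∈ Finset.range (m - 1), resid d l / theta ^ l :=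
      Finset.sum_nonneg fun l _ => div_nonneg (resid_nonneg d l) (by positivity)
    have := YF_nonneg d last
    positivity
  refine (tailMono_theta.const_mul h0).congr fun k hk => ?_
  have hk' : ¬ k ≤ m - 3 := by
    have : 20 ≤ k := hk
    change ¬ k ≤ 17
    omega
  unfold YI YF
  rw [if_neg hk', abs_mul]
  ring

lemma z1F_nonneg (d : NumData) (i : Fin m) : 0 ≤ z1F d i := by
  have h1 := one_sub_theta_sq_pos
  have hθ := theta_pos
  have h2 := omega_pos 2 (m - 1)
  have h3 : 0 ≤ theta ^ (2 * L) := pow_nonneg hθ.le _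
  unfold z1F
  refine add_nonneg (Finset.sum_nonneg fun j _ => div_nonneg (abs_nonneg _) (omega_pos 2 j).le) ?_
  generalize theta ^ (2 * L) = p at h3 ⊢
  positivity

lemma tailMono_z1I (d : NumData) : TailMono (z1I d) := by
  have hη := eta_pos
  have h0 : 0 ≤ z1F d last * (eta * (|lam m| / |mu m|)) := by
    have := z1F_nonneg d last; positivity
  refine (tailMono_theta.const_mul h0).congr fun k _ => ?_
  unfold z1I; ring

lemma absAF_nonneg {A : Matrix (Fin m) (Fin m) ℝ} {c : Fin m → ℝ} {q : ℝ} (hc : ∀ j, 0 ≤ c j)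
    (hq : 0 ≤ q) (i : Fin m) : 0 ≤ absAF A c q i := by
  have h1 : 0 < 1 - theta := by linarith [theta_lt_one]
  have h2 := omega_four_pos m
  have h3 : 0 < C₁ := by norm_num [C₁]
  have hη := eta_pos
  unfold absAF
  refine add_nonneg (Finset.sum_nonneg fun j _ => mul_nonneg (abs_nonneg _) (hc j)) ?_
  positivity

/-- From `k = M` on the bracket is the constant `chi + θ/(1-θ)`, so the bound is a nonnegative
combination of `θ^k` and an inverse fourth power. -/
lemma tailMono_absAI {A : Matrix (Fin m) (Fin m) ℝ} {c : Fin m → ℝ} {q : ℝ} (hc : ∀ j, 0 ≤ c j)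
    (hq : 0 ≤ q) : TailMono (absAI A c q) := by
  have hη := eta_pos
  have hθ := theta_pos
  have h1 : 0 < 1 - theta := by linarith [theta_lt_one]
  have h3 : 0 < C₁ := by norm_num [C₁]
  have ha := absAF_nonneg (A := A) hc hq last
  have hχ := two_le_chi
  have h0 : 0 ≤ absAF A c q last * (eta * (|lam m| / |mu m|)) := by positivity
  have h0' : 0 ≤ eta * q / C₁ * (chi + theta / (1 - theta)) := by positivity
  refine ((tailMono_theta.const_mul h0).add (tailMono_quartic.const_mul h0')).congr fun k hk => ?_
  unfold absAI
  rw [if_neg (not_lt.2 hk)]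
  have := (omega_four_pos (m + k)).ne'
  field_simp

lemma c1F_nonneg (d : NumData) (j : Fin m) : 0 ≤ c1F d j :=
  mul_nonneg (by positivity) (Finset.sum_nonneg fun l _ =>
    div_nonneg (abs_nonneg _) (omega_pos 2 _).le)

lemma c2F_nonneg (d : NumData) (j : Fin m) : 0 ≤ c2F d j :=
  div_nonneg (mul_nonneg (by positivity) (alpha_nonneg _)) (omega_pos 2 _).le

lemma q1_nonneg (d : NumData) : 0 ≤ q1 d :=
  mul_nonneg (mul_nonneg (by positivity) (alpha_nonneg _)) (memOmega_extend d.x).dominated.nonneg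

lemma q2_nonneg (d : NumData) : 0 ≤ q2 d := mul_nonneg (by positivity) (alpha_nonneg _)

lemma tailMono_lipI (d : NumData) {r : ℝ} (hr : 0 ≤ r) : TailMono (lipI d r) :=
  (tailMono_z1I d).add ((tailMono_absAI (c1F_nonneg d) (q1_nonneg d)).add
    (tailMono_absAI (fun j => mul_nonneg hr (c2F_nonneg d j)) (mul_nonneg hr (q2_nonneg d))))

/-! ### Radii polynomials and contraction constants -/

lemma absAF_smul (A : Matrix (Fin m) (Fin m) ℝ) (c : Fin m → ℝ) (q a : ℝ) (i : Fin m) :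
    absAF A (fun j => a * c j) (a * q) i = a * absAF A c q i := by
  unfold absAF
  have : ∑ j, |A i j| * (a * c j) = a * ∑ j, |A i j| * c j := by
    rw [Finset.mul_sum]; exact Finset.sum_congr rfl fun j _ => by ring
  rw [this]; ring

lemma absAI_smul (A : Matrix (Fin m) (Fin m) ℝ) (c : Fin m → ℝ) (q a : ℝ) (k : ℕ) :
    absAI A (fun j => a * c j) (a * q) k = a * absAI A c q k := by
  unfold absAI; rw [absAF_smul]; ring

lemma radiiF_eq (d : NumData) (r : ℝ) (i : Fin m) :
    radiiF d i r = YF d i + lipF d r i * r - r / omega 2 i := by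
  unfold radiiF ZF lipF; rw [absAF_smul]; ring

lemma radiiI_eq (d : NumData) (r : ℝ) (k : ℕ) :
    radiiI d k r = YI d k + lipI d r k * r - r / omega 2 (m + k) := by
  unfold radiiI ZI lipI; rw [absAI_smul]; ring

lemma exists_lt_one_bound {ι : Type*} (s : Finset ι) (a : ι → ℝ) (h : ∀ i ∈ s, a i < 1) :
    ∃ K, 0 ≤ K ∧ K < 1 ∧ ∀ i ∈ s, a i ≤ K := by
  classical
  induction s using Finset.induction_on with
  | empty => exact ⟨0, le_rfl, one_pos, by simp⟩
  | insert i s _ ih =>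
    obtain ⟨K, h0, h1, h2⟩ := ih fun j hj => h j (Finset.mem_insert_of_mem hj)
    refine ⟨max K (a i), le_max_of_le_left h0, max_lt h1 (h i (Finset.mem_insert_self _ _)), ?_⟩
    intro j hj
    rcases Finset.mem_insert.1 hj with rfl | hj
    · exact le_max_right _ _
    · exact (h2 j hj).trans (le_max_left _ _)

lemma lipF_lt {d : NumData} {r : ℝ} (hr : 0 < r) (h : RadiiNeg d r) (i : Fin m) :
    lipF d r i * omega 2 i < 1 := by
  have h1 := h.1 i
  rw [radiiF_eq] at h1
  have h2 := YF_nonneg d i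
  have h3 : r * lipF d r i < r * (1 / omega 2 i) := by
    rw [mul_one_div]; linarith
  have h4 := lt_of_mul_lt_mul_left h3 hr.le
  rwa [lt_div_iff₀ (omega_pos 2 i)] at h4

lemma lipI_lt {d : NumData} {r : ℝ} (hr : 0 < r) (h : RadiiNeg d r) {k : ℕ} (hk : k ≤ M) :
    lipI d r k * omega 2 (m + k) < 1 := by
  have h1 := h.2 k hk
  rw [radiiI_eq] at h1
  have h2 := YI_nonneg d k
  have h3 : r * lipI d r k < r * (1 / omega 2 (m + k)) := by
    rw [mul_one_div]; linarith
  have h4 := lt_of_mul_lt_mul_left h3 hr.le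
  rwa [lt_div_iff₀ (omega_pos 2 _)] at h4

/-- Since `Y ≥ 0`, dividing `P_k(r) < 0` by `r` makes each weighted Lipschitz constant less than
one. A uniform `K < 1` exists because only the coordinates up to `m + M` need a maximum;
monotonicity covers the others. -/
lemma exists_contraction_const {d : NumData} {r : ℝ} (hr : 0 < r) (h : RadiiNeg d r) :
    ∃ K, 0 ≤ K ∧ K < 1 ∧ (∀ i, lipF d r i ≤ K / omega 2 i) ∧
      ∀ k, lipI d r k ≤ K / omega 2 (m + k) := by
  obtain ⟨K, h0, h1, h2⟩ := exists_lt_one_bound Finset.univ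
    (fun i : Fin m => lipF d r i * omega 2 i) fun i _ => lipF_lt hr h i
  obtain ⟨K', h0', h1', h2'⟩ := exists_lt_one_bound (Finset.range (M + 1))
    (fun k => lipI d r k * omega 2 (m + k)) fun k hk =>
      lipI_lt hr h (Nat.lt_succ_iff.1 (Finset.mem_range.1 hk))
  refine ⟨max K K', le_max_of_le_left h0, max_lt h1 h1', fun i => ?_, fun k => ?_⟩
  · rw [le_div_iff₀ (omega_pos 2 _)]
    exact (h2 i (Finset.mem_univ i)).trans (le_max_left _ _)
  · rw [le_div_iff₀ (omega_pos 2 _)]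
    refine le_trans ?_ (le_max_right _ _)
    by_cases hk : k < M + 1
    · exact h2' k (Finset.mem_range.2 hk)
    · have h3 := tailMono_lipI d hr.le k (by omega)
      have h4 := h2' M (Finset.mem_range.2 (Nat.lt_succ_self M))
      rw [mul_comm (lipI d r k)]
      rw [mul_comm] at h4
      exact h3.trans h4

lemma radiiI_le {d : NumData} {r : ℝ} (hr : 0 < r) (h : RadiiNeg d r) (k : ℕ) :
    YI d k + lipI d r k * r ≤ r / omega 2 (m + k) := by
  by_cases hk : k ≤ M
  · have := h.2 k hk
    rw [radiiI_eq] at this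
    linarith
  · have hm := ((tailMono_YI d).add ((tailMono_lipI d hr.le).const_mul hr.le)) k (by omega)
    have h1 := h.2 M le_rfl
    rw [radiiI_eq] at h1
    have h2 : YI d M + r * lipI d r M ≤ r / omega 2 (m + M) := by linarith
    rw [le_div_iff₀ (omega_pos 2 _)] at h2 ⊢
    rw [mul_comm (lipI d r k), mul_comm]
    linarith

/-! ### The Newton-like operator -/

lemma linPart_sub (x y : ℕ → ℝ) : linPart (x - y) = linPart x - linPart y := by
  funext k; simp only [linPart, Pi.sub_apply]; split_ifs <;> ring

/-- For a quadratic map the difference equals the derivative at the midpoint, with no remainder. The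
midpoint stays in the ball, which makes a mean value inequality unnecessary. -/
lemma f_sub (σ : ℝ) {x y : ℕ → ℝ} {a b : ℝ} (hx : Dominated x a) (hy : Dominated y b) :
    f σ x - f σ y = linDeriv σ ((1 / 2 : ℝ) • (x + y)) (x - y) := by
  funext k
  have h := congrFun (conv_sq_sub hx hy) k
  have h2 := congrFun (linPart_sub x y) k
  simp only [Pi.sub_apply] at h h2
  simp only [f, linDeriv, Pi.sub_apply, Pi.add_apply, Pi.smul_apply, conv_smul_left, smul_eq_mul,
    h2, ← h]
  ring

lemma abs_gCoeff_le (k : ℕ) : |gCoeff k| ≤ 3 / 2 := by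
  unfold gCoeff; split <;> norm_num

lemma f_bounded (σ : ℝ) {x : ℕ → ℝ} {a : ℝ} (hx : Dominated x a) : ∃ C, ∀ k, |f σ x k| ≤ C :=
  ⟨_, fun k => (abs_sub _ _).trans (add_le_add ((abs_add_le _ _).trans
    (add_le_add (abs_linPart_le hx k) (((hx.conv_dominated hx).smul σ).abs_le k)))
      (abs_gCoeff_le k))⟩

/-- The Newton-like operator. -/
def newton (d : NumData) (x : ℕ → ℝ) : ℕ → ℝ := x - opA d.A (f d.σ x)

lemma dominated_of_sub_extend {v : Fin m → ℝ} {x : ℕ → ℝ} {r : ℝ}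
    (hx : Dominated (x - extend v) r) : Dominated x (r + normOmega 2 (extend v)) := by
  have := hx.add (memOmega_extend v).dominated
  rwa [sub_add_cancel] at this

lemma nat_cases_m {P : ℕ → Prop} (h1 : ∀ i : Fin m, P i) (h2 : ∀ n, P (m + n)) (k : ℕ) : P k := by
  by_cases hk : k < m
  · exact h1 ⟨k, hk⟩
  · obtain ⟨n, rfl⟩ := Nat.exists_eq_add_of_le (not_lt.1 hk)
    exact h2 n

lemma newton_sub {d : NumData} {r ζ : ℝ} {x y : ℕ → ℝ} (hx : Dominated (x - extend d.x) r)
    (hy : Dominated (y - extend d.x) r) (hz : Dominated (x - y) ζ) :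
    (∀ i : Fin m, |newton d x i - newton d y i| ≤ lipF d r i * ζ) ∧
    ∀ n, |newton d x (m + n) - newton d y (m + n)| ≤ lipI d r n * ζ := by
  have hx' := dominated_of_sub_extend hx
  have hy' := dominated_of_sub_extend hy
  obtain ⟨C, hC⟩ := f_bounded d.σ hx'
  obtain ⟨D, hD⟩ := f_bounded d.σ hy'
  have hb : Dominated ((1 / 2 : ℝ) • ((x - extend d.x) + (y - extend d.x))) r := by
    have := (hx.add hy).smul (1 / 2 : ℝ)
    convert this using 1
    rw [abs_of_pos (by norm_num)]; ring
  have e : (1 / 2 : ℝ) • (x + y) =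
      extend d.x + (1 / 2 : ℝ) • ((x - extend d.x) + (y - extend d.x)) := by
    funext k; simp only [Pi.smul_apply, Pi.add_apply, Pi.sub_apply, smul_eq_mul]; ring
  have hA : ∀ k, newton d x k - newton d y k = (x - y) k - opA d.A (linDeriv d.σ (extend d.x +
      (1 / 2 : ℝ) • ((x - extend d.x) + (y - extend d.x))) (x - y)) k := fun k => by
    have h1 := congrFun (opA_sub d.A hC hD) k
    rw [f_sub d.σ hx' hy', e, Pi.sub_apply] at h1
    rw [h1]
    simp only [newton, Pi.sub_apply]
    ring
  refine ⟨fun i => ?_, fun n => ?_⟩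
  · rw [hA, opA_val]; exact abs_sub_opF_deriv d hb hz i
  · rw [hA, opA_tail]; exact abs_sub_opI_deriv d hb hz n

lemma newton_center (d : NumData) :
    (∀ i : Fin m, |newton d (extend d.x) i - extend d.x i| ≤ YF d i) ∧
    ∀ n, |newton d (extend d.x) (m + n) - extend d.x (m + n)| ≤ YI d n := by
  refine ⟨fun i => ?_, fun n => ?_⟩
  · simp only [newton, Pi.sub_apply, sub_sub_cancel_left, abs_neg, opA_val]
    exact abs_opF_f_le d i
  · simp only [newton, Pi.sub_apply, sub_sub_cancel_left, abs_neg, opA_tail]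
    exact abs_opI_f_le d n

/-- For a kernel vector `v` one has `v = (1 - B) v`. At an index where `|v i| * w i` is maximal this
contradicts the row bound unless `v = 0`. -/
lemma isUnit_of_weighted_lt {B : Matrix (Fin m) (Fin m) ℝ} {w : Fin m → ℝ} (hw : ∀ i, 0 < w i)
    (h : ∀ i, ∑ j, |(1 - B) i j| / w j < 1 / w i) : IsUnit B := by
  rw [← Matrix.mulVec_injective_iff_isUnit]
  change Function.Injective (Matrix.mulVecLin B)
  rw [injective_iff_map_eq_zero]
  intro v hv
  have hv' : B.mulVec v = 0 := hv
  obtain ⟨i, _, hi⟩ := Finset.exists_max_image Finset.univ (fun i => |v i| * w i)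
    ⟨(0 : Fin m), Finset.mem_univ _⟩
  have e : v i = ∑ j, (1 - B) i j * v j := by
    have : ((1 - B).mulVec v) i = v i := by rw [Matrix.sub_mulVec, Matrix.one_mulVec, hv', sub_zero]
    rw [← this]; rfl
  set s := |v i| * w i with hs
  have hvj : ∀ j, |v j| ≤ s / w j := fun j => by
    rw [le_div_iff₀ (hw j)]; exact hi j (Finset.mem_univ j)
  have h0 : 0 ≤ s := mul_nonneg (abs_nonneg _) (hw i).le
  have h1 : |v i| ≤ s * ∑ j, |(1 - B) i j| / w j := by
    rw [e, Finset.mul_sum]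
    refine (Finset.abs_sum_le_sum_abs _ _).trans (Finset.sum_le_sum fun j _ => ?_)
    rw [abs_mul]
    calc _ ≤ |(1 - B) i j| * (s / w j) := mul_le_mul_of_nonneg_left (hvj j) (abs_nonneg _)
      _ = _ := by ring
  have hs0 : s = 0 := by
    by_contra hne
    have hpos : 0 < s := lt_of_le_of_ne h0 (Ne.symm hne)
    have h2 : |v i| < s * (1 / w i) := lt_of_le_of_lt h1 (mul_lt_mul_of_pos_left (h i) hpos)
    rw [mul_one_div, hs, mul_div_cancel_right₀ _ (hw i).ne'] at h2
    exact lt_irrefl _ h2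
  funext j
  have := hvj j
  rw [hs0, zero_div] at this
  simpa using this

/-- The other contributions to `lipF` are nonnegative, so the weighted row sums of `1 - A K̃` are
below the threshold. Hence `A K̃`, and with it `A`, is invertible. -/
lemma isUnit_A {d : NumData} {r : ℝ} (hr : 0 < r) (h : RadiiNeg d r) : IsUnit d.A := by
  have : IsUnit (d.A * KTilde d) := by
    refine isUnit_of_weighted_lt (w := fun i => omega 2 i) (fun i => omega_pos 2 i) fun i => ?_
    have h1 := lipF_lt hr h i
    rw [← lt_div_iff₀ (omega_pos 2 i)] at h1
    refine lt_of_le_of_lt ?_ h1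
    have h2 := absAF_nonneg (A := d.A) (c1F_nonneg d) (q1_nonneg d) i
    have h3 := absAF_nonneg (A := d.A) (fun j => mul_nonneg hr.le (c2F_nonneg d j))
      (mul_nonneg hr.le (q2_nonneg d)) i
    have h4 : ∑ j, |(1 - d.A * KTilde d) i j| / omega 2 j ≤ z1F d i := by
      unfold z1F
      have h1 := one_sub_theta_sq_pos
      have h2 := omega_pos 2 (m - 1)
      have h3 : 0 ≤ theta ^ (2 * L) := pow_nonneg theta_pos.le _
      generalize theta ^ (2 * L) = p at h3 ⊢
      refine le_add_of_nonneg_right ?_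
      positivity
    unfold lipF
    linarith
  rw [Matrix.isUnit_iff_isUnit_det] at this ⊢
  rw [Matrix.det_mul] at this
  exact isUnit_of_mul_isUnit_left this

/-- If the finite output vanishes, the tail output is just `tailInv` of the tail of `h`, so that
tail vanishes. Then only `A` acting on the head remains. -/
lemma eq_zero_of_opA_eq_zero {A : Matrix (Fin m) (Fin m) ℝ} (hA : IsUnit A) {h : ℕ → ℝ} {C : ℝ}
    (hC : ∀ k, |h k| ≤ C) (h0 : opA A h = 0) : h = 0 := by
  have hF : ∀ i, opF A h i = 0 := fun i => by rw [← opA_val, h0]; rfl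
  have hI : ∀ n, opI A h n = 0 := fun n => by rw [← opA_tail, h0]; rfl
  have ht : tailInv (fun n => h (m + n)) = 0 := by
    funext n
    have := hI n
    rw [opI, hF last] at this
    simpa using this
  have htail : (fun n => h (m + n)) = 0 := by
    rw [← tailOp_tailInv (tail_le_mu hC), ht]
    funext n; simp [tailOp]
  have hhead : A.mulVec (fun j : Fin m => h j) = 0 := by
    funext i
    have := hF i
    rw [opF, ht] at this
    simpa [Matrix.mulVec, dotProduct] using this
  have hinj := Matrix.mulVec_injective_iff_isUnit.2 hA
  have hz : (fun j : Fin m => h j) = 0 := hinj (by rw [hhead, Matrix.mulVec_zero])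
  funext k
  exact nat_cases_m (P := fun k => h k = 0) (fun i => congrFun hz i) (fun n => congrFun htail n) k

theorem exists_unique_zero {d : NumData} {r : ℝ} (hr : 0 < r) (h : RadiiNeg d r) :
    ∃ x, Dominated (x - extend d.x) r ∧ f d.σ x = 0 ∧
      ∀ y, Dominated (y - extend d.x) r → f d.σ y = 0 → y = x := by
  obtain ⟨K, hK0, hK1, hKF, hKI⟩ := exists_contraction_const hr h
  have hcen : Dominated (extend d.x - extend d.x) r := fun k => by
    simpa using div_nonneg hr.le (omega_pos 2 k).le
  obtain ⟨x, hx, hfix, huniq⟩ := exists_fixedPoint_of_weighted_contraction (w := omega 2)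
    (omega_pos 2) (c := extend d.x) hr.le hK0 hK1 (newton d) (fun x hx => by
      have hx' : Dominated (x - extend d.x) r := hx
      -- Comparing with the image of the centre at distance `ζ = r` gives displacement at most `Y +
      -- Z(r)`, which the radii polynomials bound by `r / ω²`.
      obtain ⟨h1, h2⟩ := newton_sub hx' hcen hx'
      obtain ⟨h3, h4⟩ := newton_center d
      refine nat_cases_m (fun i => ?_) (fun n => ?_)
      · have h5 := h.1 i
        rw [radiiF_eq] at h5
        have := abs_sub_le (newton d x i) (newton d (extend d.x) i) (extend d.x i)
        linarith [h1 i, h3 i]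
      · have h5 := radiiI_le hr h n
        have := abs_sub_le (newton d x (m + n)) (newton d (extend d.x) (m + n))
          (extend d.x (m + n))
        linarith [h2 n, h4 n])
    (fun x y hx hy ζ hz => by
      have hζ : 0 ≤ ζ := Dominated.nonneg (x := x - y) hz
      obtain ⟨h1, h2⟩ := newton_sub (d := d) (r := r) (x := x) (y := y) hx hy hz
      refine nat_cases_m (fun i => ?_) (fun n => ?_)
      · rw [mul_div_right_comm]
        exact (h1 i).trans (mul_le_mul_of_nonneg_right (hKF i) hζ)
      · rw [mul_div_right_comm]
        exact (h2 n).trans (mul_le_mul_of_nonneg_right (hKI n) hζ))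
  refine ⟨x, hx, ?_, fun y hy hfy => huniq y hy ?_⟩
  · obtain ⟨C, hC⟩ := f_bounded d.σ (dominated_of_sub_extend (x := x) (v := d.x) hx)
    refine eq_zero_of_opA_eq_zero (isUnit_A hr h) hC ?_
    have : x - opA d.A (f d.σ x) = x := hfix
    simpa using this
  · have hA0 : opA d.A 0 = 0 := by
      have := opA_sub d.A (h := 0) (k := 0) (C := 0) (D := 0) (by simp) (by simp)
      simpa using this
    rw [newton, hfy, hA0, sub_zero]

/-! ### Cosine series -/

/-- Absolute summability of the symmetric extension to `ℤ`. -/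
def SummableZ (x : ℕ → ℝ) : Prop := Summable fun j : ℤ => x j.natAbs

lemma SummableZ.mul_le {x : ℕ → ℝ} (hx : SummableZ x) {φ : ℤ → ℝ} (hφ : ∀ j, |φ j| ≤ 1) :
    Summable fun j : ℤ => x j.natAbs * φ j := by
  refine Summable.of_norm_bounded hx.norm fun j => ?_
  rw [norm_mul]
  exact mul_le_of_le_one_right (norm_nonneg _) (hφ j)

lemma SummableZ.cos {x : ℕ → ℝ} (hx : SummableZ x) (ξ : ℝ) :
    Summable fun j : ℤ => x j.natAbs * Real.cos (j * ξ) := hx.mul_le fun _ => abs_cos_le_one _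

lemma SummableZ.sin {x : ℕ → ℝ} (hx : SummableZ x) (ξ : ℝ) :
    Summable fun j : ℤ => x j.natAbs * Real.sin (j * ξ) := hx.mul_le fun _ => abs_sin_le_one _

lemma SummableZ.add {x y : ℕ → ℝ} (hx : SummableZ x) (hy : SummableZ y) : SummableZ (x + y) :=
  Summable.add hx hy

lemma SummableZ.smul {x : ℕ → ℝ} (hx : SummableZ x) (c : ℝ) : SummableZ (c • x) :=
  Summable.mul_left c hx

lemma summableZ_of_nat {x : ℕ → ℝ} (hx : Summable x) : SummableZ x :=
  Summable.of_nat_of_neg (by simpa using hx) (by simpa using hx)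

lemma SummableZ.nat {x : ℕ → ℝ} (hx : SummableZ x) : Summable x :=
  (hx.comp_injective (i := fun n : ℕ => (n : ℤ)) Nat.cast_injective).congr fun n => by simp

lemma tsum_sin_eq_zero (x : ℕ → ℝ) (ξ : ℝ) : ∑' j : ℤ, x j.natAbs * Real.sin (j * ξ) = 0 := by
  have h := (Equiv.neg ℤ).tsum_eq fun j : ℤ => x j.natAbs * Real.sin (j * ξ)
  have e : ∀ j : ℤ, x ((Equiv.neg ℤ) j).natAbs * Real.sin (((Equiv.neg ℤ) j : ℤ) * ξ) =
      -(x j.natAbs * Real.sin (j * ξ)) := fun j => by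
    simp [Real.sin_neg]
  rw [tsum_congr e, tsum_neg] at h
  linarith

lemma cosSeries_add {x y : ℕ → ℝ} (hx : SummableZ x) (hy : SummableZ y) (ξ : ℝ) :
    cosSeries (x + y) ξ = cosSeries x ξ + cosSeries y ξ := by
  unfold cosSeries
  rw [← (hx.cos ξ).tsum_add (hy.cos ξ)]
  exact tsum_congr fun j => by simp only [Pi.add_apply]; ring

lemma cosSeries_smul (c : ℝ) (x : ℕ → ℝ) (ξ : ℝ) : cosSeries (c • x) ξ = c * cosSeries x ξ := by
  unfold cosSeries
  rw [← tsum_mul_left]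
  exact tsum_congr fun j => by simp only [Pi.smul_apply, smul_eq_mul]; ring

lemma tsum_conv_int (x y : ℕ → ℝ) (n : ℤ) :
    ∑' j : ℤ, x j.natAbs * y (n - j).natAbs = conv x y n.natAbs := by
  unfold conv
  rcases le_total 0 n with hn | hn
  · rw [Int.natAbs_of_nonneg hn]
  · have hn' : ((n.natAbs : ℕ) : ℤ) = -n := by omega
    rw [← (Equiv.neg ℤ).tsum_eq]
    refine tsum_congr fun j => ?_
    have e : (n - (Equiv.neg ℤ) j).natAbs = (-n - j).natAbs := by
      rw [Equiv.neg_apply]; omega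
    rw [hn', e]
    simp

/-- The equivalence `(n, j) ↦ (j, n - j)`. -/
def diagEquiv : ℤ × ℤ ≃ ℤ × ℤ where
  toFun p := (p.2, p.1 - p.2)
  invFun p := (p.1 + p.2, p.1)
  left_inv p := by simp
  right_inv p := by simp

lemma tsum_mul_tsum_int {F G : ℤ → ℝ} (hF : Summable F) (hG : Summable G) :
    (Summable fun p : ℤ × ℤ => F p.1 * G p.2) ∧
      (∑' j, F j) * ∑' j, G j = ∑' p : ℤ × ℤ, F p.1 * G p.2 := by
  have h := summable_mul_of_summable_norm hF.norm hG.norm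
  exact ⟨h, hF.tsum_mul_tsum hG h⟩

/-- The product is a double series over `ℤ × ℤ`. By oddness the product of sine series is zero;
subtracting it turns `cos cos` into the cosine of the sum, and summing along `n = j + l` produces
the convolution. -/
lemma summableZ_conv_and_mul {x y : ℕ → ℝ} (hx : SummableZ x) (hy : SummableZ y) :
    SummableZ (conv x y) ∧ ∀ ξ, cosSeries x ξ * cosSeries y ξ = cosSeries (conv x y) ξ := by
  have hprod : Summable fun p : ℤ × ℤ => x p.1.natAbs * y p.2.natAbs :=
    (tsum_mul_tsum_int hx hy).1
  have hdiag := (diagEquiv.summable_iff).2 hprod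
  have hdiag' : Summable fun p : ℤ × ℤ => x p.2.natAbs * y (p.1 - p.2).natAbs := hdiag
  refine ⟨?_, fun ξ => ?_⟩
  · refine hdiag'.prod.congr fun n => ?_
    exact tsum_conv_int x y n
  · obtain ⟨sc, hcc⟩ := tsum_mul_tsum_int (hx.cos ξ) (hy.cos ξ)
    obtain ⟨ss, hss⟩ := tsum_mul_tsum_int (hx.sin ξ) (hy.sin ξ)
    rw [tsum_sin_eq_zero, zero_mul] at hss
    have hsum : Summable fun p : ℤ × ℤ =>
        x p.1.natAbs * y p.2.natAbs * Real.cos ((p.1 + p.2 : ℤ) * ξ) := by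
      refine Summable.of_norm_bounded hprod.norm fun p => ?_
      rw [norm_mul]
      exact mul_le_of_le_one_right (norm_nonneg _) (abs_cos_le_one _)
    have h1 : cosSeries x ξ * cosSeries y ξ =
        ∑' p : ℤ × ℤ, x p.1.natAbs * y p.2.natAbs * Real.cos ((p.1 + p.2 : ℤ) * ξ) := by
      unfold cosSeries
      rw [hcc, ← sub_zero (∑' p : ℤ × ℤ, _), hss, ← sc.tsum_sub ss]
      refine tsum_congr fun p => ?_
      push_cast
      rw [add_mul, Real.cos_add]; ring
    rw [h1, ← diagEquiv.tsum_eq]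
    refine (Summable.tsum_prod ((diagEquiv.summable_iff).2 hsum)).trans ?_
    unfold cosSeries
    refine tsum_congr fun n => ?_
    rw [← tsum_conv_int, ← tsum_mul_right]
    refine tsum_congr fun j => ?_
    simp [diagEquiv]

/-! ### Differentiation -/

/-- The sequence `k² x_k`. -/
def sqMul (x : ℕ → ℝ) (k : ℕ) : ℝ := (k : ℝ) ^ 2 * x k

lemma natAbs_cast_sq (j : ℤ) : ((j.natAbs : ℕ) : ℝ) ^ 2 = (j : ℝ) ^ 2 := by
  rw [Nat.cast_natAbs, Int.cast_abs, sq_abs]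

lemma cosSeries_continuous {x : ℕ → ℝ} (hx : SummableZ x) : Continuous (cosSeries x) := by
  refine continuous_tsum (fun j => by fun_prop) hx.norm fun j ξ => ?_
  rw [norm_mul]
  exact mul_le_of_le_one_right (norm_nonneg _) (abs_cos_le_one _)

/-- The termwise derivative of the cosine series. -/
def cosSeriesDeriv (x : ℕ → ℝ) (ξ : ℝ) : ℝ := ∑' j : ℤ, -(j : ℝ) * x j.natAbs * Real.sin (j * ξ)

section

variable {x : ℕ → ℝ}

lemma abs_int_le_sq (j : ℤ) : |(j : ℝ)| ≤ (j : ℝ) ^ 2 := by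
  rw [← sq_abs]
  rcases eq_or_ne j 0 with rfl | hj
  · simp
  · have : (1 : ℝ) ≤ |(j : ℝ)| := by exact_mod_cast Int.one_le_abs hj
    nlinarith

lemma norm_sqMul (j : ℤ) : ‖sqMul x j.natAbs‖ = (j : ℝ) ^ 2 * |x j.natAbs| := by
  rw [sqMul, natAbs_cast_sq, norm_mul, Real.norm_of_nonneg (sq_nonneg _), Real.norm_eq_abs]

lemma hasDerivAt_cosSeries (hq : SummableZ (sqMul x)) (hx : SummableZ x) (ξ : ℝ) :
    HasDerivAt (cosSeries x) (cosSeriesDeriv x ξ) ξ := by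
  refine hasDerivAt_tsum (y₀ := 0) (u := fun j : ℤ => ‖sqMul x j.natAbs‖)
    (g := fun (j : ℤ) ξ => x j.natAbs * Real.cos (j * ξ))
    (g' := fun (j : ℤ) ξ => -(j : ℝ) * x j.natAbs * Real.sin (j * ξ))
    hq.norm (fun j ξ => ?_) (fun j ξ => ?_) (hx.cos 0) ξ
  · have h : HasDerivAt (fun ξ : ℝ => (j : ℝ) * ξ) j ξ := by
      simpa using (hasDerivAt_id ξ).const_mul (j : ℝ)
    exact ((h.cos).const_mul (x j.natAbs)).congr_deriv (by ring)
  · rw [norm_sqMul, norm_mul, norm_mul, norm_neg, Real.norm_eq_abs, Real.norm_eq_abs]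
    refine (mul_le_of_le_one_right (by positivity) (abs_sin_le_one _)).trans ?_
    exact mul_le_mul_of_nonneg_right (abs_int_le_sq j) (abs_nonneg _)

lemma hasDerivAt_cosSeriesDeriv (hq : SummableZ (sqMul x)) (ξ : ℝ) :
    HasDerivAt (cosSeriesDeriv x) (-cosSeries (sqMul x) ξ) ξ := by
  have e : -cosSeries (sqMul x) ξ =
      ∑' j : ℤ, -(j : ℝ) ^ 2 * x j.natAbs * Real.cos (j * ξ) := by
    unfold cosSeries
    rw [← tsum_neg]
    refine tsum_congr fun j => ?_
    rw [sqMul, natAbs_cast_sq]; ring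
  rw [e]
  refine hasDerivAt_tsum (y₀ := 0) (u := fun j : ℤ => ‖sqMul x j.natAbs‖)
    (g := fun (j : ℤ) ξ => -(j : ℝ) * x j.natAbs * Real.sin (j * ξ))
    (g' := fun (j : ℤ) ξ => -(j : ℝ) ^ 2 * x j.natAbs * Real.cos (j * ξ))
    hq.norm (fun j ξ => ?_) (fun j ξ => ?_) ?_ ξ
  · have h : HasDerivAt (fun ξ : ℝ => (j : ℝ) * ξ) j ξ := by
      simpa using (hasDerivAt_id ξ).const_mul (j : ℝ)
    exact ((h.sin).const_mul (-(j : ℝ) * x j.natAbs)).congr_deriv (by ring)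
  · rw [norm_sqMul, norm_mul, norm_mul, norm_neg, norm_pow, Real.norm_eq_abs, sq_abs,
      Real.norm_eq_abs]
    exact mul_le_of_le_one_right (by positivity) (abs_cos_le_one _)
  · simp

lemma deriv_cosSeries (hq : SummableZ (sqMul x)) (hx : SummableZ x) :
    deriv (cosSeries x) = cosSeriesDeriv x := funext fun ξ => (hasDerivAt_cosSeries hq hx ξ).deriv

lemma deriv_cosSeriesDeriv (hq : SummableZ (sqMul x)) :
    deriv (cosSeriesDeriv x) = fun ξ => -cosSeries (sqMul x) ξ :=
  funext fun ξ => (hasDerivAt_cosSeriesDeriv hq ξ).deriv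

lemma contDiff_cosSeries (hq : SummableZ (sqMul x)) (hx : SummableZ x) :
    ContDiff ℝ 2 (cosSeries x) := by
  rw [show (2 : WithTop ℕ∞) = 1 + 1 from rfl, contDiff_succ_iff_deriv, deriv_cosSeries hq hx,
    contDiff_one_iff_deriv, deriv_cosSeriesDeriv hq]
  exact ⟨fun ξ => (hasDerivAt_cosSeries hq hx ξ).differentiableAt, by simp,
    fun ξ => (hasDerivAt_cosSeriesDeriv hq ξ).differentiableAt, (cosSeries_continuous hq).neg⟩

end

lemma uniqueDiffOn_Icc_pi : UniqueDiffOn ℝ (Set.Icc 0 π) := uniqueDiffOn_Icc pi_pos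

lemma cosSeriesDeriv_zero (x : ℕ → ℝ) : cosSeriesDeriv x 0 = 0 := by
  simp [cosSeriesDeriv]

lemma cosSeriesDeriv_pi (x : ℕ → ℝ) : cosSeriesDeriv x π = 0 := by
  simp [cosSeriesDeriv, Real.sin_int_mul_pi]

/-! ### From zeros of `f` to solutions -/

/-- In terms of `k² y_k` the tridiagonal part is the identity plus multiplication by `2 + cos ξ`. At
`k = 0` the neighbour `-1` reflects to `1`, which doubles the coefficient and explains the
exceptional `β_0 = 1`. -/
lemma linPart_eq (y : ℕ → ℝ) (k : ℕ) : linPart y k = y k + 2 * sqMul y k +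
    1 / 2 * (sqMul y (k + 1) + sqMul y ((k : ℤ) - 1).natAbs) := by
  rcases k with _ | k
  · simp [linPart, mu, beta, sqMul]; ring
  · have e : (((k + 1 : ℕ) : ℤ) - 1).natAbs = k := by omega
    rw [e]
    simp only [linPart, mu, beta, lam, sqMul, Nat.add_eq_zero_iff, one_ne_zero, and_false, if_false,
      Nat.add_sub_cancel]
    push_cast
    ring

/-- The cosine coefficients of `2 + cos ξ`. -/
def coefC : ℕ → ℝ
  | 0 => 2
  | 1 => 1 / 2
  | _ => 0

lemma summableZ_of_support {x : ℕ → ℝ} (N : ℕ) (h : ∀ k, N ≤ k → x k = 0) : SummableZ x :=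
  (dominated_of_support N h).choose_spec.summable

lemma coefC_of_le {k : ℕ} (hk : 2 ≤ k) : coefC k = 0 := by
  obtain ⟨n, rfl⟩ := Nat.exists_eq_add_of_le' hk
  rfl

lemma summableZ_coefC : SummableZ coefC := summableZ_of_support 2 fun _ => coefC_of_le

lemma summableZ_gCoeff : SummableZ gCoeff := summableZ_of_support 3 fun _ => gCoeff_of_le

lemma cosSeries_coefC (ξ : ℝ) : cosSeries coefC ξ = 2 + Real.cos ξ := by
  unfold cosSeries
  rw [tsum_eq_sum (s := {-1, 0, 1})]
  · simp [coefC]; ring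
  · intro j hj
    simp only [Finset.mem_insert, Finset.mem_singleton, not_or] at hj
    rw [coefC_of_le (by omega), zero_mul]

lemma cosSeries_gCoeff (ξ : ℝ) : cosSeries gCoeff ξ = g ξ := by
  unfold cosSeries
  rw [tsum_eq_sum (s := {-2, -1, 0, 1, 2})]
  · simp [gCoeff, g]; ring
  · intro j hj
    simp only [Finset.mem_insert, Finset.mem_singleton, not_or] at hj
    rw [gCoeff_of_le (by omega), zero_mul]

lemma conv_coefC (q : ℕ → ℝ) (k : ℕ) : conv coefC q k =
    2 * q k + 1 / 2 * (q (k + 1) + q ((k : ℤ) - 1).natAbs) := by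
  unfold conv
  rw [tsum_eq_sum (s := {-1, 0, 1})]
  · have e : ((k : ℤ) + 1).natAbs = k + 1 := by omega
    simp [coefC, e]; ring
  · intro j hj
    simp only [Finset.mem_insert, Finset.mem_singleton, not_or] at hj
    rw [coefC_of_le (by omega), zero_mul]

lemma f_eq (σ : ℝ) (x : ℕ → ℝ) :
    f σ x = conv coefC (sqMul x) + (x + (σ • conv x x + (-1 : ℝ) • gCoeff)) := by
  funext k
  simp only [f, linPart_eq, Pi.add_apply, Pi.smul_apply, smul_eq_mul, conv_coefC]
  ring

/-- Regularity gain. Membership in `Ω²` makes `k² x_k` only bounded. The equation convolves it with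
`(1/2, 2, 1/2)` and equates the result to an absolutely summable sequence. The diagonal `2` exceeds
the off-diagonal total `1`, so the partial sums satisfy `2S ≤ ∑‖h‖ + S + a`. -/
lemma summableZ_sqMul {x : ℕ → ℝ} {a σ : ℝ} (hx : Dominated x a) (hf : f σ x = 0) :
    SummableZ (sqMul x) := by
  have hxs : SummableZ x := hx.summable
  have hB : ∀ k, |sqMul x k| ≤ a := fun k => by
    rcases Nat.eq_zero_or_pos k with rfl | hk
    · simpa [sqMul] using hx.nonneg
    · have h := dominated_iff.1 hx k
      rw [omega_of_pos 2 hk] at h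
      rw [sqMul, abs_mul, abs_of_nonneg (sq_nonneg _), mul_comm]
      exact h
  set h : ℕ → ℝ := x + (σ • conv x x + (-1 : ℝ) • gCoeff) with hh
  have hs : SummableZ h :=
    hxs.add (((summableZ_conv_and_mul hxs hxs).1.smul σ).add (summableZ_gCoeff.smul (-1)))
  have hn := hs.nat.norm
  have key : ∀ k, 2 * |sqMul x k| ≤
      ‖h k‖ + 1 / 2 * (|sqMul x (k + 1)| + |sqMul x ((k : ℤ) - 1).natAbs|) := fun k => by
    have := congrFun hf k
    rw [f_eq, Pi.add_apply, ← hh, conv_coefC] at this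
    have e : 2 * sqMul x k =
        -h k - 1 / 2 * (sqMul x (k + 1) + sqMul x ((k : ℤ) - 1).natAbs) := by
      simp only [Pi.zero_apply] at this; linarith
    rw [← abs_two, ← abs_mul, e, abs_two]
    refine (abs_sub _ _).trans (add_le_add (by rw [abs_neg]; rfl) ?_)
    rw [abs_mul, abs_of_pos (by norm_num : (0 : ℝ) < 1 / 2)]
    gcongr
    exact abs_add_le _ _
  refine summableZ_of_nat (Summable.of_norm ?_)
  refine summable_of_sum_range_le (c := ∑' k, ‖h k‖ + a) (fun n => norm_nonneg _) fun N => ?_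
  change ∑ k ∈ Finset.range N, |sqMul x k| ≤ _
  set S := ∑ k ∈ Finset.range N, |sqMul x k| with hS
  have h1 : ∑ k ∈ Finset.range N, |sqMul x (k + 1)| ≤ S + a := by
    have e1 := Finset.sum_range_succ (fun k => |sqMul x k|) N
    rw [Finset.sum_range_succ'] at e1
    linarith [hB N, abs_nonneg (sqMul x 0)]
  have h2 : ∑ k ∈ Finset.range N, |sqMul x ((k : ℤ) - 1).natAbs| ≤ S + a := by
    rcases N with _ | n
    · simpa [hS] using hx.nonneg
    · rw [Finset.sum_range_succ', hS, Finset.sum_range_succ]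
      have e : ∀ k : ℕ, (((k + 1 : ℕ) : ℤ) - 1).natAbs = k := fun k => by omega
      simp only [e]
      linarith [hB (((0 : ℕ) : ℤ) - 1).natAbs, abs_nonneg (sqMul x n)]
  have h3 : ∑ k ∈ Finset.range N, ‖h k‖ ≤ ∑' k, ‖h k‖ :=
    hn.sum_le_tsum _ fun k _ => norm_nonneg _
  have h4 := Finset.sum_le_sum fun k (_ : k ∈ Finset.range N) => key k
  rw [← Finset.mul_sum, Finset.sum_add_distrib, ← Finset.mul_sum, Finset.sum_add_distrib] at h4
  linarith

theorem isNeumannSolution_of_zero {σ a : ℝ} {x : ℕ → ℝ} (hx : Dominated x a) (hf : f σ x = 0) :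
    IsNeumannSolution σ (cosSeries x) := by
  have hxs : SummableZ x := hx.summable
  have hq := summableZ_sqMul hx hf
  have hcd := contDiff_cosSeries hq hxs
  have hder : ∀ ξ ∈ Set.Icc 0 π, derivWithin (cosSeries x) (Set.Icc 0 π) ξ = cosSeriesDeriv x ξ :=
    fun ξ hξ => (hasDerivAt_cosSeries hq hxs ξ).hasDerivWithinAt.derivWithin
      (uniqueDiffOn_Icc_pi ξ hξ)
  refine ⟨hcd.contDiffOn, fun ξ hξ => ?_, ?_, ?_⟩
  · rw [iteratedDerivWithin_eq_iteratedDeriv uniqueDiffOn_Icc_pi hcd.contDiffAt hξ,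
      iteratedDeriv_succ, iteratedDeriv_one, deriv_cosSeries hq hxs, deriv_cosSeriesDeriv hq]
    have hc := summableZ_conv_and_mul summableZ_coefC hq
    have hxx := summableZ_conv_and_mul hxs hxs
    have h0 : cosSeries (f σ x) ξ = 0 := by rw [hf]; simp [cosSeries]
    have hg := (summableZ_gCoeff.smul (-1))
    have hs := hxx.1.smul σ
    rw [f_eq, cosSeries_add hc.1 (hxs.add (hs.add hg)), cosSeries_add hxs (hs.add hg),
      cosSeries_add hs hg, cosSeries_smul, cosSeries_smul, ← hc.2, ← hxx.2, cosSeries_coefC,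
      cosSeries_gCoeff] at h0
    linarith
  · rw [hder 0 ⟨le_rfl, pi_pos.le⟩, cosSeriesDeriv_zero]
  · rw [hder π ⟨pi_pos.le, le_rfl⟩, cosSeriesDeriv_pi]

/-! ### From solutions to zeros of `f` -/

/-- The cosine integral `∫₀^π h(ξ) cos (k ξ) dξ`. -/
def cosInt (h : ℝ → ℝ) (k : ℤ) : ℝ := ∫ ξ in (0 : ℝ)..π, h ξ * Real.cos (k * ξ)

lemma integral_cos_int_mul (n : ℤ) :
    ∫ ξ in (0 : ℝ)..π, Real.cos (n * ξ) = if n = 0 then π else 0 := by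
  split_ifs with h
  · simp [h]
  · have hn : (n : ℝ) ≠ 0 := by exact_mod_cast h
    rw [intervalIntegral.integral_comp_mul_left _ hn, integral_cos]
    simp [Real.sin_int_mul_pi]

lemma integral_cos_mul_cos (j k : ℤ) :
    ∫ ξ in (0 : ℝ)..π, Real.cos (j * ξ) * Real.cos (k * ξ) =
      π / 2 * ((if j = k then 1 else 0) + if j = -k then 1 else 0) := by
  have e : ∀ ξ : ℝ, Real.cos (j * ξ) * Real.cos (k * ξ) =
      1 / 2 * (Real.cos ((j - k : ℤ) * ξ) + Real.cos ((j + k : ℤ) * ξ)) := fun ξ => by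
    push_cast
    rw [sub_mul, add_mul, Real.cos_sub, Real.cos_add]; ring
  simp only [e]
  rw [intervalIntegral.integral_const_mul, intervalIntegral.integral_add
    (Continuous.intervalIntegrable (by fun_prop) _ _)
    (Continuous.intervalIntegrable (by fun_prop) _ _), integral_cos_int_mul, integral_cos_int_mul]
  simp only [sub_eq_zero, add_eq_zero_iff_eq_neg]
  split_ifs <;> ring

/-- Both `j = k` and `j = -k` contribute `π/2`; at `k = 0` the two coincide and the single index is
counted twice, so the formula is uniform in `k`. -/
lemma cosInt_cosSeries {x : ℕ → ℝ} (hx : SummableZ x) (k : ℤ) :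
    cosInt (cosSeries x) k = π * x k.natAbs := by
  have h := intervalIntegral.hasSum_integral_of_dominated_convergence (a := 0) (b := π)
    (μ := MeasureTheory.volume) (f := fun ξ => cosSeries x ξ * Real.cos (k * ξ))
    (F := fun (j : ℤ) ξ => x j.natAbs * Real.cos (j * ξ) * Real.cos (k * ξ))
    (fun j _ => |x j.natAbs|)
    (fun j => (Continuous.aestronglyMeasurable (by fun_prop)))
    (fun j => Filter.Eventually.of_forall fun ξ _ => by
      rw [norm_mul, norm_mul]
      exact (mul_le_of_le_one_right (by positivity) (abs_cos_le_one _)).trans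
        (mul_le_of_le_one_right (by positivity) (abs_cos_le_one _)))
    (Filter.Eventually.of_forall fun ξ _ => hx.norm)
    (by simp)
    (Filter.Eventually.of_forall fun ξ _ => (hx.cos ξ).hasSum.mul_right _)
  unfold cosInt
  rw [← h.tsum_eq]
  have e : ∀ j : ℤ, ∫ ξ in (0 : ℝ)..π, x j.natAbs * Real.cos (j * ξ) * Real.cos (k * ξ) =
      (if j = k then π / 2 * x k.natAbs else 0) + if j = -k then π / 2 * x k.natAbs else 0 :=
    fun j => by
      simp only [mul_assoc]
      rw [intervalIntegral.integral_const_mul, integral_cos_mul_cos]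
      split_ifs with h1 h2 h2
      · subst h1; ring
      · subst h1; ring
      · subst h2; rw [Int.natAbs_neg]; ring
      · ring
  rw [tsum_congr e, Summable.tsum_add, tsum_ite_eq, tsum_ite_eq]
  · ring
  · exact (hasSum_ite_eq k _).summable
  · exact (hasSum_ite_eq (-k) _).summable

/-- Termwise differentiation of the series is not available beforehand, so the equation is tested
against `cos (k ξ)` and the derivatives of `u` are moved to the cosine. -/
lemma f_eq_zero_of_isNeumannSolution {σ a : ℝ} {y : ℕ → ℝ} (hy : Dominated y a)
    (h : IsNeumannSolution σ (cosSeries y)) : f σ y = 0 := by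
  obtain ⟨hcd, hode, hl, hr⟩ := h
  have hys : SummableZ y := hy.summable
  set s := Set.Icc (0 : ℝ) π with hs
  have hsI : Set.uIcc 0 π = s := Set.uIcc_of_le pi_pos.le
  set u := cosSeries y with hu
  set u' := derivWithin u s with hu'
  set u'' := iteratedDerivWithin 2 u s with hu''
  have hcu : Continuous u := cosSeries_continuous hys
  have hd1 : ∀ ξ ∈ s, HasDerivWithinAt u (u' ξ) s ξ := fun ξ hξ =>
    ((hcd.differentiableOn (by norm_num)) ξ hξ).hasDerivWithinAt
  have hd2 : ∀ ξ ∈ s, HasDerivWithinAt u' (u'' ξ) s ξ := fun ξ hξ => by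
    have h1 := hcd.differentiableOn_iteratedDerivWithin (m := 1) (by norm_num) uniqueDiffOn_Icc_pi
    rw [iteratedDerivWithin_one] at h1
    have h2 := (h1 ξ hξ).hasDerivWithinAt
    have h3 : u'' = derivWithin u' s := by
      rw [hu'', iteratedDerivWithin_succ, iteratedDerivWithin_one]
    rw [h3]; exact h2
  have hc1 : ContinuousOn u' s := fun ξ hξ => (hd2 ξ hξ).continuousWithinAt
  have hc2 : ContinuousOn u'' s :=
    hcd.continuousOn_iteratedDerivWithin (by norm_num) uniqueDiffOn_Icc_pi
  have ii1 : IntervalIntegrable u' MeasureTheory.volume 0 π := by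
    apply ContinuousOn.intervalIntegrable; rw [hsI]; exact hc1
  have ii2 : IntervalIntegrable u'' MeasureTheory.volume 0 π := by
    apply ContinuousOn.intervalIntegrable; rw [hsI]; exact hc2
  have iicos : ∀ k : ℤ, IntervalIntegrable (fun ξ => u'' ξ * Real.cos (k * ξ))
      MeasureTheory.volume 0 π := fun k => by
    apply ContinuousOn.intervalIntegrable; rw [hsI]
    exact hc2.mul (Continuous.continuousOn (by fun_prop))
  have hcosd : ∀ (k : ℤ) (ξ : ℝ), HasDerivAt (fun ξ : ℝ => Real.cos (k * ξ))
      (-(k * Real.sin (k * ξ))) ξ := fun k ξ => by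
    have h : HasDerivAt (fun ξ : ℝ => (k : ℝ) * ξ) k ξ := by
      simpa using (hasDerivAt_id ξ).const_mul (k : ℝ)
    exact h.cos.congr_deriv (by ring)
  have hsind : ∀ (k : ℤ) (ξ : ℝ), HasDerivAt (fun ξ : ℝ => k * Real.sin (k * ξ))
      (k ^ 2 * Real.cos (k * ξ)) ξ := fun k ξ => by
    have h : HasDerivAt (fun ξ : ℝ => (k : ℝ) * ξ) k ξ := by
      simpa using (hasDerivAt_id ξ).const_mul (k : ℝ)
    exact (h.sin.const_mul (k : ℝ)).congr_deriv (by ring)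
  have hparts : ∀ k : ℤ, cosInt u'' k = -(k : ℝ) ^ 2 * cosInt u k := fun k => by
    -- The boundary terms of this first integration vanish by the Neumann conditions, those of the
    -- second because `sin (k ξ)` is zero at both ends.
    have p1 := intervalIntegral.integral_mul_deriv_eq_deriv_mul_of_hasDerivWithinAt (a := 0)
      (b := π) (u := fun ξ : ℝ => Real.cos (k * ξ)) (v := u')
      (u' := fun ξ => -(k * Real.sin (k * ξ))) (v' := u'')
      (fun ξ _ => (hcosd k ξ).hasDerivWithinAt) (by rw [hsI]; exact hd2)
      (Continuous.intervalIntegrable (by fun_prop) _ _) ii2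
    have p2 := intervalIntegral.integral_mul_deriv_eq_deriv_mul_of_hasDerivWithinAt (a := 0)
      (b := π) (u := fun ξ : ℝ => k * Real.sin (k * ξ)) (v := u)
      (u' := fun ξ => k ^ 2 * Real.cos (k * ξ)) (v' := u')
      (fun ξ _ => (hsind k ξ).hasDerivWithinAt) (by rw [hsI]; exact hd1)
      (Continuous.intervalIntegrable (by fun_prop) _ _) ii1
    rw [hl, hr] at p1
    simp only [mul_zero, neg_mul, intervalIntegral.integral_neg, sub_neg_eq_add,
      zero_add, sub_self] at p1
    simp only [Real.sin_int_mul_pi, mul_zero, zero_mul, Real.sin_zero, sub_self, zero_sub] at p2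
    have e1 : cosInt u'' k = ∫ ξ in (0 : ℝ)..π, Real.cos (k * ξ) * u'' ξ :=
      intervalIntegral.integral_congr fun ξ _ => mul_comm _ _
    have e2 : (k : ℝ) ^ 2 * cosInt u k = ∫ ξ in (0 : ℝ)..π, (k : ℝ) ^ 2 * Real.cos (k * ξ) * u ξ := by
      unfold cosInt
      rw [← intervalIntegral.integral_const_mul]
      exact intervalIntegral.integral_congr fun ξ _ => by ring
    rw [e1, p1, p2, ← e2]; ring
  have hsq := summableZ_conv_and_mul hys hys
  funext k
  have hU : ∀ j : ℤ, cosInt u'' j = -(π * sqMul y j.natAbs) := fun j => by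
    rw [hparts, hu, cosInt_cosSeries hys, sqMul, natAbs_cast_sq]; ring
  have hlhs : ∫ ξ in (0 : ℝ)..π, (2 + Real.cos ξ) * u'' ξ * Real.cos ((k : ℤ) * ξ) =
      2 * cosInt u'' k + 1 / 2 * (cosInt u'' (k + 1) + cosInt u'' (k - 1)) := by
    unfold cosInt
    rw [← intervalIntegral.integral_add (iicos _) (iicos _), ← intervalIntegral.integral_const_mul,
      ← intervalIntegral.integral_const_mul, ← intervalIntegral.integral_add
        ((iicos _).const_mul _) (((iicos _).add (iicos _)).const_mul _)]
    refine intervalIntegral.integral_congr fun ξ _ => ?_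
    push_cast
    rw [add_mul _ _ ξ, sub_mul _ _ ξ, one_mul, Real.cos_add, Real.cos_sub]
    ring
  have hcg : Continuous g := by unfold g; fun_prop
  have hrhs : ∫ ξ in (0 : ℝ)..π, (2 + Real.cos ξ) * u'' ξ * Real.cos ((k : ℤ) * ξ) =
      cosInt u k + σ * cosInt (cosSeries (conv y y)) k - cosInt (cosSeries gCoeff) k := by
    have hcc := cosSeries_continuous hsq.1
    have hcg' := cosSeries_continuous summableZ_gCoeff
    have c1 : IntervalIntegrable (fun ξ => u ξ * Real.cos ((k : ℤ) * ξ))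
      MeasureTheory.volume 0 π := Continuous.intervalIntegrable (by fun_prop) _ _
    have c2 : IntervalIntegrable (fun ξ => cosSeries (conv y y) ξ * Real.cos ((k : ℤ) * ξ))
      MeasureTheory.volume 0 π := Continuous.intervalIntegrable (by fun_prop) _ _
    have c3 : IntervalIntegrable (fun ξ => cosSeries gCoeff ξ * Real.cos ((k : ℤ) * ξ))
      MeasureTheory.volume 0 π := Continuous.intervalIntegrable (by fun_prop) _ _
    unfold cosInt
    rw [← intervalIntegral.integral_const_mul, ← intervalIntegral.integral_add c1 (c2.const_mul σ),
      ← intervalIntegral.integral_sub (c1.add (c2.const_mul σ)) c3]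
    refine intervalIntegral.integral_congr fun ξ hξ => ?_
    rw [hsI] at hξ
    have := hode ξ hξ
    rw [← hsq.2, cosSeries_gCoeff, ← hu]
    have e : (2 + Real.cos ξ) * u'' ξ = u ξ + σ * (u ξ * u ξ) - g ξ := by linarith
    rw [e]; ring
  rw [hlhs, hU, hU, hU, hu, cosInt_cosSeries hys, cosInt_cosSeries hsq.1,
    cosInt_cosSeries summableZ_gCoeff] at hrhs
  have ek : ((k : ℤ) + 1).natAbs = k + 1 := by omega
  rw [ek, Int.natAbs_natCast] at hrhs
  rw [f, linPart_eq, Pi.zero_apply]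
  have hπ := pi_pos
  have : π * (y k + 2 * sqMul y k + 1 / 2 * (sqMul y (k + 1) + sqMul y ((k : ℤ) - 1).natAbs) +
      σ * conv y y k - gCoeff k) = 0 := by linarith
  exact (mul_eq_zero.1 this).resolve_left hπ.ne'

theorem exists_isUniqueTrueSolution {d : NumData} {r : ℝ} (hr : 0 < r) (h : RadiiNeg d r) :
    ∃ x, IsUniqueTrueSolution d r x := by
  obtain ⟨x, hx, hf, huniq⟩ := exists_unique_zero hr h
  refine ⟨x, mem_ballOmega_iff.2 hx, hf,
    isNeumannSolution_of_zero (dominated_of_sub_extend hx) hf, fun y hy hor => ?_⟩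
  have hyb := mem_ballOmega_iff.1 hy
  rcases hor with h0 | h0
  · exact huniq y hyb h0
  · exact huniq y hyb (f_eq_zero_of_isNeumannSolution (dominated_of_sub_extend hyb) h0)

/-! ### Numerical bounds for the constants -/

lemma eta_lt : eta < 1.2 := by
  unfold eta
  have h1 := gamma_mem.1
  have h2 := theta_mem.2
  have h3 := theta_pos
  have h5 : 0.9095 ≤ 1 - theta ^ 2 := by nlinarith
  have h4 : 0.834 < gamma * (1 - theta ^ 2) :=
    calc (0.834 : ℝ) < 0.917 * 0.9095 := by norm_num
      _ ≤ _ := mul_le_mul h1.le h5 (by norm_num) gamma_pos.le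
  rw [div_lt_iff₀ (by linarith)]
  linarith

lemma sum_Icc_inv_sq_le (n : ℕ) : ∑ l ∈ Finset.Icc 1 n, 1 / (l : ℝ) ^ 2 ≤ 1.645 := by
  have h := sum_le_hasSum (Finset.Icc 1 n) (fun i _ => by positivity) hasSum_zeta_two
  refine h.trans ?_
  have h1 := pi_lt_d4
  have h2 := pi_pos
  nlinarith

/-- From `k² ≤ 2(l² + (k-l)²)` the sum is at most four times a partial sum of `ζ(2)`. -/
lemma innerSum_le_const (k : ℕ) : innerSum k ≤ 6.58 := by
  unfold innerSum
  have hr : ∑ l ∈ Finset.Icc 1 (k - 1), 1 / ((k : ℝ) - l) ^ 2 =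
      ∑ l ∈ Finset.Icc 1 (k - 1), 1 / (l : ℝ) ^ 2 := by
    refine Finset.sum_nbij' (fun l => k - l) (fun l => k - l) ?_ ?_ ?_ ?_ ?_
    · intro l hl; rw [Finset.mem_Icc] at *; omega
    · intro l hl; rw [Finset.mem_Icc] at *; omega
    · intro l hl; rw [Finset.mem_Icc] at *; omega
    · intro l hl; rw [Finset.mem_Icc] at *; omega
    · intro l hl
      rw [Finset.mem_Icc] at hl
      rw [Nat.cast_sub (by omega)]
  have h : ∀ l ∈ Finset.Icc 1 (k - 1), (k : ℝ) ^ 2 / ((l : ℝ) ^ 2 * ((k : ℝ) - l) ^ 2) ≤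
      2 * (1 / (l : ℝ) ^ 2 + 1 / ((k : ℝ) - l) ^ 2) := fun l hl => by
    rw [Finset.mem_Icc] at hl
    have h1 : (1 : ℝ) ≤ l := by exact_mod_cast hl.1
    have h2 : (l : ℝ) + 1 ≤ k := by exact_mod_cast (by omega : l + 1 ≤ k)
    have h3 : (0 : ℝ) < (k : ℝ) - l := by linarith
    have h4 : (0 : ℝ) < l := by linarith
    rw [div_add_div _ _ (by positivity) (by positivity), mul_div_assoc',
      div_le_div_iff_of_pos_right (by positivity)]
    nlinarith [sq_nonneg ((k : ℝ) - 2 * l)]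
  refine (Finset.sum_le_sum h).trans ?_
  rw [← Finset.mul_sum, Finset.sum_add_distrib, hr]
  linarith [sum_Icc_inv_sq_le (k - 1)]

lemma alpha_le (k : ℕ) : alpha k ≤ 12 := by
  have hS := sum_Icc_inv_sq_le L
  have hL : (2 : ℝ) / (L : ℝ) = 0.02 := by norm_num
  unfold alpha
  rw [hL]
  split_ifs with h0 h1
  · linarith
  · have := innerSum_le_const k
    unfold innerSum at this
    linarith
  · have h18 : log ((m : ℝ) - 2) ≤ 3 := by
      rw [log_le_iff_le_exp (by norm_num)]
      have h := exp_one_gt_d9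
      have e : exp 3 = exp 1 * exp 1 * exp 1 := by rw [← exp_add, ← exp_add]; norm_num
      rw [e]
      have h2 : (7.3 : ℝ) ≤ exp 1 * exp 1 := by nlinarith
      norm_num
      nlinarith
    have h1 := pi_lt_d4
    have h2 := pi_pos
    have h3 : π ^ 2 ≤ 9.87 := by nlinarith
    have h4 : 4 * log ((m : ℝ) - 2) / m ≤ 0.6 := by
      rw [div_le_iff₀ (by norm_num)]; norm_num at h18 ⊢; linarith
    have h5 : 2 * ((m : ℝ) / ((m : ℝ) - 1)) ^ 2 ≤ 2.3 := by norm_num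
    linarith

lemma chi_le : chi ≤ 6 := by
  have ht := theta_mem
  have htp := theta_pos
  have hs : (4 : ℝ) < √(M : ℝ) := by
    apply lt_sqrt_of_sq_lt; norm_num
  have hs2 : √(M : ℝ) < 4.5 := by
    rw [sqrt_lt' (by norm_num)]; norm_num
  have hpow : theta ^ 4 ≤ 0.0082 := by
    calc theta ^ 4 ≤ 0.3003 ^ 4 := pow_le_pow_left₀ htp.le ht.2.le 4
      _ ≤ _ := by norm_num
  have hr : ∀ e : ℝ, 4 ≤ e → theta ^ e ≤ 0.0082 := fun e he => by
    refine le_trans ?_ hpow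
    rw [← rpow_natCast]
    exact rpow_le_rpow_of_exponent_ge htp theta_lt_one.le (by exact_mod_cast he)
  have h1 := hr ((M : ℝ) / 2) (by norm_num)
  have h2 := hr √(M : ℝ) hs.le
  have h3 : 1 / (1 - theta) ≤ 1.43 := by
    rw [div_le_iff₀ (by linarith)]; linarith
  have h4 : ((m : ℝ) + M) / ((m : ℝ) + M - √(M : ℝ) - 1) ≤ 1.16 := by
    push_cast at hs2 ⊢
    rw [div_le_iff₀ (by linarith)]; linarith
  have h4' : 0 ≤ ((m : ℝ) + M) / ((m : ℝ) + M - √(M : ℝ) - 1) := by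
    push_cast at hs2 ⊢
    apply div_nonneg <;> linarith
  have h5 := pow_le_pow_left₀ h4' h4 4
  unfold chi
  have a1 : theta ^ ((M : ℝ) / 2) * ((M : ℝ) / 2) * (((m : ℝ) + M) / m) ^ 4 ≤ 0.0082 * 160 := by
    have e : ((M : ℝ) / 2) * (((m : ℝ) + M) / m) ^ 4 = 160 := by norm_num
    rw [mul_assoc, e]; linarith
  have a2 : theta ^ √(M : ℝ) * ((M : ℝ) / 2) * 2 ^ 4 ≤ 0.0082 * 160 := by
    have e : ((M : ℝ) / 2) * 2 ^ 4 = 160 := by norm_num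
    rw [mul_assoc, e]; linarith
  have a3 : 1 / (1 - theta) * (((m : ℝ) + M) / ((m : ℝ) + M - √(M : ℝ) - 1)) ^ 4 ≤
      1.43 * 1.16 ^ 4 := by
    apply mul_le_mul h3 h5 (by positivity) (by norm_num)
  have n1 : (0.0082 : ℝ) * 160 ≤ 1.4 := by norm_num
  have n3 : (1.43 : ℝ) * 1.16 ^ 4 ≤ 2.7 := by norm_num
  linarith

lemma lam_m : lam m = 180.5 := by norm_num [lam]

lemma mu_m : mu m = 801 := by norm_num [mu]

lemma beta_last : beta (m - 1) = 200 := by norm_num [beta]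

lemma abs_lam_div_mu : |lam m| / |mu m| = 180.5 / 801 := by
  rw [lam_m, mu_m, abs_of_pos (by norm_num), abs_of_pos (by norm_num)]

lemma wTilde_nonneg : 0 ≤ wTilde := by
  unfold wTilde
  refine Finset.sum_nonneg fun l _ => div_nonneg (Finset.prod_nonneg fun i _ =>
    mul_nonneg (beta_pos _).le (lam_nonneg _)) ?_
  exact mul_nonneg (minor_step l).1.le (minor_step (l + 1)).1.le

lemma theta_pow_le : theta ^ (2 * L) ≤ 0.0001 := by
  have ht := theta_mem
  have htp := theta_pos
  calc theta ^ (2 * L) ≤ theta ^ 8 :=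
        pow_le_pow_of_le_one htp.le theta_lt_one.le (by norm_num)
    _ ≤ 0.3003 ^ 8 := pow_le_pow_left₀ htp.le ht.2.le 8
    _ ≤ _ := by norm_num

/-- The series is not summed: it approximates `tailCol 0`, and the Green function bounds that entry
by `η/μ_m`. -/
lemma wTilde_le : wTilde ≤ 1.21 / 801 := by
  have h1 := abs_tailCol_le 0
  have h2 := abs_tailCol_sub_wTilde
  rw [mu_m] at h1 h2
  have h3 := theta_pow_le
  have h4 : 0.9 ≤ 1 - theta ^ 2 := by nlinarith [theta_mem.2, theta_pos]
  have h5 : theta ^ (2 * L) / (801 * (1 - theta ^ 2)) ≤ 0.0001 / (801 * 0.9) := by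
    apply div_le_div₀ (by norm_num) h3 (by norm_num) (by linarith)
  have h6 := eta_lt
  have h7 := (abs_le.1 (h2.trans h5)).1
  have h8 := le_abs_self (tailCol 0)
  rw [pow_zero, mul_one] at h1
  norm_num at h1 h7 ⊢
  linarith

lemma theta_pow_mul_sq_le (k : ℕ) : theta ^ k * omega 2 (m + k) ≤ 400 := by
  induction k with
  | zero => rw [omega_of_pos 2 (m_add_pos _)]; norm_num
  | succ k ih =>
    refine le_trans ?_ ih
    rw [omega_of_pos 2 (m_add_pos _), omega_of_pos 2 (m_add_pos _), pow_succ]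
    have ht := theta_mem.2
    have ht0 := theta_pos
    have hk0 : (0 : ℝ) ≤ k := by positivity
    push_cast
    have h : theta * (20 + ((k : ℝ) + 1)) ^ 2 ≤ (20 + (k : ℝ)) ^ 2 := by nlinarith
    calc _ = theta ^ k * (theta * (20 + ((k : ℝ) + 1)) ^ 2) := by ring
      _ ≤ theta ^ k * (20 + (k : ℝ)) ^ 2 := mul_le_mul_of_nonneg_left h (by positivity)
      _ = _ := by ring

/-! ### A sparse approximate inverse -/

/-- Diagonal entries of the sparse approximate inverse of `(λ, μ - c, β)`. -/
def sparseDiag (c : ℝ) (i : ℕ) : ℝ := 1 / (mu i - c)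

/-- The entry `(0, 1)` of the sparse approximate inverse. -/
def sparseCorner (c : ℝ) : ℝ := -1 / ((1 - c) * (3 - c))

/-- The approximate inverse of the tridiagonal matrix `(λ, μ - c, β)`: its diagonal part, with one
correction in the first row. -/
def sparseA (c : ℝ) : Matrix (Fin m) (Fin m) ℝ := fun i j =>
  if j = i then sparseDiag c i else if i = 0 ∧ j = 1 then sparseCorner c else 0

lemma sum_sparse (p q : ℝ) (i : Fin m) (y : Fin m → ℝ) :
    ∑ j, (if j = i then p else if i = 0 ∧ j = 1 then q else 0) * y j =
      p * y i + if i = 0 then q * y 1 else 0 := by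
  by_cases hi : i = 0
  · subst hi
    have : ∀ j : Fin m, (if j = 0 then p else if (0 : Fin m) = 0 ∧ j = 1 then q else 0) * y j =
        (if j = 0 then p * y 0 else 0) + if j = 1 then q * y 1 else 0 := fun j => by
      by_cases h0 : j = 0
      · subst h0; simp
      · by_cases h1 : j = 1
        · subst h1; simp
        · simp [h0, h1]
    rw [Finset.sum_congr rfl fun j _ => this j, Finset.sum_add_distrib]
    simp
  · simp [hi]

lemma sum_sparseA (c : ℝ) (i : Fin m) (y : Fin m → ℝ) :
    ∑ j, sparseA c i j * y j = sparseDiag c i * y i + if i = 0 then sparseCorner c * y 1 else 0 :=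
  sum_sparse _ _ i y

lemma sum_abs_sparseA (c : ℝ) (i : Fin m) (y : Fin m → ℝ) :
    ∑ j, |sparseA c i j| * y j =
      |sparseDiag c i| * y i + if i = 0 then |sparseCorner c| * y 1 else 0 := by
  rw [← sum_sparse]
  refine Finset.sum_congr rfl fun j _ => ?_
  unfold sparseA
  split_ifs <;> simp

lemma sparseA_last {c : ℝ} {i : Fin m} (hi : i ≠ last) : sparseA c i last = 0 := by
  unfold sparseA
  rw [if_neg (Ne.symm hi), if_neg]
  rintro ⟨_, h⟩
  exact absurd h (by decide)

section

variable {c : ℝ}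

lemma mu_sub_ne (hc : c = 0 ∨ c = 2) (i : ℕ) : mu i - c ≠ 0 := by
  rcases Nat.eq_zero_or_pos i with rfl | hi
  · rcases hc with rfl | rfl <;> norm_num [mu]
  · have h1 : (1 : ℝ) ≤ i := by exact_mod_cast hi
    rcases hc with rfl | rfl <;> unfold mu <;> nlinarith

lemma sparseDiag_mul (hc : c = 0 ∨ c = 2) (i : ℕ) : sparseDiag c i * (mu i - c) = 1 := by
  unfold sparseDiag
  rw [one_div, inv_mul_cancel₀ (mu_sub_ne hc i)]

lemma abs_sparseDiag_zero (hc : c = 0 ∨ c = 2) : |sparseDiag c 0| = 1 := by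
  rcases hc with rfl | rfl <;> norm_num [sparseDiag, mu]

lemma abs_sparseCorner_le (hc : c = 0 ∨ c = 2) : |sparseCorner c| ≤ 1 := by
  rcases hc with rfl | rfl <;> norm_num [sparseCorner, abs_div]

/-- The reason for the corner entry. In row zero `|μ_0 - c| = β_0 = ω_1 = 1`, so the diagonal alone
would leave a defect of size one; the corner cancels the entry `(0, 1)`. -/
lemma sparse_row_zero (hc : c = 0 ∨ c = 2) : sparseDiag c 0 + sparseCorner c * (3 - c) = 0 := by
  rcases hc with rfl | rfl <;> norm_num [sparseDiag, sparseCorner, mu]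

lemma abs_sparseDiag_mul_omega_le_one (hc : c = 0 ∨ c = 2) {i : ℕ} (hi : 1 ≤ i) :
    |sparseDiag c i| * omega 2 i ≤ 1 := by
  have h1 : (1 : ℝ) ≤ i := by exact_mod_cast hi
  have hpos : 0 < mu i - c := by
    rcases hc with rfl | rfl <;> unfold mu <;> nlinarith
  rw [sparseDiag, abs_of_pos (by positivity), omega_of_pos 2 hi, div_mul_eq_mul_div, one_mul,
    div_le_one hpos]
  rcases hc with rfl | rfl <;> unfold mu <;> nlinarith

lemma abs_sparseDiag_mul_omega_le (hc : c = 0 ∨ c = 2) {i : ℕ} (hi : 2 ≤ i) :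
    |sparseDiag c i| * omega 2 i ≤ 4 / 7 := by
  have h1 : (2 : ℝ) ≤ i := by exact_mod_cast hi
  have hpos : 0 < mu i - c := by
    rcases hc with rfl | rfl <;> unfold mu <;> nlinarith
  rw [sparseDiag, abs_of_pos (by positivity), omega_of_pos 2 (by omega), div_mul_eq_mul_div,
    one_mul, div_le_iff₀ hpos]
  rcases hc with rfl | rfl <;> unfold mu <;> nlinarith

lemma abs_sparseDiag_last (hc : c = 0 ∨ c = 2) : |sparseDiag c 19| ≤ 1 / 721 := by
  rcases hc with rfl | rfl <;> norm_num [sparseDiag, mu, abs_of_pos]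

lemma omega_last : omega 2 19 = 361 := by norm_num [omega]

lemma sum_abs_sparseA_le (hc : c = 0 ∨ c = 2) {y : Fin m → ℝ} {C : ℝ} (hy0 : ∀ j, 0 ≤ y j)
    (hy : ∀ j, y j ≤ C) (i : Fin m) : (∑ j, |sparseA c i j| * y j) * omega 2 i ≤ 2 * C := by
  have hC := (hy0 0).trans (hy 0)
  rw [sum_abs_sparseA]
  split_ifs with hi
  · subst hi
    have h1 := abs_sparseCorner_le hc
    have h2 := mul_le_mul h1 (hy 1) (hy0 1) zero_le_one
    change (|sparseDiag c 0| * y 0 + _) * omega 2 0 ≤ _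
    rw [omega_zero, abs_sparseDiag_zero hc]
    linarith [hy 0]
  · have hi' : 1 ≤ (i : ℕ) := by
      rcases Nat.eq_zero_or_pos (i : ℕ) with h | h
      · exact absurd (Fin.ext h) hi
      · exact h
    have h1 := abs_sparseDiag_mul_omega_le_one hc hi'
    have h2 := mul_le_mul h1 (hy i) (hy0 i) zero_le_one
    rw [add_zero, mul_right_comm]
    linarith

lemma sum_abs_sparseA_last_le (hc : c = 0 ∨ c = 2) {y : Fin m → ℝ} {C : ℝ} (hy0 : ∀ j, 0 ≤ y j)
    (hy : ∀ j, y j ≤ C) : ∑ j, |sparseA c last j| * y j ≤ C / 721 := by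
  rw [sum_abs_sparseA, if_neg (by decide), add_zero]
  change |sparseDiag c 19| * y last ≤ _
  calc _ ≤ 1 / 721 * C := mul_le_mul (abs_sparseDiag_last hc) (hy _) (hy0 _) (by norm_num)
    _ = _ := by ring

lemma abs_sparseA_last_last (hc : c = 0 ∨ c = 2) : |sparseA c last last| ≤ 1 / 721 := by
  unfold sparseA
  rw [if_pos rfl]
  exact abs_sparseDiag_last hc

end

/-! ### Radii polynomials for data with a sparse approximate inverse -/

/-- Data with `x̄ = v + b e_0` and the sparse approximate inverse of `(λ, μ - c, β)`, where
`c = -2 σ b`; the remaining nonlinear terms are small. -/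
structure IsSparseData (d : NumData) (c b X : ℝ) (v : Fin m → ℝ) : Prop where
  hc : c = 0 ∨ c = 2
  hA : d.A = sparseA c
  hx : extend d.x = extend v + b • Pi.single 0 1
  hb : 2 * d.σ * b = -c
  hX : Dominated (extend v) X
  hσX : |d.σ| * X ≤ 0.0001
  hσ : |d.σ| ≤ 0.0001

lemma dominated_single (n : ℕ) : ∃ a, Dominated (Pi.single n (1 : ℝ)) a :=
  dominated_of_support (n + 1) fun _ hk => Pi.single_eq_of_ne (by omega) _

lemma dominated_single_zero : Dominated (Pi.single 0 (1 : ℝ)) 1 := fun k => by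
  rcases k with _ | k
  · simp [omega_zero]
  · simpa using (omega_pos 2 (k + 1)).le

lemma conv_single_zero (y : ℕ → ℝ) (k : ℕ) : conv (Pi.single 0 1) y k = y k := by
  unfold conv
  rw [tsum_eq_single 0]
  · simp
  · intro j hj
    rw [Pi.single_eq_of_ne (by simpa using hj), zero_mul]

lemma single_symm (i j : ℕ) : (Pi.single j (1 : ℝ) : ℕ → ℝ) i = (Pi.single i 1 : ℕ → ℝ) j := by
  simp only [Pi.single_apply, eq_comm]

lemma sum_single_div (n : ℕ) :
    ∑ j : Fin m, (Pi.single n (1 : ℝ) : ℕ → ℝ) j / omega 2 j =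
      extend (fun j => 1 / omega 2 j) n := by
  rw [extend_eq_sum]
  refine Finset.sum_congr rfl fun j _ => ?_
  rw [single_symm]; ring

lemma sum_single_div_le (n : ℕ) :
    ∑ j : Fin m, (Pi.single n (1 : ℝ) : ℕ → ℝ) j / omega 2 j ≤ 1 / omega 2 n := by
  rw [sum_single_div]
  by_cases hn : n < m
  · simp [extend, hn]
  · rw [extend_of_le _ (not_lt.1 hn)]
    have := omega_pos 2 n
    positivity

/-- These weighted row sums are bounded by the convolution of `|v|` with the weights `1/ω²`, so the
general convolution estimate applies. -/
lemma sum_abs_conv_single_le {v : Fin m → ℝ} {X : ℝ} (hX : Dominated (extend v) X) (i : ℕ) :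
    ∑ j : Fin m, |conv (extend v) (Pi.single (j : ℕ) 1) i| / omega 2 j ≤
      X * alpha i / omega 2 i := by
  have habs : ∀ k, extend (fun i => |v i|) k = |extend v k| := fun k => by
    unfold extend; split_ifs <;> simp
  have hX' : Dominated (extend fun i => |v i|) X := fun k => by
    rw [habs, abs_abs]; exact hX k
  have h := abs_conv_le hX' dominated_weight i
  rw [mul_one] at h
  refine le_trans ?_ ((le_abs_self _).trans h)
  rw [conv_extend]
  calc ∑ j : Fin m, |conv (extend v) (Pi.single (j : ℕ) 1) i| / omega 2 j
      ≤ ∑ j : Fin m, ∑ l ∈ Finset.Icc (-19 : ℤ) 19, |extend v l.natAbs| *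
          ((Pi.single ((i : ℤ) - l).natAbs (1 : ℝ) : ℕ → ℝ) j / omega 2 j) := by
        refine Finset.sum_le_sum fun j _ => ?_
        rw [conv_extend, div_eq_mul_inv]
        refine (mul_le_mul_of_nonneg_right (Finset.abs_sum_le_sum_abs _ _)
          (inv_nonneg.2 (omega_pos 2 _).le)).trans (le_of_eq ?_)
        rw [Finset.sum_mul]
        refine Finset.sum_congr rfl fun l _ => ?_
        have h0 : 0 ≤ (Pi.single ((i : ℤ) - l).natAbs (1 : ℝ) : ℕ → ℝ) j := by
          rw [Pi.single_apply]; split_ifs <;> norm_num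
        rw [abs_mul, single_symm, abs_of_nonneg h0]
        ring
    _ = ∑ l ∈ Finset.Icc (-19 : ℤ) 19, |extend v l.natAbs| *
          ∑ j : Fin m, (Pi.single ((i : ℤ) - l).natAbs (1 : ℝ) : ℕ → ℝ) j / omega 2 j := by
        rw [Finset.sum_comm]
        exact Finset.sum_congr rfl fun l _ => (Finset.mul_sum _ _ _).symm
    _ ≤ _ := by
        refine Finset.sum_le_sum fun l _ => ?_
        rw [habs]
        exact mul_le_mul_of_nonneg_left (sum_single_div_le _) (abs_nonneg _)

namespace IsSparseData

variable {d : NumData} {c b X : ℝ} {v : Fin m → ℝ}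

/-- The linear part of the corrected Jacobian. -/
def linBlock (c : ℝ) (i j : Fin m) : ℝ :=
  linPart (Pi.single (j : ℕ) 1) i - c * (Pi.single (i : ℕ) (1 : ℝ) : ℕ → ℝ) j -
    Matrix.single last last (beta (m - 1) * lam m * wTilde) i j

/-- The nonlinear part of the corrected Jacobian. -/
def nonlinBlock (d : NumData) (v : Fin m → ℝ) (i j : Fin m) : ℝ :=
  2 * d.σ * conv (extend v) (Pi.single (j : ℕ) 1) i

lemma KTilde_eq (h : IsSparseData d c b X v) (i j : Fin m) :
    KTilde d i j = linBlock c i j + nonlinBlock d v i j := by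
  obtain ⟨a, ha⟩ := dominated_single (j : ℕ)
  have h1 := congrFun (conv_add_left h.hX (dominated_single_zero.smul b) ha) i
  rw [← h.hx, conv_smul_left, Pi.add_apply, Pi.smul_apply, conv_single_zero, smul_eq_mul,
    single_symm] at h1
  simp only [KTilde, Matrix.sub_apply, jac, h1, linBlock, nonlinBlock]
  linear_combination (Pi.single (i : ℕ) (1 : ℝ) : ℕ → ℝ) j * h.hb

lemma sum_abs_nonlinBlock_le (h : IsSparseData d c b X v) (i : Fin m) :
    ∑ j, |nonlinBlock d v i j| / omega 2 j ≤ 0.0024 := by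
  have h1 := sum_abs_conv_single_le h.hX i
  have h2 : X * alpha i / omega 2 i ≤ X * 12 :=
    (div_le_self (mul_nonneg h.hX.nonneg (alpha_nonneg _)) (one_le_omega 2 _)).trans
      (mul_le_mul_of_nonneg_left (alpha_le _) h.hX.nonneg)
  have e : ∑ j, |nonlinBlock d v i j| / omega 2 j =
      2 * |d.σ| * ∑ j : Fin m, |conv (extend v) (Pi.single (j : ℕ) 1) i| / omega 2 j := by
    rw [Finset.mul_sum]
    refine Finset.sum_congr rfl fun j _ => ?_
    rw [nonlinBlock, abs_mul, abs_mul, abs_two, mul_div_assoc]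
  rw [e]
  calc _ ≤ 2 * |d.σ| * (X * 12) := by gcongr; exact h1.trans h2
    _ = 24 * (|d.σ| * X) := by ring
    _ ≤ 24 * 0.0001 := by have := h.hσX; gcongr
    _ ≤ _ := by norm_num

lemma one_sub_mul_KTilde (h : IsSparseData d c b X v) (i j : Fin m) :
    (1 - d.A * KTilde d) i j =
      ((1 : Matrix (Fin m) (Fin m) ℝ) i j - ∑ l, sparseA c i l * linBlock c l j) -
        ∑ l, sparseA c i l * nonlinBlock d v l j := by
  rw [Matrix.sub_apply, Matrix.mul_apply, h.hA, sub_sub, ← Finset.sum_add_distrib]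
  congr 1
  refine Finset.sum_congr rfl fun l _ => ?_
  rw [h.KTilde_eq]; ring

/-- Weighted row sums of the defect of the linear part. -/
def linDefect (c : ℝ) (i : Fin m) : ℝ :=
  ∑ j, |(1 : Matrix (Fin m) (Fin m) ℝ) i j - ∑ l, sparseA c i l * linBlock c l j| / omega 2 j

lemma sum_abs_one_sub_le (h : IsSparseData d c b X v) (i : Fin m) :
    ∑ j, |(1 - d.A * KTilde d) i j| / omega 2 j ≤ linDefect c i +
      ∑ l, |sparseA c i l| * ∑ j, |nonlinBlock d v l j| / omega 2 j := by
  have e : ∑ l, |sparseA c i l| * ∑ j, |nonlinBlock d v l j| / omega 2 j =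
      ∑ j, (∑ l, |sparseA c i l * nonlinBlock d v l j|) / omega 2 j := by
    simp only [Finset.mul_sum, Finset.sum_div]
    rw [Finset.sum_comm]
    refine Finset.sum_congr rfl fun j _ => Finset.sum_congr rfl fun l _ => ?_
    rw [abs_mul]; ring
  rw [e, linDefect, ← Finset.sum_add_distrib]
  refine Finset.sum_le_sum fun j _ => ?_
  rw [← add_div]
  refine div_le_div_of_nonneg_right ?_ (omega_pos 2 _).le
  rw [h.one_sub_mul_KTilde]
  exact (abs_sub _ _).trans (add_le_add le_rfl (Finset.abs_sum_le_sum_abs _ _))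

lemma linPart_single (i j : ℕ) : linPart (Pi.single j 1) i =
    (if i = 0 then 0 else lam i * (Pi.single (i - 1) (1 : ℝ) : ℕ → ℝ) j) +
      mu i * (Pi.single i (1 : ℝ) : ℕ → ℝ) j + beta i * (Pi.single (i + 1) (1 : ℝ) : ℕ → ℝ) j := by
  unfold linPart
  rw [single_symm i, single_symm (i + 1), single_symm (i - 1)]

lemma one_eq_single (i j : Fin m) :
    (1 : Matrix (Fin m) (Fin m) ℝ) i j = (Pi.single (i : ℕ) (1 : ℝ) : ℕ → ℝ) j := by
  rw [Matrix.one_apply, Pi.single_apply]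
  simp only [Fin.ext_iff, eq_comm]

/-- The corner cancels entry `(0, 1)` at the price of entry `(0, 2)`, of size at most `β_1 = 2` and
damped by `ω_2 = 4`. Entry `(0, 0)` is unaffected because `λ_1 = 0`. -/
lemma linDefect_zero_le (hc : c = 0 ∨ c = 2) : linDefect c 0 ≤ 1 / 2 := by
  have hrow : ∀ j : Fin m, (1 : Matrix (Fin m) (Fin m) ℝ) 0 j - ∑ l, sparseA c 0 l * linBlock c l j =
      -2 * sparseCorner c * (Pi.single 2 (1 : ℝ) : ℕ → ℝ) j := fun j => by
    rw [sum_sparseA, if_pos rfl, one_eq_single]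
    unfold linBlock
    rw [linPart_single, linPart_single, Matrix.single_apply, Matrix.single_apply,
      if_neg (show ¬ ((last : Fin m) = 0 ∧ last = j) from fun h => absurd h.1 (by decide)),
      if_neg (show ¬ ((last : Fin m) = 1 ∧ last = j) from fun h => absurd h.1 (by decide))]
    change (Pi.single 0 (1 : ℝ) : ℕ → ℝ) j - (sparseDiag c 0 * ((if (0 : ℕ) = 0 then 0 else _) +
      mu 0 * (Pi.single 0 (1 : ℝ) : ℕ → ℝ) j + beta 0 * (Pi.single 1 (1 : ℝ) : ℕ → ℝ) j -
      c * (Pi.single 0 (1 : ℝ) : ℕ → ℝ) j - 0) + sparseCorner c * ((if (1 : ℕ) = 0 then 0 else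
        lam 1 * (Pi.single 0 (1 : ℝ) : ℕ → ℝ) j) + mu 1 * (Pi.single 1 (1 : ℝ) : ℕ → ℝ) j +
        beta 1 * (Pi.single 2 (1 : ℝ) : ℕ → ℝ) j - c * (Pi.single 1 (1 : ℝ) : ℕ → ℝ) j - 0)) = _
    have h1 := sparseDiag_mul hc 0
    have h2 := sparse_row_zero hc
    have e1 : mu 0 = 1 := by norm_num [mu]
    have e2 : beta 0 = 1 := by norm_num [beta]
    have e3 : lam 1 = 0 := by norm_num [lam]
    have e4 : mu 1 = 3 := by norm_num [mu]
    have e5 : beta 1 = 2 := by norm_num [beta]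
    rw [e1] at h1
    rw [if_pos rfl, if_neg one_ne_zero, e1, e2, e3, e4, e5]
    linear_combination (-(Pi.single 0 (1 : ℝ) : ℕ → ℝ) j) * h1 -
      (Pi.single 1 (1 : ℝ) : ℕ → ℝ) j * h2
  unfold linDefect
  simp only [hrow]
  have h0 : ∀ j : ℕ, 0 ≤ (Pi.single 2 (1 : ℝ) : ℕ → ℝ) j := fun j => by
    rw [Pi.single_apply]; split_ifs <;> norm_num
  have e : ∀ j : Fin m, |-2 * sparseCorner c * (Pi.single 2 (1 : ℝ) : ℕ → ℝ) j| / omega 2 j =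
      2 * |sparseCorner c| * ((Pi.single 2 (1 : ℝ) : ℕ → ℝ) j / omega 2 j) := fun j => by
    rw [abs_mul, abs_mul, abs_neg, abs_two, abs_of_nonneg (h0 j), mul_div_assoc]
  rw [Finset.sum_congr rfl fun j _ => e j, ← Finset.mul_sum]
  have h3 := sum_single_div_le 2
  have h4 := abs_sparseCorner_le hc
  have h5 : (1 : ℝ) / omega 2 2 = 1 / 4 := by rw [omega_of_pos 2 (by norm_num)]; norm_num
  rw [h5] at h3
  calc _ ≤ 2 * 1 * (1 / 4 : ℝ) := by
        apply mul_le_mul _ h3 _ (by norm_num)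
        · linarith
        · exact Finset.sum_nonneg fun j _ => div_nonneg (h0 j) (omega_pos 2 _).le
    _ = _ := by norm_num

lemma linDefect_le (hc : c = 0 ∨ c = 2) {i : Fin m} (hi : (i : ℕ) ≠ 0) :
    linDefect c i ≤ |sparseDiag c i| * (lam i / omega 2 (i - 1) +
      beta i * extend (fun j => 1 / omega 2 j) (i + 1) +
      if i = last then beta (m - 1) * lam m * wTilde / omega 2 i else 0) := by
  set κ := beta (m - 1) * lam m * wTilde with hκ
  have hκ0 : 0 ≤ κ := mul_nonneg (mul_nonneg (beta_pos _).le (lam_nonneg _)) wTilde_nonneg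
  have hi0 : i ≠ 0 := fun h => hi (by rw [h]; rfl)
  have hs : ∀ n j : ℕ, 0 ≤ (Pi.single n (1 : ℝ) : ℕ → ℝ) j := fun n j => by
    rw [Pi.single_apply]; split_ifs <;> norm_num
  have hcor : ∀ j, Matrix.single last last κ i j =
      (if i = last then κ else 0) * (Pi.single (i : ℕ) (1 : ℝ) : ℕ → ℝ) j := fun j => by
    rw [Matrix.single_apply, Pi.single_apply]
    by_cases h1 : i = last
    · subst h1
      simp only [true_and, if_true, Fin.ext_iff, eq_comm, mul_ite, mul_one, mul_zero]
    · rw [if_neg (fun h => h1 h.1.symm), if_neg h1, zero_mul]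
  have hrow : ∀ j : Fin m, (1 : Matrix (Fin m) (Fin m) ℝ) i j - ∑ l, sparseA c i l * linBlock c l j =
      -(sparseDiag c i * (lam i * (Pi.single ((i : ℕ) - 1) (1 : ℝ) : ℕ → ℝ) j +
        beta i * (Pi.single ((i : ℕ) + 1) (1 : ℝ) : ℕ → ℝ) j -
        (if i = last then κ else 0) * (Pi.single (i : ℕ) (1 : ℝ) : ℕ → ℝ) j)) := fun j => by
    rw [sum_sparseA, if_neg hi0, one_eq_single]
    unfold linBlock
    rw [linPart_single, ← hκ, hcor, if_neg hi]
    linear_combination (-(Pi.single (i : ℕ) (1 : ℝ) : ℕ → ℝ) j) * sparseDiag_mul hc i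
  unfold linDefect
  simp only [hrow, abs_neg, abs_mul]
  have hk : 0 ≤ (if i = last then κ else 0) := by split_ifs <;> simp [hκ0]
  calc _ ≤ ∑ j : Fin m, |sparseDiag c i| * (lam i * ((Pi.single ((i : ℕ) - 1) (1 : ℝ) : ℕ → ℝ) j /
          omega 2 j) + beta i * ((Pi.single ((i : ℕ) + 1) (1 : ℝ) : ℕ → ℝ) j / omega 2 j) +
        (if i = last then κ else 0) * ((Pi.single (i : ℕ) (1 : ℝ) : ℕ → ℝ) j / omega 2 j)) := by
        refine Finset.sum_le_sum fun j _ => ?_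
        rw [mul_div_assoc]
        refine mul_le_mul_of_nonneg_left ?_ (abs_nonneg _)
        rw [div_le_iff₀ (omega_pos 2 _)]
        refine (abs_sub _ _).trans ?_
        rw [abs_of_nonneg (add_nonneg (mul_nonneg (lam_nonneg _) (hs _ _))
          (mul_nonneg (beta_pos _).le (hs _ _))), abs_of_nonneg (mul_nonneg hk (hs _ _))]
        have := (omega_pos 2 j).ne'
        apply le_of_eq
        field_simp
    _ = |sparseDiag c i| * (lam i * ∑ j : Fin m, (Pi.single ((i : ℕ) - 1) (1 : ℝ) : ℕ → ℝ) j /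
          omega 2 j + beta i * ∑ j : Fin m, (Pi.single ((i : ℕ) + 1) (1 : ℝ) : ℕ → ℝ) j / omega 2 j +
        (if i = last then κ else 0) *
          ∑ j : Fin m, (Pi.single (i : ℕ) (1 : ℝ) : ℕ → ℝ) j / omega 2 j) := by
        rw [← Finset.mul_sum, Finset.sum_add_distrib, Finset.sum_add_distrib, ← Finset.mul_sum,
          ← Finset.mul_sum, ← Finset.mul_sum]
    _ ≤ _ := by
        refine mul_le_mul_of_nonneg_left (add_le_add (add_le_add ?_ ?_) ?_) (abs_nonneg _)
        · rw [div_eq_mul_one_div]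
          exact mul_le_mul_of_nonneg_left (sum_single_div_le _) (lam_nonneg _)
        · rw [sum_single_div]
        · split_ifs
          · rw [div_eq_mul_one_div]
            exact mul_le_mul_of_nonneg_left (sum_single_div_le _) hκ0
          · simp

lemma lam_div_omega_le {i : ℕ} (hi : i ≠ 0) : lam i / omega 2 (i - 1) ≤ 1 / 2 := by
  obtain ⟨n, rfl⟩ := Nat.exists_eq_succ_of_ne_zero hi
  rw [div_le_iff₀ (omega_pos 2 _), Nat.succ_eq_add_one, Nat.add_sub_cancel, lam]
  push_cast
  rcases Nat.eq_zero_or_pos n with rfl | hn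
  · rw [omega_zero]; norm_num
  · rw [omega_of_pos 2 hn]; ring_nf; exact le_rfl

lemma beta_mul_extend_le {i : ℕ} (hi : i ≠ 0) :
    beta i * extend (fun j => 1 / omega 2 j) (i + 1) ≤ 1 / 2 := by
  have hb : beta i * (1 / omega 2 (i + 1)) = 1 / 2 := by
    rw [omega_of_pos 2 (Nat.succ_pos i), beta, if_neg hi]
    push_cast
    have : (i : ℝ) + 1 ≠ 0 := by positivity
    field_simp
  by_cases h : i + 1 < m
  · have e : extend (fun j => 1 / omega 2 j) (i + 1) = 1 / omega 2 (i + 1) :=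
      extend_val (fun j : Fin m => 1 / omega 2 j) ⟨i + 1, h⟩
    rw [e, hb]
  · rw [extend_of_le _ (not_lt.1 h), mul_zero]; norm_num

lemma z1F_tail_eq (h : IsSparseData d c b X v) {i : Fin m} (hi : i ≠ last) :
    z1F d i = ∑ j, |(1 - d.A * KTilde d) i j| / omega 2 j := by
  unfold z1F
  have : d.A i last = 0 := by rw [h.hA]; exact sparseA_last hi
  rw [this, abs_zero, mul_zero, add_zero]

lemma z1F_last_le (h : IsSparseData d c b X v) : z1F d last ≤ 0.36 / 361 := by
  have h1 := h.sum_abs_one_sub_le last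
  have h2 := linDefect_le h.hc (i := last) (by decide)
  have h3 := sum_abs_sparseA_last_le h.hc (y := fun l => ∑ j, |nonlinBlock d v l j| / omega 2 j)
    (fun l => Finset.sum_nonneg fun j _ => div_nonneg (abs_nonneg _) (omega_pos 2 _).le)
    h.sum_abs_nonlinBlock_le
  have hl : ((last : Fin m) : ℕ) = 19 := rfl
  rw [if_pos rfl, hl] at h2
  have h4 := lam_div_omega_le (i := 19) (by norm_num)
  have h5 : extend (fun j => 1 / omega 2 j) (19 + 1) = 0 := extend_of_le _ (le_refl 20)
  have hw := wTilde_le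
  have h6 : linDefect c last ≤ 1 / 721 * (1 / 2 + 200 * 180.5 * (1.21 / 801) / 361) := by
    refine h2.trans (mul_le_mul (abs_sparseDiag_last h.hc) ?_ ?_ (by norm_num))
    · rw [h5, mul_zero, add_zero, beta_last, lam_m, omega_last]
      refine add_le_add h4 (div_le_div_of_nonneg_right ?_ (by norm_num))
      exact mul_le_mul_of_nonneg_left hw (by norm_num)
    · rw [h5, mul_zero, add_zero, beta_last, lam_m, omega_last]
      have := wTilde_nonneg
      have := lam_nonneg 19
      have := omega_pos 2 (19 - 1)
      positivity
  have h7 : |beta (m - 1)| * |lam m| * theta ^ (2 * L) / (|mu m| * omega 2 (m - 1) * (1 - theta ^ 2)) *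
      |d.A last last| ≤ 200 * 180.5 * 0.0001 / (801 * 361 * 0.9) * (1 / 721) := by
    have ht := theta_pow_le
    have ht0 : 0 ≤ theta ^ (2 * L) := pow_nonneg theta_pos.le _
    have h9 : 0.9 ≤ 1 - theta ^ 2 := by nlinarith [theta_mem.2, theta_pos]
    have ha : |d.A last last| ≤ 1 / 721 := by rw [h.hA]; exact abs_sparseA_last_last h.hc
    have ho : omega 2 (m - 1) = 361 := omega_last
    rw [beta_last, lam_m, mu_m, ho, abs_of_pos (by norm_num), abs_of_pos (by norm_num),
      abs_of_pos (by norm_num)]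
    generalize theta ^ (2 * L) = p at ht ht0 ⊢
    refine mul_le_mul ?_ ha (abs_nonneg _) (by norm_num)
    apply div_le_div₀ (by norm_num) (by linarith) (by norm_num) (by linarith)
  unfold z1F
  refine (add_le_add (h1.trans (add_le_add h6 h3)) h7).trans ?_
  norm_num

/-- For interior rows `i ≥ 2` the weighted neighbours contribute at most `1/2` each and the weighted
diagonal at most `4/7`, its value at `i = 2` for `c = 2`. Rows `0` and `1` give at most `1/2`, and
the nonlinear block adds at most `0.0048`. The last row is treated separately. -/
lemma z1F_le (h : IsSparseData d c b X v) (i : Fin m) : z1F d i * omega 2 i ≤ 0.6 := by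
  by_cases hl : i = last
  · subst hl
    have h1 := h.z1F_last_le
    have h2 : omega 2 ((last : Fin m) : ℕ) = 361 := omega_last
    rw [h2]
    norm_num at h1 ⊢
    linarith
  · rw [h.z1F_tail_eq hl]
    have h1 := h.sum_abs_one_sub_le i
    have h3 := sum_abs_sparseA_le h.hc (y := fun l => ∑ j, |nonlinBlock d v l j| / omega 2 j)
      (fun l => Finset.sum_nonneg fun j _ => div_nonneg (abs_nonneg _) (omega_pos 2 _).le)
      h.sum_abs_nonlinBlock_le i
    have hω := omega_pos 2 i
    have h4 : linDefect c i * omega 2 i ≤ 4 / 7 := by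
      rcases Nat.eq_zero_or_pos (i : ℕ) with h0 | h0
      · have hi : i = 0 := Fin.ext h0
        subst hi
        have := linDefect_zero_le h.hc
        change linDefect c 0 * omega 2 0 ≤ _
        rw [omega_zero]; linarith
      · have h5 := linDefect_le h.hc h0.ne'
        have h6 := lam_div_omega_le h0.ne'
        have h7 := beta_mul_extend_le h0.ne'
        rw [if_neg hl, add_zero] at h5
        rcases Nat.lt_or_ge 1 (i : ℕ) with h8 | h8
        · have h9 := abs_sparseDiag_mul_omega_le h.hc h8
          calc _ ≤ |sparseDiag c i| * 1 * omega 2 i := by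
                gcongr
                exact h5.trans (mul_le_mul_of_nonneg_left (by linarith) (abs_nonneg _))
            _ ≤ _ := by rwa [mul_one]
        · have hi1 : (i : ℕ) = 1 := by omega
          have h9 := abs_sparseDiag_mul_omega_le_one h.hc (le_of_eq hi1.symm)
          have h10 : lam i / omega 2 (i - 1) = 0 := by rw [hi1]; norm_num [lam]
          rw [h10, zero_add] at h5
          calc _ ≤ |sparseDiag c i| * (1 / 2) * omega 2 i := by
                gcongr
                exact h5.trans (mul_le_mul_of_nonneg_left (by linarith) (abs_nonneg _))
            _ = (|sparseDiag c i| * omega 2 i) / 2 := by ring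
            _ ≤ _ := by linarith
    have h5 := mul_le_mul_of_nonneg_right h1 hω.le
    rw [add_mul] at h5
    norm_num at h3 h4 h5 ⊢
    linarith

end IsSparseData

/-! ### Bounds for the Lipschitz constants -/

lemma omega_two_m_add (k : ℕ) : omega 2 (m + k) = ((m : ℝ) + k) ^ 2 := by
  rw [omega_of_pos 2 (m_add_pos k)]; push_cast; ring

lemma omega_four_m_add (k : ℕ) : omega 4 (m + k) = omega 2 (m + k) * omega 2 (m + k) := by
  rw [omega_of_pos 4 (m_add_pos k), omega_of_pos 2 (m_add_pos k)]; ring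

/-- The weighted decay is largest at `k = 0`, whence `1.2 · 400 · 180.5/801 < 109`. This factor
amplifies the last finite coordinate in the tail, hence the sharper bound `z1F_last_le`. -/
lemma decay_mul_omega_le (k : ℕ) :
    eta * theta ^ k * (|lam m| / |mu m|) * omega 2 (m + k) ≤ 109 := by
  rw [abs_lam_div_mu]
  have h1 := theta_pow_mul_sq_le k
  have h2 := eta_lt
  have h3 : 0 ≤ theta ^ k * omega 2 (m + k) :=
    mul_nonneg (pow_nonneg theta_pos.le _) (omega_pos 2 _).le
  calc _ = eta * (theta ^ k * omega 2 (m + k)) * (180.5 / 801) := by ring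
    _ ≤ 1.2 * 400 * (180.5 / 801) := by gcongr
    _ ≤ _ := by norm_num

section

variable {c C q Q : ℝ} {y : Fin m → ℝ}

lemma absAF_coupling_le (hq : 0 ≤ q) :
    |beta (m - 1)| * eta * q / (C₁ * (1 - theta) * omega 4 m) ≤ 0.0011 * q := by
  have h1 := eta_lt
  have h2 := theta_mem.2
  have h3 : omega 4 m = 160000 := by rw [omega_of_pos 4 (by norm_num)]; norm_num
  rw [beta_last, h3, C₁, abs_of_pos (by norm_num), div_le_iff₀ (by norm_num; linarith)]
  have h4 : 200 * eta ≤ 0.0011 * (2 * (1 - theta) * 160000) := by norm_num at *; linarith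
  calc _ ≤ 0.0011 * (2 * (1 - theta) * 160000) * q := mul_le_mul_of_nonneg_right h4 hq
    _ = _ := by ring

lemma absAF_last_le (hc : c = 0 ∨ c = 2) (hy0 : ∀ j, 0 ≤ y j) (hy : ∀ j, y j ≤ C) (hq : 0 ≤ q)
    (hQ : q ≤ Q) : absAF (sparseA c) y q last ≤ (C + 0.0011 * Q) / 721 := by
  unfold absAF
  have h1 := sum_abs_sparseA_last_le hc hy0 hy
  have h2 := mul_le_mul ((absAF_coupling_le hq).trans
    (mul_le_mul_of_nonneg_left hQ (by norm_num))) (abs_sparseA_last_last hc) (abs_nonneg _)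
    (mul_nonneg (by norm_num) (hq.trans hQ))
  refine (add_le_add h1 h2).trans (le_of_eq ?_)
  ring

lemma absAF_le (hc : c = 0 ∨ c = 2) (hy0 : ∀ j, 0 ≤ y j) (hy : ∀ j, y j ≤ C) (hq : 0 ≤ q)
    (hQ : q ≤ Q) (i : Fin m) : absAF (sparseA c) y q i * omega 2 i ≤ 2 * C + 0.001 * Q := by
  have hC := (hy0 0).trans (hy 0)
  by_cases hl : i = last
  · subst hl
    have h1 := absAF_last_le hc hy0 hy hq hQ
    have h2 : omega 2 ((last : Fin m) : ℕ) = 361 := omega_last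
    rw [h2]
    have := hq.trans hQ
    linarith
  · unfold absAF
    rw [sparseA_last hl, abs_zero, mul_zero, add_zero]
    have h1 := sum_abs_sparseA_le hc hy0 hy i
    have := hq.trans hQ
    linarith

lemma absAI_le (hc : c = 0 ∨ c = 2) (hy0 : ∀ j, 0 ≤ y j) (hy : ∀ j, y j ≤ C) (hq : 0 ≤ q)
    (hQ : q ≤ Q) {k : ℕ} (hk : k ≤ M) :
    absAI (sparseA c) y q k * omega 2 (m + k) ≤ 109 * ((C + 0.0011 * Q) / 721) + 0.0031 * Q := by
  have h1 := absAF_last_le hc hy0 hy hq hQ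
  have h0 := absAF_nonneg hy0 hq (A := sparseA c) last
  have h2 := decay_mul_omega_le k
  have hω := omega_pos 2 (m + k)
  have ht := theta_mem.2
  have hf : theta / (1 - theta) ≤ 0.43 := by rw [div_le_iff₀ (by linarith)]; linarith
  have hf0 : 0 ≤ theta / (1 - theta) := div_nonneg theta_pos.le (by linarith)
  set T := (if k < M then
          ∑ l ∈ Finset.range (k + 1), theta ^ (k - l) * (((m : ℝ) + k) / ((m : ℝ) + l)) ^ 4
        else chi) + theta / (1 - theta) with hT
  have hT1 : T / omega 2 (m + k) ≤ 0.0051 := by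
    rw [div_le_iff₀ hω, omega_two_m_add]
    by_cases hkM : k < M
    · have h3 := powSum_le k
      unfold powSum at h3
      rw [hT, if_pos hkM]
      have h4 : (0 : ℝ) ≤ k := Nat.cast_nonneg k
      have h5 : (400 : ℝ) ≤ ((m : ℝ) + k) ^ 2 := by push_cast; nlinarith
      calc _ ≤ (1.6 : ℝ) + 0.43 := add_le_add h3 hf
        _ ≤ 0.0051 * 400 := by norm_num
        _ ≤ _ := mul_le_mul_of_nonneg_left h5 (by norm_num)
    · rw [hT, if_neg hkM]
      have h3 := chi_le
      have hk' : k = 20 := le_antisymm hk (not_lt.1 hkM)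
      have h5 : ((m : ℝ) + k) ^ 2 = 1600 := by rw [hk']; norm_num
      rw [h5]; linarith
  have he := eta_lt
  have hep := eta_pos
  have hT0 : 0 ≤ T / omega 2 (m + k) := by
    refine div_nonneg (add_nonneg ?_ hf0) hω.le
    split_ifs
    · have := theta_pos
      exact Finset.sum_nonneg fun l _ => by positivity
    · linarith [two_le_chi]
  have e : absAI (sparseA c) y q k * omega 2 (m + k) =
      absAF (sparseA c) y q last * (eta * theta ^ k * (|lam m| / |mu m|) * omega 2 (m + k)) +
        eta * q / 2 * (T / omega 2 (m + k)) := by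
    unfold absAI
    rw [← hT, C₁, omega_four_m_add]
    have := hω.ne'
    field_simp
  rw [e]
  have hd : 0 ≤ eta * theta ^ k * (|lam m| / |mu m|) * omega 2 (m + k) := by
    have := theta_pos
    positivity
  refine add_le_add ?_ ?_
  · rw [mul_comm 109]
    exact mul_le_mul h1 h2 hd (h0.trans h1)
  · calc _ ≤ 1.2 * Q / 2 * 0.0051 := by
          have := hq.trans hQ
          gcongr
      _ ≤ _ := by have := hq.trans hQ; linarith

end

namespace IsSparseData

variable {d : NumData} {c b X : ℝ} {v : Fin m → ℝ}

lemma c1F_le (h : IsSparseData d c b X v) (k : Fin m) : c1F d k ≤ 0.00001 := by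
  unfold c1F
  have hX := h.hX.nonneg
  have h1 : ∀ l ∈ Finset.Ico (m - (k : ℕ)) m, |extend d.x l| / omega 2 ((k : ℕ) + l) ≤ X / 400 :=
    fun l hl => by
      have hk : (k : ℕ) < 20 := k.2
      replace hl : 20 - (k : ℕ) ≤ l ∧ l < 20 := Finset.mem_Ico.1 hl
      have hl0 : 0 < l := by omega
      have e : extend d.x l = extend v l := by
        rw [h.hx, Pi.add_apply, Pi.smul_apply, Pi.single_eq_of_ne hl0.ne', smul_zero, add_zero]
      rw [e, omega_of_pos 2 (by omega)]
      have h2 : (20 : ℝ) ≤ (((k : ℕ) + l : ℕ) : ℝ) := by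
        exact_mod_cast (by omega : 20 ≤ (k : ℕ) + l)
      exact div_le_div₀ hX (h.hX.abs_le l) (by norm_num) (by nlinarith)
  have h2 := Finset.sum_le_card_nsmul _ _ _ h1
  rw [Nat.card_Ico, nsmul_eq_mul] at h2
  have h3 : ((m - (m - (k : ℕ)) : ℕ) : ℝ) ≤ 19 := by
    have : (k : ℕ) < 20 := k.2
    exact_mod_cast (by omega : 20 - (20 - (k : ℕ)) ≤ 19)
  have h4 := h.hσX
  calc _ ≤ 2 * |d.σ| * (19 * (X / 400)) := by
        gcongr
        exact h2.trans (mul_le_mul_of_nonneg_right h3 (by positivity))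
    _ = 0.095 * (|d.σ| * X) := by ring
    _ ≤ _ := by linarith

lemma c2F_le (h : IsSparseData d c b X v) (k : Fin m) : c2F d k ≤ 0.0024 := by
  unfold c2F
  have h1 := alpha_le k
  have h2 := h.hσ
  refine (div_le_self (mul_nonneg (by positivity) (alpha_nonneg _)) (one_le_omega 2 _)).trans ?_
  have h3 := mul_le_mul h2 h1 (alpha_nonneg _) (by norm_num)
  linarith

lemma q2_le (h : IsSparseData d c b X v) : q2 d ≤ 0.0024 := by
  unfold q2
  have h3 := mul_le_mul h.hσ (alpha_le m) (alpha_nonneg _) (by norm_num)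
  linarith

/-- The centre may be huge, but `|σ| |b| = c/2 ≤ 1`; this contributes `24`, and `|σ| X` is
negligible. -/
lemma q1_le (h : IsSparseData d c b X v) : q1 d ≤ 24.1 := by
  have hD : Dominated (extend d.x) (X + |b|) := by
    have := h.hX.add (dominated_single_zero.smul b)
    rwa [← h.hx, mul_one] at this
  have h1 := hD.normOmega_le
  have h2 := alpha_le m
  have h3 := h.hσX
  have h4 : |d.σ| * |b| ≤ 1 := by
    have e : d.σ * b = -c / 2 := by linarith [h.hb]
    rw [← abs_mul, e]
    rcases h.hc with rfl | rfl <;> norm_num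
  have hX := h.hX.nonneg
  have hn : 0 ≤ normOmega 2 (extend d.x) :=
    Real.iSup_nonneg fun k => mul_nonneg (abs_nonneg _) (omega_pos 2 k).le
  unfold q1
  calc _ ≤ 2 * |d.σ| * 12 * (X + |b|) := by
        gcongr
    _ = 24 * (|d.σ| * X) + 24 * (|d.σ| * |b|) := by ring
    _ ≤ _ := by linarith

lemma lipF_le (h : IsSparseData d c b X v) {r : ℝ} (hr0 : 0 ≤ r) (hr : r ≤ 0.0001) (i : Fin m) :
    lipF d r i * omega 2 i ≤ 0.66 := by
  have h1 := h.z1F_le i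
  have h2 := absAF_le h.hc (c1F_nonneg d) h.c1F_le (q1_nonneg d) h.q1_le i
  have h3 := absAF_le h.hc (c2F_nonneg d) h.c2F_le (q2_nonneg d) h.q2_le i
  have h4 := mul_le_mul_of_nonneg_left h3 hr0
  unfold lipF
  rw [absAF_smul, h.hA, add_mul, add_mul, mul_assoc]
  linarith

lemma lipI_le (h : IsSparseData d c b X v) {r : ℝ} (hr0 : 0 ≤ r) (hr : r ≤ 0.0001) {k : ℕ}
    (hk : k ≤ M) : lipI d r k * omega 2 (m + k) ≤ 0.2 := by
  have h1 : z1I d k * omega 2 (m + k) ≤ 0.36 / 361 * 109 := by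
    unfold z1I
    rw [mul_assoc]
    have := theta_pos
    have := eta_pos
    have := omega_pos 2 (m + k)
    exact mul_le_mul h.z1F_last_le (decay_mul_omega_le k) (by positivity) (by norm_num)
  have h2 := absAI_le h.hc (c1F_nonneg d) h.c1F_le (q1_nonneg d) h.q1_le hk
  have h3 := absAI_le h.hc (c2F_nonneg d) h.c2F_le (q2_nonneg d) h.q2_le hk
  have h4 := mul_le_mul_of_nonneg_left h3 hr0
  unfold lipI
  rw [absAI_smul, h.hA, add_mul, add_mul, mul_assoc]
  norm_num at h1 h2 h4 hr ⊢
  linarith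

end IsSparseData

/-! ### Bounds for the defect -/

/-- The defect `f(x̄)` is small. -/
structure SmallDefect (d : NumData) : Prop where
  head : ∀ k < m, |f d.σ (extend d.x) k| ≤ 5 * 10 ^ (-12 : ℤ)
  first : |f d.σ (extend d.x) m| ≤ 4 * 10 ^ (-11 : ℤ)
  tail : ∀ k, m < k → |f d.σ (extend d.x) k| ≤ 10 ^ (-14 : ℤ)

/-- The first source is kept apart because truncation puts nearly all of the tail defect there; its
contribution retains the factor `θ^k`. -/
lemma greenSum_le {r : ℕ → ℝ} {a e : ℝ} (hr : ∀ n, m - 1 ≤ n → r n = 0) (he : 0 ≤ e)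
    (ha : r 0 ≤ a) (h : ∀ n, 0 < n → r n ≤ e) (k : ℕ) :
    greenSum r k ≤ eta * (theta ^ k * a + (k + 19) * e) := by
  have ht0 := theta_pos.le
  have ht1 := theta_lt_one.le
  have hp : ∀ n : ℕ, theta ^ n ≤ 1 := fun n => pow_le_one₀ ht0 ht1
  have hb : ∀ n l : ℕ, 0 < l → theta ^ n * r l ≤ e := fun n l hl =>
    (mul_le_mul_of_nonneg_left (h l hl) (pow_nonneg ht0 _)).trans
      (mul_le_of_le_one_left he (hp n))
  rw [greenSum_of_support hr]
  refine mul_le_mul_of_nonneg_left ?_ eta_pos.le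
  rw [Finset.sum_range_succ', Nat.sub_zero]
  have h1 := Finset.sum_le_card_nsmul (Finset.range k)
    (fun l => theta ^ (k - (l + 1)) * r (l + 1)) e fun l _ => hb _ _ (Nat.succ_pos l)
  have h2 := Finset.sum_le_card_nsmul (Finset.Ico (k + 1) (m - 1))
    (fun l => theta ^ (l - k) * r l) e fun l hl => hb _ _ (by
      rw [Finset.mem_Ico] at hl; omega)
  have h3 := mul_le_mul_of_nonneg_left ha (pow_nonneg ht0 k)
  rw [Finset.card_range, nsmul_eq_mul] at h1
  rw [Nat.card_Ico, nsmul_eq_mul] at h2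
  have h4 : ((m - 1 - (k + 1) : ℕ) : ℝ) ≤ 19 := by
    exact_mod_cast (by omega : 19 - (k + 1) ≤ 19)
  have h5 := mul_le_mul_of_nonneg_right h4 he
  linarith

namespace SmallDefect

variable {d : NumData} {c : ℝ}

lemma greenSum_resid_le (hs : SmallDefect d) (k : ℕ) :
    greenSum (resid d) k ≤ eta * (theta ^ k * (4 * 10 ^ (-11 : ℤ) / 801) +
      (k + 19) * (10 ^ (-14 : ℤ) / 801)) := by
  refine greenSum_le (fun n hn => resid_eq_zero d hn) (by positivity) ?_ (fun n hn => ?_) k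
  · have h := hs.first
    unfold resid
    rw [add_zero, mu_m, abs_of_pos (by norm_num : (0 : ℝ) < 801)]
    exact div_le_div_of_nonneg_right h (by norm_num)
  · have h := hs.tail (m + n) (by omega)
    unfold resid
    refine div_le_div₀ (by positivity) h (by norm_num) ?_
    rw [abs_of_pos (mu_pos _), mu]
    have : (0 : ℝ) ≤ n := Nat.cast_nonneg n
    push_cast
    nlinarith

lemma resid₀_le (hs : SmallDefect d) : resid₀ d ≤ 6.1 * 10 ^ (-14 : ℤ) := by
  have h := hs.greenSum_resid_le 0
  rw [greenSum_resid_zero] at h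
  refine h.trans ((mul_le_mul_of_nonneg_right eta_lt.le (by positivity)).trans ?_)
  norm_num

lemma resid₀_nonneg (d : NumData) : 0 ≤ resid₀ d :=
  mul_nonneg eta_pos.le (Finset.sum_nonneg fun l _ =>
    mul_nonneg (pow_nonneg theta_pos.le _) (resid_nonneg d l))

lemma abs_Af_le (hA : d.A = sparseA c) (i : Fin m) :
    |Af d i| ≤ ∑ j : Fin m, |sparseA c i j| * |f d.σ (extend d.x) j| := by
  unfold Af
  rw [hA]
  exact (Finset.abs_sum_le_sum_abs _ _).trans (le_of_eq (Finset.sum_congr rfl fun j _ => abs_mul _ _))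

lemma YF_last_le (hs : SmallDefect d) (hc : c = 0 ∨ c = 2) (hA : d.A = sparseA c) :
    YF d last ≤ 2.4 * 10 ^ (-14 : ℤ) := by
  have h1 := (abs_Af_le hA last).trans (sum_abs_sparseA_last_le hc (fun j => abs_nonneg _)
    fun j => hs.head j j.2)
  have h2 := hs.resid₀_le
  have h0 := resid₀_nonneg d
  have h3 := mul_le_mul h2 (abs_sparseA_last_last hc) (abs_nonneg _) (by positivity)
  unfold YF
  rw [beta_last, abs_of_pos (by norm_num : (0 : ℝ) < 200), hA, mul_assoc]
  refine (add_le_add h1 (mul_le_mul_of_nonneg_left h3 (by norm_num))).trans ?_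
  norm_num

lemma YF_le (hs : SmallDefect d) (hc : c = 0 ∨ c = 2) (hA : d.A = sparseA c) (i : Fin m) :
    YF d i * omega 2 i ≤ 1.1 * 10 ^ (-11 : ℤ) := by
  by_cases hl : i = last
  · subst hl
    have h1 := hs.YF_last_le hc hA
    have h2 : omega 2 ((last : Fin m) : ℕ) = 361 := omega_last
    rw [h2]
    norm_num at h1 ⊢
    linarith
  · have h1 := sum_abs_sparseA_le hc (fun j => abs_nonneg (f d.σ (extend d.x) j))
      (fun j => hs.head j j.2) i
    have h2 := mul_le_mul_of_nonneg_right (abs_Af_le hA i) (omega_pos 2 i).le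
    unfold YF
    rw [hA, sparseA_last hl, abs_zero, mul_zero, add_zero]
    refine (h2.trans h1).trans ?_
    norm_num

lemma YI_eq (d : NumData) (k : ℕ) : YI d k =
    YF d last * (eta * theta ^ k * (|lam m| / |mu m|)) + greenSum (resid d) k := by
  rw [greenSum_resid]
  unfold YI YF
  rw [abs_mul]
  congr 1
  ring

lemma YI_le (hs : SmallDefect d) (hc : c = 0 ∨ c = 2) (hA : d.A = sparseA c) {k : ℕ} (hk : k ≤ M) :
    YI d k * omega 2 (m + k) ≤ 3 * 10 ^ (-11 : ℤ) := by
  have h1 := hs.YF_last_le hc hA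
  have hω := omega_pos 2 (m + k)
  have ht := theta_pos
  have he := eta_pos
  have h2 := mul_le_mul h1 (decay_mul_omega_le k) (by positivity) (by positivity)
  have h3 := mul_le_mul_of_nonneg_right (hs.greenSum_resid_le k) hω.le
  have h4 := theta_pow_mul_sq_le k
  have hk' : (k : ℝ) ≤ 20 := by exact_mod_cast hk
  have h5 : omega 2 (m + k) ≤ 1600 := by
    rw [omega_two_m_add]
    have : (0 : ℝ) ≤ k := Nat.cast_nonneg k
    push_cast
    nlinarith
  rw [YI_eq, add_mul, mul_assoc]
  have h6 : eta * (theta ^ k * (4 * 10 ^ (-11 : ℤ) / 801) + (k + 19) * (10 ^ (-14 : ℤ) / 801)) *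
      omega 2 (m + k) ≤ 1.2 * (400 * (4 * 10 ^ (-11 : ℤ) / 801) +
        (20 + 19) * (10 ^ (-14 : ℤ) / 801) * 1600) :=
    calc _ = eta * ((theta ^ k * omega 2 (m + k)) * (4 * 10 ^ (-11 : ℤ) / 801) +
          (k + 19) * (10 ^ (-14 : ℤ) / 801) * omega 2 (m + k)) := by ring
      _ ≤ _ := by
        have := eta_lt
        gcongr
  refine (add_le_add h2 (h3.trans h6)).trans ?_
  norm_num

end SmallDefect

theorem radiiNeg_of_smallDefect {d : NumData} {c b X : ℝ} {v : Fin m → ℝ}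
    (h : IsSparseData d c b X v) (hs : SmallDefect d) {r : ℝ} (hr0 : 4 * 10 ^ (-11 : ℤ) ≤ r)
    (hr : r ≤ 10 ^ (-4 : ℤ)) : RadiiNeg d r := by
  have hrp : 0 < r := lt_of_lt_of_le (by positivity) hr0
  have hr' : r ≤ 0.0001 := hr.trans (by norm_num)
  -- On this range the margins close at the lower end: `1.1e-11 < 0.34 r` in the finite block and
  -- `3e-11 < 0.8 r` in the tail. The upper end keeps the quadratic terms inside the Lipschitz
  -- bounds `0.66` and `0.2`.
  norm_num at hr0
  refine ⟨fun i => ?_, fun k hk => ?_⟩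
  · have hω := omega_pos 2 i
    have h1 := mul_le_mul_of_nonneg_right (h.lipF_le hrp.le hr' i) hrp.le
    have h2 := hs.YF_le h.hc h.hA i
    norm_num at h2
    rw [radiiF_eq, sub_neg, lt_div_iff₀ hω, add_mul, mul_right_comm]
    linarith
  · have hω := omega_pos 2 (m + k)
    have h1 := mul_le_mul_of_nonneg_right (h.lipI_le hrp.le hr' hk) hrp.le
    have h2 := hs.YI_le h.hc h.hA hk
    norm_num at h2
    rw [radiiI_eq, sub_neg, lt_div_iff₀ hω, add_mul, mul_right_comm]
    linarith

/-! ### Integer arithmetic for the defect of explicit data -/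

/-- A finite list of integers as a sequence. -/
def seqZ (V : List ℤ) (k : ℕ) : ℤ := V.getD k 0

/-- The vector with entries `V_i / N`. -/
def vecZ (V : List ℤ) (N : ℕ) (i : Fin m) : ℝ := (seqZ V i : ℝ) / N

/-- Twice the tridiagonal linear part, on integer sequences. -/
def linZ (V : List ℤ) (k : ℕ) : ℤ :=
  (if k = 0 then 0 else ((k : ℤ) - 1) ^ 2 * seqZ V (k - 1)) + 2 * (1 + 2 * (k : ℤ) ^ 2) * seqZ V k +
    (if k = 0 then 2 else ((k : ℤ) + 1) ^ 2) * seqZ V (k + 1)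

/-- The convolution of integer sequences supported in `{0, …, m - 1}`. -/
def convZ (V U : List ℤ) (k : ℕ) : ℤ :=
  ∑ j ∈ Finset.Icc (-19 : ℤ) 19, seqZ V j.natAbs * seqZ U ((k : ℤ) - j).natAbs

section

variable {V U : List ℤ} {N P : ℕ}

lemma extend_vecZ (hV : V.length ≤ m) (k : ℕ) : extend (vecZ V N) k = (seqZ V k : ℝ) / N := by
  by_cases hk : k < m
  · exact extend_val _ (⟨k, hk⟩ : Fin m)
  · rw [extend_of_le _ (not_lt.1 hk), seqZ, List.getD_eq_default _ _ (hV.trans (not_lt.1 hk))]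
    simp

lemma linPart_vecZ (hV : V.length ≤ m) (k : ℕ) :
    linPart (extend (vecZ V N)) k = (linZ V k : ℝ) / (2 * N) := by
  unfold linPart linZ beta lam mu
  rw [extend_vecZ hV, extend_vecZ hV, extend_vecZ hV]
  split_ifs <;> push_cast <;> ring

lemma conv_vecZ (hV : V.length ≤ m) (hU : U.length ≤ m) (k : ℕ) :
    conv (extend (vecZ V N)) (extend (vecZ U P)) k = (convZ V U k : ℝ) / (N * P) := by
  rw [conv_extend, convZ, Int.cast_sum, Finset.sum_div]
  refine Finset.sum_congr rfl fun j _ => ?_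
  rw [extend_vecZ hV, extend_vecZ hU]
  push_cast; ring

lemma dominated_vecZ (hV : V.length ≤ m) {C : ℕ}
    (h : ∀ k < m, |seqZ V k| * max 1 ((k : ℤ) ^ 2) ≤ C) :
    Dominated (extend (vecZ V N)) ((C : ℝ) / N) := by
  refine dominated_iff.2 fun k => ?_
  have hω : omega 2 k = ((max 1 ((k : ℤ) ^ 2) : ℤ) : ℝ) := by
    rcases Nat.eq_zero_or_pos k with rfl | hk
    · simp [omega_zero]
    · rw [omega_of_pos 2 hk, max_eq_right (by exact_mod_cast Nat.one_le_pow _ _ hk)]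
      push_cast; rfl
  by_cases hk : k < m
  · rw [extend_vecZ hV, abs_div, Nat.abs_cast, div_mul_eq_mul_div, hω]
    refine div_le_div_of_nonneg_right ?_ (Nat.cast_nonneg N)
    exact_mod_cast h k hk
  · rw [extend_of_le _ (not_lt.1 hk), abs_zero, zero_mul]
    positivity

end

lemma linPart_extend_eq_zero (v : Fin m → ℝ) {k : ℕ} (hk : m < k) : linPart (extend v) k = 0 := by
  unfold linPart
  rw [if_neg (by omega), extend_of_le _ (by omega), extend_of_le _ hk.le, extend_of_le _ (by omega)]
  ring

lemma linPart_add (x y : ℕ → ℝ) : linPart (x + y) = linPart x + linPart y := by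
  funext k; simp only [linPart, Pi.add_apply]; split_ifs <;> ring

lemma linPart_smul (c : ℝ) (x : ℕ → ℝ) : linPart (c • x) = c • linPart x := by
  funext k; simp only [linPart, Pi.smul_apply, smul_eq_mul]; split_ifs <;> ring

lemma abs_div_le_of_int {z : ℤ} {b N : ℝ} {B : ℤ} (h : |z| ≤ B) (hN : 0 < N) (hb : B ≤ b * N) :
    |(z : ℝ) / N| ≤ b := by
  rw [abs_div, abs_of_pos hN, div_le_iff₀ hN]
  refine le_trans ?_ hb
  exact_mod_cast h

/-! ### The branch through the solution `cos ξ` at `σ = 0` -/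

/-- Taylor coefficient of order `0` of the branch: the solution for `σ = 0`. -/
def branchZero : List ℤ := [0, 1]

/-- Taylor coefficient of order `1` of the branch, times `10 ^ 12`. -/
def branchOne : List ℤ :=
  [-520419722980, 20419722980, -30629584471, 3434755277, -500147664, 83877934, -15366296, 2990425,
    -608085, 127842, -27589, 6081, -1364, 310, -71, 17, -4, 1]

/-- Taylor coefficient of order `2` of the branch, times `10 ^ 12`. -/
def branchTwo : List ℤ :=
  [-234633535943, 193794089982, -15166481248, 3499290662, -627978495, 116627930, -22704585, 4600702,
    -962894, 206861, -45400, 10142, -2300, 528, -123, 29, -7, 2]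

/-- Taylor coefficients of the branch. -/
def taylorZero : Fin m → ℝ := vecZ branchZero 2
def taylorOne : Fin m → ℝ := vecZ branchOne (10 ^ 12)
def taylorTwo : Fin m → ℝ := vecZ branchTwo (10 ^ 12)

/-- The numerical data on the branch. -/
def branchData (σ : ℝ) : NumData where
  σ := σ
  x := fun i => taylorZero i + σ * taylorOne i + σ ^ 2 * taylorTwo i
  A := sparseA 0

lemma extend_branchData (σ : ℝ) : extend (branchData σ).x =
    extend taylorZero + σ • extend taylorOne + σ ^ 2 • extend taylorTwo := by
  funext k
  simp only [extend, branchData, Pi.add_apply, Pi.smul_apply, smul_eq_mul]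
  split_ifs <;> simp

lemma dominated_taylorZero : Dominated (extend taylorZero) 0.5 := by
  have h := dominated_vecZ (V := branchZero) (N := 2) (C := 1) (by decide) (by decide +kernel)
  norm_num at h ⊢; exact h

lemma dominated_taylorOne : Dominated (extend taylorOne) 0.53 := by
  have h := dominated_vecZ (V := branchOne) (N := 10 ^ 12) (C := 530000000000) (by decide)
    (by decide +kernel)
  norm_num at h ⊢; exact h

lemma dominated_taylorTwo : Dominated (extend taylorTwo) 0.24 := by
  have h := dominated_vecZ (V := branchTwo) (N := 10 ^ 12) (C := 240000000000) (by decide)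
    (by decide +kernel)
  norm_num at h ⊢; exact h

lemma linPart_taylorZero (k : ℕ) : linPart (extend taylorZero) k = gCoeff k := by
  by_cases hk : k < 3
  · unfold taylorZero
    rw [linPart_vecZ (by decide)]
    interval_cases k
    · rw [show linZ branchZero 0 = 2 by decide]; norm_num [gCoeff]
    · rw [show linZ branchZero 1 = 6 by decide]; norm_num [gCoeff]
    · rw [show linZ branchZero 2 = 1 by decide]; norm_num [gCoeff]
  · rw [gCoeff_of_le (not_lt.1 hk)]
    by_cases hk' : m < k
    · exact linPart_extend_eq_zero _ hk'
    · have h : ∀ k < 21, 3 ≤ k → linZ branchZero k = 0 := by decide +kernel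
      unfold taylorZero
      rw [linPart_vecZ (by decide), h k (Nat.lt_succ_of_le (not_lt.1 hk')) (not_lt.1 hk)]
      simp

/-- The defect of first order. -/
def defectOne (k : ℕ) : ℝ := linPart (extend taylorOne) k + conv (extend taylorZero) (extend taylorZero) k

/-- The defect of second order. -/
def defectTwo (k : ℕ) : ℝ :=
  linPart (extend taylorTwo) k + 2 * conv (extend taylorZero) (extend taylorOne) k

lemma defectOne_eq (k : ℕ) : defectOne k =
    ((2 * linZ branchOne k + 10 ^ 12 * convZ branchZero branchZero k : ℤ) : ℝ) / (4 * 10 ^ 12) := by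
  unfold defectOne taylorOne taylorZero
  rw [linPart_vecZ (by decide), conv_vecZ (by decide) (by decide)]
  push_cast; ring

lemma defectTwo_eq (k : ℕ) : defectTwo k =
    ((linZ branchTwo k + 2 * convZ branchZero branchOne k : ℤ) : ℝ) / (2 * 10 ^ 12) := by
  unfold defectTwo taylorTwo taylorOne taylorZero
  rw [linPart_vecZ (by decide), conv_vecZ (by decide) (by decide)]
  push_cast; ring

/-- The coefficient lists stop before the last mode, so truncation creates no coupling beyond `m`;
the indices up to `38` are a finite check. -/
lemma defectOne_of_lt {k : ℕ} (hk : m < k) : defectOne k = 0 := by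
  by_cases hk' : k < 39
  · have h : ∀ k < 39, 20 < k → 2 * linZ branchOne k + 10 ^ 12 * convZ branchZero branchZero k = 0 := by
      decide +kernel
    rw [defectOne_eq, h k hk' hk]; simp
  · rw [defectOne, linPart_extend_eq_zero _ hk, conv_extend_eq_zero _ _ (not_lt.1 hk'), add_zero]

lemma defectTwo_of_lt {k : ℕ} (hk : m < k) : defectTwo k = 0 := by
  by_cases hk' : k < 39
  · have h : ∀ k < 39, 20 < k → linZ branchTwo k + 2 * convZ branchZero branchOne k = 0 := by
      decide +kernel
    rw [defectTwo_eq, h k hk' hk]; simp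
  · rw [defectTwo, linPart_extend_eq_zero _ hk, conv_extend_eq_zero _ _ (not_lt.1 hk')]; simp

lemma abs_defectOne_le {k : ℕ} (hk : k ≤ m) : |defectOne k| ≤ 10 ^ (-9 : ℤ) := by
  have h : ∀ k < 21, |2 * linZ branchOne k + 10 ^ 12 * convZ branchZero branchZero k| ≤ 4000 := by
    decide +kernel
  rw [defectOne_eq]
  exact abs_div_le_of_int (h k (Nat.lt_succ_of_le hk)) (by norm_num) (by norm_num)

lemma abs_defectTwo_le {k : ℕ} (hk : k ≤ m) : |defectTwo k| ≤ 10 ^ (-9 : ℤ) := by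
  have h : ∀ k < 21, |linZ branchTwo k + 2 * convZ branchZero branchOne k| ≤ 2000 := by
    decide +kernel
  rw [defectTwo_eq]
  exact abs_div_le_of_int (h k (Nat.lt_succ_of_le hk)) (by norm_num) (by norm_num)

/-- The defect of order at least three, divided by `σ ^ 3`. -/
def defectRest (σ : ℝ) (k : ℕ) : ℝ :=
  2 * conv (extend taylorZero) (extend taylorTwo) k + conv (extend taylorOne) (extend taylorOne) k +
    2 * σ * conv (extend taylorOne) (extend taylorTwo) k +
    σ ^ 2 * conv (extend taylorTwo) (extend taylorTwo) k

/-- Expansion in powers of `σ`. Order zero cancels exactly, orders one and two carry only the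
rounding of the coefficients, and everything else has a factor `σ³`. One integer check thus serves
all parameters. -/
lemma f_branchData (σ : ℝ) (k : ℕ) : f σ (extend (branchData σ).x) k =
    σ * defectOne k + σ ^ 2 * defectTwo k + σ ^ 3 * defectRest σ k := by
  have d0 := dominated_taylorZero
  have d1 := dominated_taylorOne.smul σ
  have d2 := dominated_taylorTwo.smul (σ ^ 2)
  have h0 := linPart_taylorZero k
  rw [extend_branchData]
  unfold f defectOne defectTwo defectRest
  rw [linPart_add, linPart_add, linPart_smul, linPart_smul,
    conv_add_left (d0.add d1) d2 ((d0.add d1).add d2), conv_add_left d0 d1 ((d0.add d1).add d2),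
    conv_add_right d0 (d0.add d1) d2, conv_add_right d0 d0 d1,
    conv_add_right d1 (d0.add d1) d2, conv_add_right d1 d0 d1,
    conv_add_right d2 (d0.add d1) d2, conv_add_right d2 d0 d1]
  simp only [conv_smul_left, conv_smul_right, Pi.add_apply, Pi.smul_apply, smul_eq_mul]
  rw [conv_comm (extend taylorOne) (extend taylorZero), conv_comm (extend taylorTwo) (extend taylorZero),
    conv_comm (extend taylorTwo) (extend taylorOne)]
  linear_combination h0

lemma abs_defectRest_le {σ : ℝ} (hσ : |σ| ≤ 0.0001) (k : ℕ) : |defectRest σ k| ≤ 6.6 / omega 2 k := by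
  have hω := omega_pos 2 k
  have key : ∀ {x y : ℕ → ℝ} {a b : ℝ}, Dominated x a → Dominated y b →
      |conv x y k| ≤ 12 * (a * b) / omega 2 k := fun {x y a b} hx hy =>
    (abs_conv_le hx hy k).trans (div_le_div_of_nonneg_right (by
      rw [mul_comm]
      exact mul_le_mul_of_nonneg_right (alpha_le k) (mul_nonneg hx.nonneg hy.nonneg)) hω.le)
  have a1 := key dominated_taylorZero dominated_taylorTwo
  have a2 := key dominated_taylorOne dominated_taylorOne
  have a3 := key dominated_taylorOne dominated_taylorTwo
  have a4 := key dominated_taylorTwo dominated_taylorTwo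
  rw [le_div_iff₀ hω] at a1 a2 a3 a4 ⊢
  have hσ2 : σ ^ 2 ≤ 0.0001 := by
    rw [← sq_abs]; nlinarith [abs_nonneg σ]
  have b3 := mul_le_mul hσ a3 (by positivity) (by norm_num)
  have b4 := mul_le_mul hσ2 a4 (by positivity) (by norm_num)
  have t : |defectRest σ k| ≤ 2 * |conv (extend taylorZero) (extend taylorTwo) k| +
      |conv (extend taylorOne) (extend taylorOne) k| +
      2 * |σ| * |conv (extend taylorOne) (extend taylorTwo) k| +
      σ ^ 2 * |conv (extend taylorTwo) (extend taylorTwo) k| := by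
    unfold defectRest
    refine (abs_add_le _ _).trans (add_le_add ((abs_add_le _ _).trans (add_le_add
      ((abs_add_le _ _).trans (add_le_add ?_ le_rfl)) ?_)) ?_)
    · rw [abs_mul, abs_two]
    · rw [abs_mul, abs_mul, abs_two]
    · rw [abs_mul, abs_of_nonneg (sq_nonneg σ)]
  have t' := mul_le_mul_of_nonneg_right t hω.le
  norm_num at a1 a2 b3 b4 t' ⊢
  linarith

/-- The cubic remainder is the dominant contribution to these bounds: `(6.75e-5)³ · 6.6` is about
`2e-12`, and beyond `m` the weight divides it by `400`. -/
lemma smallDefect_branchData {σ : ℝ} (hσ : |σ| ≤ 675 * 10 ^ (-7 : ℤ)) : SmallDefect (branchData σ) := by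
  have hσ1 : |σ| ≤ 0.0000675 := hσ.trans (by norm_num)
  have hσ2 : |σ| ^ 2 ≤ 0.0000675 ^ 2 := pow_le_pow_left₀ (abs_nonneg _) hσ1 2
  have hσ3 : |σ| ^ 3 ≤ 0.0000675 ^ 3 := pow_le_pow_left₀ (abs_nonneg _) hσ1 3
  have hr := abs_defectRest_le (σ := σ) (by linarith)
  have t : ∀ k, |f (branchData σ).σ (extend (branchData σ).x) k| ≤
      |σ| * |defectOne k| + |σ| ^ 2 * |defectTwo k| + |σ| ^ 3 * |defectRest σ k| := fun k => by
    change |f σ _ k| ≤ _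
    rw [f_branchData]
    refine (abs_add_le _ _).trans (add_le_add ((abs_add_le _ _).trans (add_le_add ?_ ?_)) ?_)
    · rw [abs_mul]
    · rw [abs_mul, abs_pow]
    · rw [abs_mul, abs_pow]
  have hlow : ∀ k ≤ m, |f (branchData σ).σ (extend (branchData σ).x) k| ≤ 5 * 10 ^ (-12 : ℤ) :=
    fun k hk => by
      have h3 : |defectRest σ k| ≤ 6.6 :=
        (hr k).trans (div_le_self (by norm_num) (one_le_omega 2 k))
      have b1 := mul_le_mul hσ1 (abs_defectOne_le hk) (abs_nonneg _) (by norm_num)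
      have b2 := mul_le_mul hσ2 (abs_defectTwo_le hk) (abs_nonneg _) (by norm_num)
      have b3 := mul_le_mul hσ3 h3 (abs_nonneg _) (by norm_num)
      refine (t k).trans ((add_le_add (add_le_add b1 b2) b3).trans ?_)
      norm_num
  refine ⟨fun k hk => hlow k hk.le, (hlow m le_rfl).trans (by norm_num), fun k hk => ?_⟩
  have h3 : |defectRest σ k| ≤ 6.6 / 400 := by
    refine (hr k).trans (div_le_div_of_nonneg_left (by norm_num) (by norm_num) ?_)
    have := omega_mono 2 hk.le
    have e : omega 2 m = 400 := by rw [omega_of_pos 2 (by norm_num)]; norm_num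
    rwa [e] at this
  have b3 := mul_le_mul hσ3 h3 (abs_nonneg _) (by norm_num)
  have := t k
  rw [defectOne_of_lt hk, defectTwo_of_lt hk, abs_zero, mul_zero, mul_zero, zero_add, zero_add] at this
  refine (this.trans b3).trans ?_
  norm_num

lemma dominated_branchData {σ : ℝ} (hσ : |σ| ≤ 675 * 10 ^ (-7 : ℤ)) :
    Dominated (extend (branchData σ).x) 0.51 := by
  have hσ1 : |σ| ≤ 0.0000675 := hσ.trans (by norm_num)
  have hσ2 : |σ ^ 2| ≤ 0.0000675 ^ 2 := by
    rw [abs_pow]; exact pow_le_pow_left₀ (abs_nonneg _) hσ1 2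
  have h := (dominated_taylorZero.add (dominated_taylorOne.smul σ)).add (dominated_taylorTwo.smul (σ ^ 2))
  rw [← extend_branchData] at h
  intro k
  refine (h k).trans (div_le_div_of_nonneg_right ?_ (omega_pos 2 k).le)
  norm_num at hσ1 hσ2 ⊢
  linarith

lemma isSparseData_branchData {σ : ℝ} (hσ : |σ| ≤ 675 * 10 ^ (-7 : ℤ)) :
    IsSparseData (branchData σ) 0 0 0.51 (branchData σ).x where
  hc := Or.inl rfl
  hA := rfl
  hx := by simp
  hb := by simp
  hX := dominated_branchData hσ
  hσX := by
    change |σ| * 0.51 ≤ _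
    norm_num at hσ ⊢
    linarith
  hσ := by
    change |σ| ≤ _
    norm_num at hσ ⊢
    linarith

/-! ### A solution far from the branch, at `σ = -1 / 20000` -/

/-- The deviation of the second solution from the constant `20000`, times `10 ^ 16`. -/
def largeList : List ℤ :=
  [11840225943867493, 16843772647380834, -920967265592913, 116936427296248, -18266139987275,
    3204698955777, -605833685071, 120660404449, -24974868445, 5324880329, -1162322446, 258609088,
    -58457818, 13391834, -3103062, 726140, -171386, 40745, -9709, 2181]

def largeDev : Fin m → ℝ := vecZ largeList (10 ^ 16)

/-- The numerical data for the solution near the constant `20000`. -/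
def largeData : NumData where
  σ := -1 / 20000
  x := fun i => largeDev i + 20000 * (Pi.single 0 1 : ℕ → ℝ) i
  A := sparseA 2

lemma extend_largeData :
    extend largeData.x = extend largeDev + (20000 : ℝ) • (Pi.single 0 1 : ℕ → ℝ) := by
  funext k
  simp only [extend, largeData, Pi.add_apply, Pi.smul_apply, smul_eq_mul]
  split_ifs with hk
  · rfl
  · rw [Pi.single_eq_of_ne (by rintro rfl; exact hk (by norm_num))]; simp

lemma dominated_largeDev : Dominated (extend largeDev) 1.7 := by
  have h := dominated_vecZ (V := largeList) (N := 10 ^ 16) (C := 17000000000000000) (by decide)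
    (by decide +kernel)
  norm_num at h ⊢; exact h

lemma isSparseData_largeData : IsSparseData largeData 2 20000 1.7 largeDev where
  hc := Or.inr rfl
  hA := rfl
  hx := extend_largeData
  hb := by norm_num [largeData]
  hX := dominated_largeDev
  hσX := by norm_num [largeData, abs_div]
  hσ := by norm_num [largeData, abs_div]

/-- The coefficients of `g`, times `2 * 10 ^ 16`. -/
def gList : List ℤ := [10000000000000000, 30000000000000000, 5000000000000000]

lemma gCoeff_eq (k : ℕ) : gCoeff k = (seqZ gList k : ℝ) / (2 * 10 ^ 16) := by
  by_cases hk : k < 3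
  · interval_cases k <;> norm_num [gCoeff, seqZ, gList]
  · rw [gCoeff_of_le (not_lt.1 hk), seqZ, List.getD_eq_default _ _ (not_lt.1 hk)]
    simp

lemma linPart_single_zero : linPart (Pi.single 0 1) = Pi.single 0 1 := by
  funext k
  rw [IsSparseData.linPart_single, Pi.single_eq_of_ne (show 0 ≠ k + 1 by omega)]
  rcases k with _ | k
  · simp [mu]
  · rw [Pi.single_eq_of_ne (show 0 ≠ k + 1 by omega), Pi.single_eq_of_ne (show k + 1 ≠ 0 by omega),
      if_neg (Nat.succ_ne_zero k), Nat.add_sub_cancel]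
    rcases k with _ | k
    · simp [lam]
    · rw [Pi.single_eq_of_ne (show 0 ≠ k + 1 by omega)]; ring

/-- Around the constant `b = -1/σ` the constant terms `b + σ b²` cancel and `2σb = -2` shifts the
diagonal, so the large number `20000` disappears from the defect. -/
lemma f_largeData (k : ℕ) : f largeData.σ (extend largeData.x) k =
    linPart (extend largeDev) k - 2 * extend largeDev k -
      1 / 20000 * conv (extend largeDev) (extend largeDev) k - gCoeff k := by
  have d1 := dominated_largeDev
  have d2 := dominated_single_zero.smul 20000
  rw [extend_largeData, f, linPart_add, linPart_smul, linPart_single_zero,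
    conv_add_left d1 d2 (d1.add d2), conv_add_right d1 d1 d2, conv_smul_left, conv_smul_right,
    conv_comm (extend largeDev) (Pi.single 0 1)]
  simp only [Pi.add_apply, Pi.smul_apply, smul_eq_mul, conv_single_zero, largeData]
  ring

lemma f_largeData_eq (k : ℕ) : f largeData.σ (extend largeData.x) k =
    ((10 ^ 20 * (linZ largeList k - 4 * seqZ largeList k - seqZ gList k) -
      convZ largeList largeList k : ℤ) : ℝ) / (2 * 10 ^ 36) := by
  rw [f_largeData, gCoeff_eq]
  unfold largeDev
  rw [linPart_vecZ (by decide), conv_vecZ (by decide) (by decide), extend_vecZ (by decide)]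
  push_cast; ring

lemma smallDefect_largeData : SmallDefect largeData := by
  refine ⟨fun k hk => ?_, ?_, fun k hk => ?_⟩
  · have h : ∀ k < 20, |10 ^ 20 * (linZ largeList k - 4 * seqZ largeList k - seqZ gList k) -
        convZ largeList largeList k| ≤ 10 ^ 25 := by decide +kernel
    rw [f_largeData_eq]
    exact abs_div_le_of_int (h k hk) (by norm_num) (by norm_num)
  -- Row `m` sees `λ_m` times the last retained coefficient, about `3.94e-11`; this accounts for the
  -- separate bound `SmallDefect.first`.
  · have h : |10 ^ 20 * (linZ largeList 20 - 4 * seqZ largeList 20 - seqZ gList 20) -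
        convZ largeList largeList 20| ≤ 8 * 10 ^ 25 := by decide +kernel
    rw [f_largeData_eq]
    exact abs_div_le_of_int h (by norm_num) (by norm_num)
  · by_cases hk' : k < 39
    · have h : ∀ k < 39, 20 < k → |10 ^ 20 * (linZ largeList k - 4 * seqZ largeList k - seqZ gList k) -
        convZ largeList largeList k| ≤ 10 ^ 22 := by decide +kernel
      rw [f_largeData_eq]
      exact abs_div_le_of_int (h k hk' hk) (by norm_num) (by norm_num)
    · rw [f_largeData, linPart_extend_eq_zero _ hk, conv_extend_eq_zero _ _ (not_lt.1 hk'),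
        extend_of_le _ hk.le, gCoeff_of_le (by omega)]
      simp

/-! ### The family of data -/

/-- A zero of `f` determines the parameter. -/
lemma sigma_unique {x : ℕ → ℝ} {a σ τ : ℝ} (hx : Dominated x a) (h1 : f σ x = 0) (h2 : f τ x = 0) :
    σ = τ := by
  by_contra hne
  -- This entry is the sum of the squares `x_{|j|}²`. If two parameters worked it would vanish,
  -- forcing `x = 0`, which contradicts `g_0 ≠ 0`.
  have hc : conv x x 0 = 0 := by
    have e1 : linPart x 0 + σ * conv x x 0 - gCoeff 0 = 0 := congrFun h1 0
    have e2 : linPart x 0 + τ * conv x x 0 - gCoeff 0 = 0 := congrFun h2 0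
    have e3 : (σ - τ) * conv x x 0 = 0 := by linear_combination e1 - e2
    exact (mul_eq_zero.1 e3).resolve_left (sub_ne_zero.2 hne)
  have hx0 : ∀ k, x k = 0 := fun k => by
    have hs : Summable fun j : ℤ => x j.natAbs * x (((0 : ℕ) : ℤ) - j).natAbs :=
      summable_conv hx.summable hx.abs_le _
    have hsq : ∀ j : ℤ, x j.natAbs * x (((0 : ℕ) : ℤ) - j).natAbs = x j.natAbs ^ 2 := fun j => by
      rw [Nat.cast_zero, zero_sub, Int.natAbs_neg, sq]
    have h3 := hs.le_tsum (k : ℤ) fun j _ => by rw [hsq]; positivity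
    change _ ≤ conv x x 0 at h3
    rw [hc, hsq, Int.natAbs_natCast] at h3
    exact pow_eq_zero_iff two_ne_zero |>.1 (le_antisymm h3 (sq_nonneg _))
  have e1 : linPart x 0 + σ * conv x x 0 - gCoeff 0 = 0 := congrFun h1 0
  rw [hc, linPart, if_pos rfl, hx0, hx0] at e1
  norm_num [gCoeff] at e1

/-- The parameter values on the branch. -/
def familySigma (p : Bool × Fin 675) : ℝ :=
  (if p.1 then 1 else -1) * (((p.2 : ℕ) : ℝ) + 1) * 10 ^ (-7 : ℤ)

/-- The index of the data near the constant `20000`. -/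
def largeIndex : Bool × Fin 675 := (false, 674)

open Classical in
/-- The family of numerical data. -/
def family (p : Bool × Fin 675) : NumData :=
  if p = largeIndex then largeData else branchData (familySigma p)

lemma family_large : family largeIndex = largeData := if_pos rfl

lemma family_of_ne {p : Bool × Fin 675} (hp : p ≠ largeIndex) :
    family p = branchData (familySigma p) := if_neg hp

lemma abs_familySigma_le (p : Bool × Fin 675) : |familySigma p| ≤ 675 * 10 ^ (-7 : ℤ) := by
  have h : ((p.2 : ℕ) : ℝ) + 1 ≤ 675 := by exact_mod_cast p.2.2
  have h0 : (0 : ℝ) ≤ ((p.2 : ℕ) : ℝ) := Nat.cast_nonneg _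
  have e : |(if p.1 then 1 else -1 : ℝ)| = 1 := by split_ifs <;> simp
  rw [familySigma, abs_mul, abs_mul, e, one_mul, abs_of_nonneg (by linarith),
    abs_of_pos (by positivity)]
  exact mul_le_mul_of_nonneg_right h (by positivity)

lemma familySigma_injective : Function.Injective familySigma := by
  rintro ⟨s, i⟩ ⟨t, j⟩ h
  have h1 := mul_right_cancel₀ (by positivity) h
  have hi : (0 : ℝ) ≤ ((i : ℕ) : ℝ) := Nat.cast_nonneg _
  have hj : (0 : ℝ) ≤ ((j : ℕ) : ℝ) := Nat.cast_nonneg _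
  cases s <;> cases t <;> norm_num at h1
  · rw [Fin.ext h1]
  · exfalso; linarith
  · exfalso; linarith
  · rw [Fin.ext h1]

lemma radiiNeg_family (p : Bool × Fin 675) {r : ℝ} (hr0 : 4 * 10 ^ (-11 : ℤ) ≤ r)
    (hr : r ≤ 10 ^ (-4 : ℤ)) : RadiiNeg (family p) r := by
  by_cases hp : p = largeIndex
  · rw [hp, family_large]
    exact radiiNeg_of_smallDefect isSparseData_largeData smallDefect_largeData hr0 hr
  · rw [family_of_ne hp]
    have hσ := abs_familySigma_le p
    exact radiiNeg_of_smallDefect (isSparseData_branchData hσ) (smallDefect_branchData hσ) hr0 hr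

/-- The mean value separates the solutions on the branch from the other one. -/
lemma mean_lt_iff {p : Bool × Fin 675} {x : ℕ → ℝ} (hx : x ∈ ballOmega 2 (extend (family p).x) 1) :
    x 0 < 2 ↔ p ≠ largeIndex := by
  have h := (mem_ballOmega_iff.1 hx).abs_le 0
  rw [Pi.sub_apply, abs_le] at h
  by_cases hp : p = largeIndex
  · rw [hp, family_large, extend_largeData, Pi.add_apply, Pi.smul_apply, Pi.single_eq_same] at h
    have h1 := abs_le.1 (dominated_largeDev.abs_le 0)
    simp only [hp, ne_eq, not_true_eq_false, iff_false, not_lt]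
    norm_num at h h1
    linarith
  · rw [family_of_ne hp] at h
    have h1 := abs_le.1 ((dominated_branchData (abs_familySigma_le p)).abs_le 0)
    simp only [ne_eq, hp, not_false_eq_true, iff_true]
    norm_num at h1
    linarith

lemma ballOmega_mono {v : Fin m → ℝ} {r s : ℝ} (h : r ≤ s) :
    ballOmega 2 (extend v) r ⊆ ballOmega 2 (extend v) s := fun _ hx => ⟨hx.1, hx.2.1, hx.2.2.trans h⟩

/-- The mean value decides whether the index is `largeIndex`; among branch solutions, equality
forces equal `σ`, and `familySigma` is injective. -/
lemma family_solution_injective {x : Bool × Fin 675 → ℕ → ℝ} {r : ℝ} (hr : r ≤ 1)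
    (hx : ∀ p, IsUniqueTrueSolution (family p) r (x p)) : Function.Injective x := by
  intro p q h
  have hp := mean_lt_iff (ballOmega_mono hr (hx p).1)
  have hq := mean_lt_iff (ballOmega_mono hr (hx q).1)
  rw [h] at hp
  have hpq : p = largeIndex ↔ q = largeIndex := not_iff_not.1 (hp.symm.trans hq)
  by_cases hl : p = largeIndex
  · rw [hl, hpq.1 hl]
  · have h1 := (hx p).2.1
    have h2 := (hx q).2.1
    rw [family_of_ne hl, h] at h1
    rw [family_of_ne fun h => hl (hpq.2 h)] at h2
    exact familySigma_injective
      (sigma_unique (dominated_of_sub_extend (mem_ballOmega_iff.1 (hx q).1)) h1 h2)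

lemma family_sigma_pos (i : Fin 675) : 0 < (family (true, i)).σ := by
  rw [family_of_ne (by simp [largeIndex])]
  change 0 < familySigma _
  simp only [familySigma, if_true]
  positivity

lemma family_sigma_neg (i : Fin 675) : (family (false, i)).σ < 0 := by
  by_cases h : ((false, i) : Bool × Fin 675) = largeIndex
  · rw [h, family_large]; norm_num [largeData]
  · rw [family_of_ne h]
    change familySigma _ < 0
    have h0 : (0 : ℝ) ≤ ((i : ℕ) : ℝ) := Nat.cast_nonneg _
    simp only [familySigma, Bool.false_eq_true, if_false]
    exact mul_neg_of_neg_of_pos (by linarith) (by positivity)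

lemma exists_family_sigma_eq : ∃ p q, p ≠ q ∧ (family p).σ = (family q).σ := by
  have hne : ((false, 499) : Bool × Fin 675) ≠ largeIndex := by
    unfold largeIndex; decide
  -- Index `499` stands for `-(499 + 1) · 10⁻⁷ = -1/20000`, the parameter of the large solution.
  refine ⟨(false, 499), largeIndex, hne, ?_⟩
  rw [family_of_ne hne, family_large]
  change familySigma (false, 499) = -1 / 20000
  have e : (((499 : Fin 675) : ℕ) : ℝ) = 499 := by
    rw [show ((499 : Fin 675) : ℕ) = 499 from rfl]; norm_num
  simp only [familySigma, Bool.false_eq_true, if_false, e]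
  norm_num

end TridiagExample

end

theorem mainTheorem9 :
    (∀ d : TridiagExample.NumData, TridiagExample.RadiiNeg d (10 ^ (-10 : ℤ)) →
      ∃ x : ℕ → ℝ, TridiagExample.IsUniqueTrueSolution d (10 ^ (-10 : ℤ)) x) ∧
    ∃ (d : Bool × Fin 675 → TridiagExample.NumData) (x : Bool × Fin 675 → ℕ → ℝ),
      (∀ i, 0 < (d (true, i)).σ) ∧ (∀ i, (d (false, i)).σ < 0) ∧
      (∀ p, ∀ r ∈ Set.Icc (4 * 10 ^ (-11 : ℤ) : ℝ) (10 ^ (-4 : ℤ)),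
        TridiagExample.RadiiNeg (d p) r) ∧
      (∀ p, TridiagExample.IsUniqueTrueSolution (d p) (10 ^ (-10 : ℤ)) (x p)) ∧
      Function.Injective x ∧
      (∃ p q, p ≠ q ∧ (d p).σ = (d q).σ) := by
  have hpart : ∀ d : TridiagExample.NumData, TridiagExample.RadiiNeg d (10 ^ (-10 : ℤ)) →
      ∃ x : ℕ → ℝ, TridiagExample.IsUniqueTrueSolution d (10 ^ (-10 : ℤ)) x := fun d hd =>
    TridiagExample.exists_isUniqueTrueSolution (by positivity) hd
  choose x hx using fun p => hpart (TridiagExample.family p)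
    (TridiagExample.radiiNeg_family p (by norm_num) (by norm_num))
  exact ⟨hpart, TridiagExample.family, x, TridiagExample.family_sigma_pos,
    TridiagExample.family_sigma_neg,
    fun p r hr => TridiagExample.radiiNeg_family p hr.1 hr.2, hx,
    TridiagExample.family_solution_injective (by norm_num) hx,
    TridiagExample.exists_family_sigma_eq⟩
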